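/- Let $M$ be a connected smooth surface, $f:M\to\mathbb{R}^3$ a smooth immersion and $N$ a smooth unit normal field along $f$. Call $k$ a principal curvature at $p$, with principal vector $v\in T_pM\setminus\{0\}$, if $dN_p(v)=-k\,df_p(v)$. Assume that $M$ is free of umbilic points, let $k_1>k_2$ be the principal curvatures, and let $\mathcal{P}_1$ be the foliation by the lines of curvature of $k_1$. For $\alpha\in(-\pi/2,\pi/2)$ let $\mathcal{F}_\alpha^{+}$ and $\mathcal{F}_\alpha^{-}$ be the foliations of $M$ whose leaves make the constant oriented angle $\alpha$, respectively $-\alpha$, with the leaves of $\mathcal{P}_1$. A regular curve on $M$ is a Darboux curve if at each of its points an osculating sphere (a sphere or plane having contact of order at least $3$ with the curve) is tangent to the surface. The surface is conformal to a Dupin cyclide if a Möbius transformation of $\mathbf{S}^3=\mathbb{R}^3\cup\{\infty\}$ maps $f(M)$ into one of the following: (A) the boundary of a tubular neighbourhood of a geodesic of $\mathbf{S}^3$, that is $\{y\in\mathbf{S}^3\subset\mathbb{R}^4 : y_1^2+y_2^2=a^2\}$ with $0<a<1$; (B) a cylinder of revolution in $\mathbb{R}^3$; (C) a cone of revolution in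 $\mathbb{R}^3$ without its vertex. A principal chart is a smooth chart $(u,v)$ of $M$ whose curves $v=\mathrm{const}$ and $u=\mathrm{const}$ are lines of curvature for $k_1$ and $k_2$, respectively. Then the following are equivalent: 1. for every $\alpha\in(-\pi/2,\pi/2)$, all leaves of $\mathcal{F}_\alpha^{+}$ and of $\mathcal{F}_\alpha^{-}$ are Darboux curves; 2. for some $\alpha\in(-\pi/2,\pi/2)$, $\alpha\neq 0$, all leaves of $\mathcal{F}_\alpha^{+}$ and of $\mathcal{F}_\alpha^{-}$ are Darboux curves; 3. the surface is conformal to a Dupin cyclide; 4. around every point of $M$ there is a principal chart $(u,v)$ in which $\dfrac{\partial k_1}{\partial u}=\dfrac{\partial k_2}{\partial v}=0$. Moreover, in any principal chart $(u,v)$ on an open set $U\subset M$, the condition $\dfrac{\partial k_1}{\partial u}=\dfrac{\partial k_2}{\partial v}=0$ holds on all of $U$ if and only if condition 1 holds for the leaves of $\mathcal{F}_\alpha^{\pm}$ restricted to $U$, and if and only if condition 2 holds for them. -/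

import Mathlib

open Set
open scoped Manifold ContDiff

/-- Euclidean three-space. -/
abbrev E3 : Type := EuclideanSpace ℝ (Fin 3)

/-- The coordinate plane. -/
abbrev E2 : Type := EuclideanSpace ℝ (Fin 2)

/-- The vector space underlying the five-dimensional Lorentz space. -/
abbrev L5 : Type := Fin 5 → ℝ

/-! ### Points, spheres and Möbius transformations in the Lorentz model -/

/-- The Lorentz bilinear form `-x₀y₀ + x₁y₁ + x₂y₂ + x₃y₃ + x₄y₄`. -/
def lorentz (x y : L5) : ℝ :=
  -(x 0 * y 0) + x 1 * y 1 + x 2 * y 2 + x 3 * y 3 + x 4 * y 4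

/-- The point of the light cone that represents the point `x` of Euclidean space: Euclidean space
is the section of the light cone by the affine hyperplane `y₀ - y₄ = 2`. -/
noncomputable def lightLift (x : E3) : L5 :=
  ![‖x‖ ^ 2 + 1, 2 * x 0, 2 * x 1, 2 * x 2, ‖x‖ ^ 2 - 1]

/-- The unit three-sphere, as the section of the light cone by the hyperplane `y₀ = 1`. -/
def lightSphere : Set L5 := {y | lorentz y y = 0 ∧ y 0 = 1}

/-- Central projection of the light cone without its vertex to the three-sphere `y₀ = 1`. For a
point `x` of Euclidean space, `toSphere (lightLift x)` is its image under inverse stereographic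
projection. -/
noncomputable def toSphere (y : L5) : L5 := (y 0)⁻¹ • y

/-- A Lorentz transformation of the five-dimensional Lorentz space. -/
def IsLorentz (A : L5 ≃ₗ[ℝ] L5) : Prop := ∀ x y, lorentz (A x) (A y) = lorentz x y

/-- A point of de Sitter space, i.e. an oriented sphere of the three-sphere; in Euclidean space it
is the round sphere or plane with equation `lorentz σ (lightLift x) = 0`. -/
def IsSphere (σ : L5) : Prop := lorentz σ σ = 1

/-! ### Dupin cyclides -/

/-- The set of points of the three-sphere at a constant distance from a great circle. -/
def cliffordTorus (a : ℝ) : Set L5 := {y ∈ lightSphere | y 1 ^ 2 + y 2 ^ 2 = a ^ 2}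

/-- The cylinder of revolution of radius `r`. -/
def roundCylinder (r : ℝ) : Set E3 := {x | x 0 ^ 2 + x 1 ^ 2 = r ^ 2}

/-- The cone of revolution of slope parameter `m`, without its vertex. -/
def roundCone (m : ℝ) : Set E3 := {x | x 0 ^ 2 + x 1 ^ 2 = m ^ 2 * x 2 ^ 2 ∧ x 2 ≠ 0}

/-- The representatives of the three conformal types of Dupin cyclides, as subsets of the
three-sphere: the boundary of a tubular neighbourhood of a geodesic of the three-sphere, a cylinder
of revolution, and a cone of revolution (regular points only). -/
def IsStandardCyclide (D : Set L5) : Prop :=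
  (∃ a : ℝ, 0 < a ∧ a < 1 ∧ D = cliffordTorus a) ∨
  (∃ r : ℝ, 0 < r ∧ D = (fun x => toSphere (lightLift x)) '' roundCylinder r) ∨
  (∃ m : ℝ, 0 < m ∧ D = (fun x => toSphere (lightLift x)) '' roundCone m)

/-- The image of `f` is conformal to a piece of a Dupin cyclide: a Möbius transformation (the
action of a Lorentz transformation on the rays of the light cone) carries it into one of the
standard cyclides. -/
def ConformalToDupinCyclide {M : Type*} (f : M → E3) : Prop :=
  ∃ D : Set L5, IsStandardCyclide D ∧ ∃ A : L5 ≃ₗ[ℝ] L5, IsLorentz A ∧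
    ∀ p, toSphere (A (lightLift (f p))) ∈ D

/-! ### Surfaces and their principal directions -/

section Surface

variable {M : Type*} [TopologicalSpace M] [ChartedSpace E2 M]

/-- The differential at `p` of a map from the surface to a normed space; the tangent space of the
surface at `p` is by definition the coordinate plane of the preferred chart at `p`. -/
noncomputable def surfDeriv {F : Type*} [NormedAddCommGroup F] [NormedSpace ℝ F] (g : M → F)
    (p : M) : E2 →L[ℝ] F :=
  mfderiv (𝓡 2) 𝓘(ℝ, F) g p

/-- `f` is a smooth immersed surface in Euclidean three-space and `N` is a smooth unit normal
field along it. -/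
structure IsOrientedSurface (f N : M → E3) : Prop where
  smooth : ContMDiff (𝓡 2) (𝓡 3) ∞ f
  immersion : ∀ p, Function.Injective (surfDeriv f p)
  smooth_normal : ContMDiff (𝓡 2) (𝓡 3) ∞ N
  norm_normal : ∀ p, ‖N p‖ = 1
  normal : ∀ p (v : E2), inner ℝ (N p) (surfDeriv f p v) = 0

/-- The point `p` is umbilic: the differential of `N` at `p` is a multiple of that of `f`. -/
def IsUmbilic (f N : M → E3) (p : M) : Prop :=
  ∃ k : ℝ, ∀ v : E2, surfDeriv N p v = -(k • surfDeriv f p v)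

/-- `e` is a tangent vector at `p` with `dN = -k df` on it; if `e ≠ 0`, this says that `e` spans a
principal direction with principal curvature `k`. -/
def IsPrincipalVector (f N : M → E3) (p : M) (k : ℝ) (e : E3) : Prop :=
  ∃ v : E2, surfDeriv f p v = e ∧ surfDeriv N p v = -(k • e)

/-- `(e₁, e₂)` is an orthonormal frame of principal directions at `p`, positively oriented with
respect to `N`, with principal curvatures `k₁ > k₂`. -/
structure IsPrincipalFrame (f N : M → E3) (p : M) (k₁ k₂ : ℝ) (e₁ e₂ : E3) : Prop where
  lt : k₂ < k₁
  principal₁ : IsPrincipalVector f N p k₁ e₁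
  principal₂ : IsPrincipalVector f N p k₂ e₂
  norm₁ : ‖e₁‖ = 1
  norm₂ : ‖e₂‖ = 1
  orthogonal : inner ℝ e₁ e₂ = 0
  oriented : 0 < (Matrix.of ![⇑e₁, ⇑e₂, ⇑(N p)]).det

/-- `φ` is a principal chart with coordinates `(u, v)`: the curves `v = const` (`u = const`) are
lines of curvature of the first (second) family, and `k₁ > k₂` are the principal curvatures as
functions of `(u, v)`. -/
structure IsPrincipalChart (f N : M → E3) (φ : OpenPartialHomeomorph M E2)
    (k₁ k₂ : E2 → ℝ) : Prop where
  chart : φ ∈ IsManifold.maximalAtlas (𝓡 2) ∞ M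
  lt : ∀ x ∈ φ.target, k₂ x < k₁ x
  principal₁ : ∀ x ∈ φ.target,
    fderiv ℝ (N ∘ φ.symm) x (EuclideanSpace.single 0 1) =
      -(k₁ x • fderiv ℝ (f ∘ φ.symm) x (EuclideanSpace.single 0 1))
  principal₂ : ∀ x ∈ φ.target,
    fderiv ℝ (N ∘ φ.symm) x (EuclideanSpace.single 1 1) =
      -(k₂ x • fderiv ℝ (f ∘ φ.symm) x (EuclideanSpace.single 1 1))

/-- `∂k₁/∂u = ∂k₂/∂v = 0` on the domain of the coordinates of the chart `φ`. -/
def RidgeDerivativesVanish (φ : OpenPartialHomeomorph M E2) (k₁ k₂ : E2 → ℝ) : Prop :=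
  ∀ x ∈ φ.target, fderiv ℝ k₁ x (EuclideanSpace.single 0 1) = 0 ∧
    fderiv ℝ k₂ x (EuclideanSpace.single 1 1) = 0

/-! ### Constant-angle foliations and Darboux curves -/

/-- The restriction of `c` to the interval `(a, b)` is a regular smooth arc on the surface that
makes the constant oriented angle `θ` with the first principal foliation, i.e. an arc of a leaf of
the constant-angle foliation of angle `θ`. -/
def IsLeafArc (f N : M → E3) (θ : ℝ) (c : ℝ → M) (a b : ℝ) : Prop :=
  ContMDiffOn 𝓘(ℝ, ℝ) (𝓡 2) ∞ c (Ioo a b) ∧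
  ∀ t ∈ Ioo a b, ∃ (k₁ k₂ : ℝ) (e₁ e₂ : E3) (r : ℝ),
    IsPrincipalFrame f N (c t) k₁ k₂ e₁ e₂ ∧ r ≠ 0 ∧
    deriv (f ∘ c) t = r • (Real.cos θ • e₁ + Real.sin θ • e₂)

/-- The sphere `σ` is tangent to the surface at `f p`: the equation of the sphere vanishes at `p`
together with its differential along the surface. -/
def SphereTangentAt (f : M → E3) (σ : L5) (p : M) : Prop :=
  lorentz σ (lightLift (f p)) = 0 ∧ surfDeriv (fun q => lorentz σ (lightLift (f q))) p = 0

/-- The sphere `σ` has contact of order at least three with the curve `γ` at time `t`, that is, it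
is an osculating sphere of `γ` there. -/
def OsculatesAt (γ : ℝ → E3) (σ : L5) (t : ℝ) : Prop :=
  ∀ j ≤ 3, iteratedDeriv j (fun s => lorentz σ (lightLift (γ s))) t = 0

/-- The regular arc `c` on `(a, b)` is a Darboux curve: at each point its osculating sphere (one of
them, where it is not unique) is tangent to the surface. -/
def IsDarbouxArc (f : M → E3) (c : ℝ → M) (a b : ℝ) : Prop :=
  ContMDiffOn 𝓘(ℝ, ℝ) (𝓡 2) ∞ c (Ioo a b) ∧
  ∀ t ∈ Ioo a b, deriv (f ∘ c) t ≠ 0 ∧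
    ∃ σ : L5, IsSphere σ ∧ OsculatesAt (f ∘ c) σ t ∧ SphereTangentAt f σ (c t)

/-- On the part `U` of the surface, the leaves of both foliations of constant angle `α` and `-α`
with the first principal foliation are Darboux curves. -/
def LeavesAreDarboux (f N : M → E3) (α : ℝ) (U : Set M) : Prop :=
  ∀ (c : ℝ → M) (a b : ℝ), MapsTo c (Ioo a b) U →
    (IsLeafArc f N α c a b ∨ IsLeafArc f N (-α) c a b) → IsDarbouxArc f c a b

end Surface

/-! ### Algebra of the Lorentz form -/

/-! Everything is computed in the Lorentz model. The surface becomes a map `m` into the light cone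
with `⟨l, m⟩ = -1` for a fixed null vector `l` (the point at infinity), its tangent planes become
unit spacelike vectors `n`, and the tangent spheres at a point are `±(n + k m)`. All four conditions
are compared with one local condition, `RidgesVanish`: in unit principal fields, `X₁ k₁ = X₂ k₂ =
0`.

Darboux leaves. For a curve of constant angle `θ`, second-order contact forces a tangent sphere to
be `±(n + κ m)`, with `κ = cos² θ k₁ + sin² θ k₂` the normal curvature. By the Codazzi equations,
third-order contact then amounts to `cos³ θ X₁ k₁ + sin³ θ X₂ k₂ = 0` (`normal_sphere_third`,
`FrameField.darboux_iff`). Using `θ = α` and `θ = -α` with `α ≠ 0` separates the two terms.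

Principal charts. If the ridge derivatives vanish, the Codazzi equations make the fields `Xᵢ / (k₁ -
k₂)` commute (`PrincipalField.cyclideField`), and commuting fields are coordinate fields
(`exists_rectifying`). Conversely, the coordinate fields of a principal chart can be normalized to
unit ones.

From ridges to cyclides. The curvature spheres `sᵢ = n + kᵢ m` are constant along `Xᵢ`, so each
family is a curve in de Sitter space. With the conformal normalization let `v` and `a` be velocity
and acceleration of `s₁`. Five-dimensionality expresses the acceleration of `s₂` through `s₁, s₂, a`
(`accel_swap`), and differentiation yields that `q = ⟨a, a⟩` is locally constant and that `a' = -q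
v`. So `s₁` runs on a conic in a fixed plane. The data `q`, `a + q s₁` and `q ⟨v, ·⟩² + ⟨a, ·⟩²` do
not depend on the chart and are constant on the connected surface. Evaluated at `s₁ - s₂`, a
multiple of `m`, they give equations for all points. The values of `q` for the two families add up
to `1`, so one of them is positive, and `√q < 1`, `= 1`, `> 1` yields the torus, the cylinder and
the cone (`exists_standardCyclide`).

From cyclides to ridges. Each standard cyclide has an equation `y₁² + y₂² = ⟨y, n₀⟩²`, which
exhibits two one-parameter families of tangent spheres. Such a family consists of curvature spheres,
and having one parameter only it is stationary along its own lines of curvature, which is the ridge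
condition (`ridge_of_tangentSphereCurves`, `ridge_of_cyclide`). -/

theorem lorentz_comm (x y : L5) : lorentz x y = lorentz y x := by
  simp only [lorentz]; ring

theorem lorentz_add_left (x y z : L5) : lorentz (x + y) z = lorentz x z + lorentz y z := by
  simp only [lorentz, Pi.add_apply]; ring

theorem lorentz_add_right (x y z : L5) : lorentz x (y + z) = lorentz x y + lorentz x z := by
  simp only [lorentz, Pi.add_apply]; ring

theorem lorentz_sub_left (x y z : L5) : lorentz (x - y) z = lorentz x z - lorentz y z := by
  simp only [lorentz, Pi.sub_apply]; ring

theorem lorentz_sub_right (x y z : L5) : lorentz x (y - z) = lorentz x y - lorentz x z := by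
  simp only [lorentz, Pi.sub_apply]; ring

theorem lorentz_neg_left (x y : L5) : lorentz (-x) y = -lorentz x y := by
  simp only [lorentz, Pi.neg_apply]; ring

theorem lorentz_neg_right (x y : L5) : lorentz x (-y) = -lorentz x y := by
  simp only [lorentz, Pi.neg_apply]; ring

theorem lorentz_smul_left (c : ℝ) (x y : L5) : lorentz (c • x) y = c * lorentz x y := by
  simp only [lorentz, Pi.smul_apply, smul_eq_mul]; ring

theorem lorentz_smul_right (c : ℝ) (x y : L5) : lorentz x (c • y) = c * lorentz x y := by
  simp only [lorentz, Pi.smul_apply, smul_eq_mul]; ring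

theorem lorentz_zero_left (y : L5) : lorentz 0 y = 0 := by simp [lorentz]

theorem lorentz_zero_right (y : L5) : lorentz y 0 = 0 := by simp [lorentz]

/-- The Lorentz form as a continuous bilinear map. -/
noncomputable def lorentzBilin : L5 →L[ℝ] L5 →L[ℝ] ℝ :=
  (LinearMap.mk₂ ℝ lorentz lorentz_add_left lorentz_smul_left lorentz_add_right
    lorentz_smul_right).toContinuousBilinearMap

@[simp] theorem lorentzBilin_apply (x y : L5) : lorentzBilin x y = lorentz x y := rfl

theorem lorentz_eq_mulVec (x y : L5) :
    lorentz x y = x ⬝ᵥ (Matrix.diagonal ![-1, 1, 1, 1, 1]).mulVec y := by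
  simp [lorentz, dotProduct, Matrix.mulVec_diagonal, Fin.sum_univ_five]

/-- Expansion of a vector with respect to a basis `d` with the help of its Lorentz-dual basis
`b`. -/
theorem eq_sum_of_lorentz_dual (b d : Fin 5 → L5)
    (h : ∀ i j, lorentz (b i) (d j) = if i = j then 1 else 0) (y : L5) :
    y = ∑ i, lorentz (b i) y • d i := by
  set J : Matrix (Fin 5) (Fin 5) ℝ := Matrix.diagonal ![-1, 1, 1, 1, 1]
  have h1 : (Matrix.of b * J) * (Matrix.of d).transpose = 1 := by
    ext i j
    rw [Matrix.mul_assoc, Matrix.one_apply, ← h i j, lorentz_eq_mulVec]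
    simp only [Matrix.mul_apply, dotProduct, Matrix.mulVec, Matrix.of_apply,
      Matrix.transpose_apply]
    rfl
  -- Duality is the matrix identity `(B J) Dᵀ = 1`; for square matrices also `Dᵀ (B J) = 1`, which
  -- is the expansion.
  have h2 := mul_eq_one_comm.mp h1
  have h3 : ((Matrix.of d).transpose * (Matrix.of b * J)).mulVec y = y := by
    rw [h2, Matrix.one_mulVec]
  rw [← Matrix.mulVec_mulVec] at h3
  conv_lhs => rw [← h3]
  ext k
  simp only [Finset.sum_apply, Pi.smul_apply, smul_eq_mul]
  simp only [Matrix.mulVec, dotProduct, Matrix.transpose_apply, Matrix.of_apply]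
  refine Finset.sum_congr rfl fun i _ => ?_
  rw [mul_comm]
  congr 1
  rw [lorentz_eq_mulVec]
  simp only [J, dotProduct, Matrix.mulVec_diagonal, Matrix.mul_diagonal, Matrix.of_apply]
  exact Finset.sum_congr rfl fun i _ => by ring

/-- Expansion with respect to a frame `m, l, e₁, e₂, n` consisting of two null vectors with product
`-1` and three orthonormal vectors orthogonal to them. -/
theorem null_frame_expansion {m l e₁ e₂ n : L5} (mm : lorentz m m = 0) (ll : lorentz l l = 0)
    (lm : lorentz l m = -1) (me₁ : lorentz m e₁ = 0) (me₂ : lorentz m e₂ = 0)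
    (mn : lorentz m n = 0) (le₁ : lorentz l e₁ = 0) (le₂ : lorentz l e₂ = 0)
    (ln : lorentz l n = 0) (e₁₁ : lorentz e₁ e₁ = 1) (e₁₂ : lorentz e₁ e₂ = 0)
    (e₂₂ : lorentz e₂ e₂ = 1) (ne₁ : lorentz n e₁ = 0) (ne₂ : lorentz n e₂ = 0)
    (nn : lorentz n n = 1) (y : L5) :
    y = -lorentz l y • m - lorentz m y • l + lorentz e₁ y • e₁ + lorentz e₂ y • e₂
      + lorentz n y • n := by
  have ml := (lorentz_comm m l).trans lm
  have e₁m := (lorentz_comm e₁ m).trans me₁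
  have e₂m := (lorentz_comm e₂ m).trans me₂
  have nm := (lorentz_comm n m).trans mn
  have e₁l := (lorentz_comm e₁ l).trans le₁
  have e₂l := (lorentz_comm e₂ l).trans le₂
  have nl := (lorentz_comm n l).trans ln
  have e₂₁ := (lorentz_comm e₂ e₁).trans e₁₂
  have e₁n := (lorentz_comm e₁ n).trans ne₁
  have e₂n := (lorentz_comm e₂ n).trans ne₂
  have := eq_sum_of_lorentz_dual ![m, l, e₁, e₂, n] ![-l, -m, e₁, e₂, n] (by
    intro i j
    fin_cases i <;> fin_cases j <;> simp [lorentz_neg_right, *]) y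
  rw [Fin.sum_univ_five] at this
  simp only [Matrix.cons_val] at this
  conv_lhs => rw [this]
  module

/-- A Lorentz orthonormal basis whose first vector is timelike gives coordinates that form a
Lorentz transformation. -/
theorem exists_isLorentz_of_orthonormal (b : Fin 5 → L5)
    (h : ∀ i j, lorentz (b i) (b j) = if i = j then (if i = 0 then -1 else 1) else 0) :
    ∃ A : L5 ≃ₗ[ℝ] L5, IsLorentz A ∧
      ∀ y i, A y i = (if i = 0 then -1 else 1) * lorentz (b i) y := by
  have key : ∀ y : L5, y = ∑ i, ((if i = 0 then -1 else 1) * lorentz (b i) y) • b i := by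
    intro y
    refine (eq_sum_of_lorentz_dual (fun i => (if i = 0 then (-1 : ℝ) else 1) • b i) b ?_ y).trans ?_
    · intro i j
      rw [lorentz_smul_left, h]
      by_cases hij : i = j <;> by_cases hi : i = 0 <;> simp [hij, hi]
      · subst hij; simp [hi]
      · subst hij; simp [hi]
    · simp only [lorentz_smul_left]
  let F : L5 →ₗ[ℝ] L5 :=
    { toFun := fun y i => (if i = 0 then -1 else 1) * lorentz (b i) y
      map_add' := fun x y => by ext i; simp only [lorentz_add_right, Pi.add_apply]; ring
      map_smul' := fun c y => by
        ext i; simp only [lorentz_smul_right, Pi.smul_apply, smul_eq_mul, RingHom.id_apply]; ring }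
  have hinj : Function.Injective F := by
    intro x y hxy
    rw [key x, key y]
    refine Finset.sum_congr rfl fun i _ => ?_
    have := congrFun hxy i
    simp only [F, LinearMap.coe_mk, AddHom.coe_mk] at this
    rw [this]
  refine ⟨LinearEquiv.ofInjectiveEndo F hinj, ?_, fun y i => rfl⟩
  intro x y
  have hx := key x
  have hxy : lorentz x y = ∑ i, ((if i = 0 then -1 else 1) * lorentz (b i) x) * lorentz (b i) y := by
    conv_lhs => rw [key x]
    simp only [Fin.sum_univ_five, lorentz_add_left, lorentz_smul_left]
  rw [hxy, Fin.sum_univ_five]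
  simp only [LinearEquiv.coe_ofInjectiveEndo, F, LinearMap.coe_mk, AddHom.coe_mk, lorentz]
  simp
  ring

/-! ### Directional derivatives along vector fields of the plane -/

section DirDeriv

variable {F : Type*} [NormedAddCommGroup F] [NormedSpace ℝ F] {V : Set E2} {X Y : E2 → E2}
  {g g' : E2 → F} {x : E2}

/-- The derivative of `g` along the vector field `X`. -/
noncomputable def dirDeriv (X : E2 → E2) (g : E2 → F) : E2 → F := fun x => fderiv ℝ g x (X x)

theorem ContDiffOn.differentiableAt_of_isOpen (hV : IsOpen V) (hg : ContDiffOn ℝ ∞ g V)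
    (hx : x ∈ V) : DifferentiableAt ℝ g x :=
  (hg.contDiffAt (hV.mem_nhds hx)).differentiableAt (by simp)

theorem ContDiffOn.dirDeriv (hV : IsOpen V) (hX : ContDiffOn ℝ ∞ X V) (hg : ContDiffOn ℝ ∞ g V) :
    ContDiffOn ℝ ∞ (dirDeriv X g) V :=
  (hg.fderiv_of_isOpen hV (by simp)).clm_apply hX

theorem dirDeriv_congr (hV : IsOpen V) (h : EqOn g g' V) : EqOn (dirDeriv X g) (dirDeriv X g') V :=
  fun _ hx => by
    simp only [dirDeriv, (h.eventuallyEq_of_mem (hV.mem_nhds hx)).fderiv_eq]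

theorem dirDeriv_const_on (hV : IsOpen V) {c : F} (h : ∀ x ∈ V, g x = c) (hx : x ∈ V) :
    dirDeriv X g x = 0 := by
  rw [dirDeriv_congr (g' := fun _ => c) hV h hx]
  simp [dirDeriv]

theorem dirDeriv_add (hg : DifferentiableAt ℝ g x) (hg' : DifferentiableAt ℝ g' x) :
    dirDeriv X (fun y => g y + g' y) x = dirDeriv X g x + dirDeriv X g' x := by
  simp [dirDeriv, fderiv_fun_add hg hg']

theorem dirDeriv_sub (hg : DifferentiableAt ℝ g x) (hg' : DifferentiableAt ℝ g' x) :
    dirDeriv X (fun y => g y - g' y) x = dirDeriv X g x - dirDeriv X g' x := by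
  simp [dirDeriv, fderiv_fun_sub hg hg']

theorem dirDeriv_neg : dirDeriv X (fun y => -g y) x = -dirDeriv X g x := by
  simp [dirDeriv, fderiv_fun_neg]

theorem dirDeriv_const_smul (c : ℝ) (hg : DifferentiableAt ℝ g x) :
    dirDeriv X (fun y => c • g y) x = c • dirDeriv X g x := by
  simp [dirDeriv, fderiv_fun_const_smul hg]

theorem dirDeriv_smul {a : E2 → ℝ} (ha : DifferentiableAt ℝ a x) (hg : DifferentiableAt ℝ g x) :
    dirDeriv X (fun y => a y • g y) x = a x • dirDeriv X g x + dirDeriv X a x • g x := by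
  simp [dirDeriv, fderiv_fun_smul ha hg]

theorem dirDeriv_linear (c s : ℝ) (hg : DifferentiableAt ℝ g x) (hg' : DifferentiableAt ℝ g' x) :
    dirDeriv X (fun y => c • g y + s • g' y) x = c • dirDeriv X g x + s • dirDeriv X g' x := by
  rw [dirDeriv_add (hg.fun_const_smul c) (hg'.fun_const_smul s), dirDeriv_const_smul c hg,
    dirDeriv_const_smul s hg']

theorem dirDeriv_combination (c s : ℝ) (g : E2 → F) : dirDeriv (fun y => c • X y + s • Y y) g =
    fun y => c • dirDeriv X g y + s • dirDeriv Y g y := by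
  ext y
  simp [dirDeriv]

theorem dirDeriv_mul {a b : E2 → ℝ} (ha : DifferentiableAt ℝ a x) (hb : DifferentiableAt ℝ b x) :
    dirDeriv X (fun y => a y * b y) x = a x * dirDeriv X b x + dirDeriv X a x * b x :=
  dirDeriv_smul ha hb

theorem dirDeriv_lorentz {g g' : E2 → L5} (hg : DifferentiableAt ℝ g x)
    (hg' : DifferentiableAt ℝ g' x) :
    dirDeriv X (fun y => lorentz (g y) (g' y)) x =
      lorentz (dirDeriv X g x) (g' x) + lorentz (g x) (dirDeriv X g' x) := by
  have := lorentzBilin.fderiv_of_bilinear hg hg'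
  simp only [lorentzBilin_apply] at this
  simp [dirDeriv, this, add_comm]

theorem ContDiffOn.lorentz {E : Type*} [NormedAddCommGroup E] [NormedSpace ℝ E] {s : Set E}
    {g g' : E → L5} (hg : ContDiffOn ℝ ∞ g s) (hg' : ContDiffOn ℝ ∞ g' s) :
    ContDiffOn ℝ ∞ (fun y => lorentz (g y) (g' y)) s :=
  ContDiffOn.clm_apply (f := fun y => lorentzBilin (g y))
    (lorentzBilin.contDiff.comp_contDiffOn hg) hg'

theorem lorentz_dirDeriv_of_const (hV : IsOpen V) {g g' : E2 → L5} (hg : ContDiffOn ℝ ∞ g V)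
    (hg' : ContDiffOn ℝ ∞ g' V) {c : ℝ} (h : ∀ x ∈ V, lorentz (g x) (g' x) = c) (hx : x ∈ V) :
    lorentz (dirDeriv X g x) (g' x) + lorentz (g x) (dirDeriv X g' x) = 0 := by
  rw [← dirDeriv_lorentz (hg.differentiableAt_of_isOpen hV hx)
    (hg'.differentiableAt_of_isOpen hV hx)]
  exact dirDeriv_const_on hV h hx

theorem lorentz_self_dirDeriv_of_const (hV : IsOpen V) {g : E2 → L5} (hg : ContDiffOn ℝ ∞ g V)
    {c : ℝ} (h : ∀ x ∈ V, lorentz (g x) (g x) = c) (hx : x ∈ V) :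
    lorentz (g x) (dirDeriv X g x) = 0 := by
  have := lorentz_dirDeriv_of_const (X := X) hV hg hg h hx
  rw [lorentz_comm (dirDeriv X g x)] at this
  linarith

theorem dirDeriv_comm_sub (hV : IsOpen V) (hg : ContDiffOn ℝ ∞ g V) (hX : ContDiffOn ℝ ∞ X V)
    (hY : ContDiffOn ℝ ∞ Y V) (hx : x ∈ V) :
    dirDeriv X (dirDeriv Y g) x - dirDeriv Y (dirDeriv X g) x =
      fderiv ℝ g x (VectorField.lieBracket ℝ X Y x) :=
  (VectorField.fderiv_apply_lieBracket (n := 2) ((hg.contDiffAt (hV.mem_nhds hx)).of_le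
    (WithTop.coe_le_coe.mpr (le_top : (2 : ℕ∞) ≤ ⊤))) (by simp) (hY.differentiableAt_of_isOpen hV hx)
    (hX.differentiableAt_of_isOpen hV hx)).symm

end DirDeriv

/-- Two planar vectors with images under a linear map that are nonzero and orthogonal span the
plane. -/
theorem exists_eq_smul_add_smul {L : E2 →ₗ[ℝ] L5} {v w : E2} (hv : lorentz (L v) (L v) ≠ 0)
    (hw : lorentz (L w) (L w) ≠ 0) (hvw : lorentz (L v) (L w) = 0) (z : E2) :
    ∃ a b : ℝ, z = a • v + b • w := by
  have hli : LinearIndependent ℝ ![v, w] := by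
    rw [LinearIndependent.pair_iff]
    intro s t hst
    have h0 : s • L v + t • L w = 0 := by rw [← map_smul, ← map_smul, ← map_add, hst, map_zero]
    have h1 := congrArg (lorentz (L v)) h0
    have h2 := congrArg (fun y => lorentz y (L w)) h0
    simp only [lorentz_add_right, lorentz_smul_right, lorentz_zero_right, hvw, mul_zero, add_zero,
      lorentz_add_left, lorentz_smul_left, lorentz_zero_left, zero_add] at h1 h2
    exact ⟨(mul_eq_zero.mp h1).resolve_right hv, (mul_eq_zero.mp h2).resolve_right hw⟩
  have hspan := hli.span_eq_top_of_card_eq_finrank (by simp)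
  have hz : z ∈ Submodule.span ℝ (Set.range ![v, w]) := by rw [hspan]; trivial
  rw [Matrix.range_cons, Matrix.range_cons, Matrix.range_empty, Set.union_empty,
    Set.singleton_union, Submodule.mem_span_pair] at hz
  obtain ⟨a, b, h⟩ := hz
  exact ⟨a, b, h.symm⟩

/-! ### Principal frame fields in the Lorentz model -/

/-- A surface in the light cone (position `m`, tangent sphere `n` of the normal field, constant
null vector `l`) over the planar domain `V`, with the unit vector fields `X₁`, `X₂` of principal
directions and the principal curvatures `k₁ > k₂`. -/
structure PrincipalField (V : Set E2) (m n : E2 → L5) (l : L5) (k₁ k₂ : E2 → ℝ)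
    (X₁ X₂ : E2 → E2) : Prop where
  isOpen : IsOpen V
  smooth_m : ContDiffOn ℝ ∞ m V
  smooth_n : ContDiffOn ℝ ∞ n V
  smooth_k₁ : ContDiffOn ℝ ∞ k₁ V
  smooth_k₂ : ContDiffOn ℝ ∞ k₂ V
  smooth_X₁ : ContDiffOn ℝ ∞ X₁ V
  smooth_X₂ : ContDiffOn ℝ ∞ X₂ V
  lt : ∀ x ∈ V, k₂ x < k₁ x
  mm : ∀ x ∈ V, lorentz (m x) (m x) = 0
  nm : ∀ x ∈ V, lorentz (n x) (m x) = 0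
  nn : ∀ x ∈ V, lorentz (n x) (n x) = 1
  ll : lorentz l l = 0
  lm : ∀ x ∈ V, lorentz l (m x) = -1
  ln : ∀ x ∈ V, lorentz l (n x) = 0
  ne₁ : ∀ x ∈ V, lorentz (n x) (dirDeriv X₁ m x) = 0
  ne₂ : ∀ x ∈ V, lorentz (n x) (dirDeriv X₂ m x) = 0
  dn₁ : ∀ x ∈ V, dirDeriv X₁ n x = -(k₁ x • dirDeriv X₁ m x)
  dn₂ : ∀ x ∈ V, dirDeriv X₂ n x = -(k₂ x • dirDeriv X₂ m x)
  unit₁ : ∀ x ∈ V, lorentz (dirDeriv X₁ m x) (dirDeriv X₁ m x) = 1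
  unit₂ : ∀ x ∈ V, lorentz (dirDeriv X₂ m x) (dirDeriv X₂ m x) = 1
  orth : ∀ x ∈ V, lorentz (dirDeriv X₁ m x) (dirDeriv X₂ m x) = 0

namespace PrincipalField

variable {V : Set E2} {m n : E2 → L5} {l : L5} {k₁ k₂ : E2 → ℝ} {X₁ X₂ : E2 → E2} {x : E2}

section
variable (P : PrincipalField V m n l k₁ k₂ X₁ X₂)
include P

theorem smooth_e₁ : ContDiffOn ℝ ∞ (dirDeriv X₁ m) V := P.smooth_X₁.dirDeriv P.isOpen P.smooth_m

theorem smooth_e₂ : ContDiffOn ℝ ∞ (dirDeriv X₂ m) V := P.smooth_X₂.dirDeriv P.isOpen P.smooth_m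

theorem m_dirDeriv (Y : E2 → E2) (hx : x ∈ V) : lorentz (m x) (dirDeriv Y m x) = 0 :=
  lorentz_self_dirDeriv_of_const P.isOpen P.smooth_m P.mm hx

theorem l_dirDeriv_m (Y : E2 → E2) (hx : x ∈ V) : lorentz l (dirDeriv Y m x) = 0 := by
  have := lorentz_dirDeriv_of_const (X := Y) (g := fun _ => l) P.isOpen contDiffOn_const P.smooth_m
    P.lm hx
  rwa [dirDeriv_const_on P.isOpen (g := fun _ => l) (fun _ _ => rfl) hx, lorentz_zero_left,
    zero_add] at this

theorem expansion (hx : x ∈ V) (y : L5) :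
    y = -lorentz l y • m x - lorentz (m x) y • l + lorentz (dirDeriv X₁ m x) y • dirDeriv X₁ m x
      + lorentz (dirDeriv X₂ m x) y • dirDeriv X₂ m x + lorentz (n x) y • n x :=
  null_frame_expansion (P.mm x hx) P.ll (P.lm x hx) (P.m_dirDeriv X₁ hx) (P.m_dirDeriv X₂ hx)
    (by rw [lorentz_comm, P.nm x hx]) (P.l_dirDeriv_m X₁ hx) (P.l_dirDeriv_m X₂ hx) (P.ln x hx)
    (P.unit₁ x hx) (P.orth x hx) (P.unit₂ x hx) (P.ne₁ x hx) (P.ne₂ x hx) (P.nn x hx) y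

/-- Of the five coefficients in `expansion`, tangency kills those of `l` and of the two tangent
vectors. -/
theorem tangent_sphere_eq (hx : x ∈ V) {σ : L5} (h : lorentz σ (m x) = 0)
    (h₁ : lorentz σ (dirDeriv X₁ m x) = 0) (h₂ : lorentz σ (dirDeriv X₂ m x) = 0) :
    σ = lorentz σ (n x) • n x - lorentz σ l • m x := by
  have := P.expansion hx σ
  rw [lorentz_comm (m x), h, lorentz_comm _ σ, lorentz_comm _ σ, lorentz_comm _ σ, lorentz_comm _ σ,
    h₁, h₂] at this
  conv_lhs => rw [this]
  module

theorem exists_eq (hx : x ∈ V) (z : E2) : ∃ a b : ℝ, z = a • X₁ x + b • X₂ x := by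
  have h₁ : lorentz (dirDeriv X₁ m x) (dirDeriv X₁ m x) ≠ 0 := by simp [P.unit₁ x hx]
  have h₂ : lorentz (dirDeriv X₂ m x) (dirDeriv X₂ m x) ≠ 0 := by simp [P.unit₂ x hx]
  exact exists_eq_smul_add_smul (L := (fderiv ℝ m x : E2 →ₗ[ℝ] L5)) h₁ h₂ (P.orth x hx) z

/-- Differentiating the constant products of the frame `m, e₁, e₂, n` determines the components of
the second derivatives of `m` along these vectors. Only the rotation coefficients `⟨e₂, X₁ e₁⟩` and
`⟨e₂, X₂ e₁⟩` remain free; the bracket and the Codazzi equations are expressed by them. -/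
theorem m_d₁e₁ (hx : x ∈ V) : lorentz (m x) (dirDeriv X₁ (dirDeriv X₁ m) x) = -1 := by
  have := lorentz_dirDeriv_of_const (X := X₁) P.isOpen P.smooth_m P.smooth_e₁
    (fun y hy => P.m_dirDeriv X₁ hy) hx
  linarith [P.unit₁ x hx]

theorem m_d₂e₂ (hx : x ∈ V) : lorentz (m x) (dirDeriv X₂ (dirDeriv X₂ m) x) = -1 := by
  have := lorentz_dirDeriv_of_const (X := X₂) P.isOpen P.smooth_m P.smooth_e₂
    (fun y hy => P.m_dirDeriv X₂ hy) hx
  linarith [P.unit₂ x hx]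

theorem m_d₁e₂ (hx : x ∈ V) : lorentz (m x) (dirDeriv X₁ (dirDeriv X₂ m) x) = 0 := by
  have := lorentz_dirDeriv_of_const (X := X₁) P.isOpen P.smooth_m P.smooth_e₂
    (fun y hy => P.m_dirDeriv X₂ hy) hx
  linarith [P.orth x hx]

theorem m_d₂e₁ (hx : x ∈ V) : lorentz (m x) (dirDeriv X₂ (dirDeriv X₁ m) x) = 0 := by
  have := lorentz_dirDeriv_of_const (X := X₂) P.isOpen P.smooth_m P.smooth_e₁
    (fun y hy => P.m_dirDeriv X₁ hy) hx
  linarith [P.orth x hx, lorentz_comm (dirDeriv X₁ m x) (dirDeriv X₂ m x)]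

theorem n_d₁e₁ (hx : x ∈ V) : lorentz (n x) (dirDeriv X₁ (dirDeriv X₁ m) x) = k₁ x := by
  have := lorentz_dirDeriv_of_const (X := X₁) P.isOpen P.smooth_n P.smooth_e₁ P.ne₁ hx
  rw [P.dn₁ x hx, lorentz_neg_left, lorentz_smul_left, P.unit₁ x hx] at this
  linarith

theorem n_d₂e₂ (hx : x ∈ V) : lorentz (n x) (dirDeriv X₂ (dirDeriv X₂ m) x) = k₂ x := by
  have := lorentz_dirDeriv_of_const (X := X₂) P.isOpen P.smooth_n P.smooth_e₂ P.ne₂ hx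
  rw [P.dn₂ x hx, lorentz_neg_left, lorentz_smul_left, P.unit₂ x hx] at this
  linarith

theorem n_d₁e₂ (hx : x ∈ V) : lorentz (n x) (dirDeriv X₁ (dirDeriv X₂ m) x) = 0 := by
  have := lorentz_dirDeriv_of_const (X := X₁) P.isOpen P.smooth_n P.smooth_e₂ P.ne₂ hx
  rw [P.dn₁ x hx, lorentz_neg_left, lorentz_smul_left, P.orth x hx] at this
  linarith

theorem n_d₂e₁ (hx : x ∈ V) : lorentz (n x) (dirDeriv X₂ (dirDeriv X₁ m) x) = 0 := by
  have := lorentz_dirDeriv_of_const (X := X₂) P.isOpen P.smooth_n P.smooth_e₁ P.ne₁ hx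
  rw [P.dn₂ x hx, lorentz_neg_left, lorentz_smul_left, lorentz_comm, P.orth x hx] at this
  linarith

theorem e₁_d₁e₁ (hx : x ∈ V) : lorentz (dirDeriv X₁ m x) (dirDeriv X₁ (dirDeriv X₁ m) x) = 0 :=
  lorentz_self_dirDeriv_of_const P.isOpen P.smooth_e₁ P.unit₁ hx

theorem e₁_d₂e₁ (hx : x ∈ V) : lorentz (dirDeriv X₁ m x) (dirDeriv X₂ (dirDeriv X₁ m) x) = 0 :=
  lorentz_self_dirDeriv_of_const P.isOpen P.smooth_e₁ P.unit₁ hx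

theorem e₂_d₁e₂ (hx : x ∈ V) : lorentz (dirDeriv X₂ m x) (dirDeriv X₁ (dirDeriv X₂ m) x) = 0 :=
  lorentz_self_dirDeriv_of_const P.isOpen P.smooth_e₂ P.unit₂ hx

theorem e₂_d₂e₂ (hx : x ∈ V) : lorentz (dirDeriv X₂ m x) (dirDeriv X₂ (dirDeriv X₂ m) x) = 0 :=
  lorentz_self_dirDeriv_of_const P.isOpen P.smooth_e₂ P.unit₂ hx

theorem e₁_d₁e₂ (hx : x ∈ V) : lorentz (dirDeriv X₁ m x) (dirDeriv X₁ (dirDeriv X₂ m) x) =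
    -lorentz (dirDeriv X₂ m x) (dirDeriv X₁ (dirDeriv X₁ m) x) := by
  have := lorentz_dirDeriv_of_const (X := X₁) P.isOpen P.smooth_e₁ P.smooth_e₂ P.orth hx
  rw [lorentz_comm _ (dirDeriv X₂ m x)] at this
  linarith

theorem e₁_d₂e₂ (hx : x ∈ V) : lorentz (dirDeriv X₁ m x) (dirDeriv X₂ (dirDeriv X₂ m) x) =
    -lorentz (dirDeriv X₂ m x) (dirDeriv X₂ (dirDeriv X₁ m) x) := by
  have := lorentz_dirDeriv_of_const (X := X₂) P.isOpen P.smooth_e₁ P.smooth_e₂ P.orth hx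
  rw [lorentz_comm _ (dirDeriv X₂ m x)] at this
  linarith

/-- The coefficients of the bracket of the principal fields. -/
theorem lieBracket_eq (hx : x ∈ V) : VectorField.lieBracket ℝ X₁ X₂ x =
    -lorentz (dirDeriv X₂ m x) (dirDeriv X₁ (dirDeriv X₁ m) x) • X₁ x
      - lorentz (dirDeriv X₂ m x) (dirDeriv X₂ (dirDeriv X₁ m) x) • X₂ x := by
  obtain ⟨a, b, hab⟩ := P.exists_eq hx (VectorField.lieBracket ℝ X₁ X₂ x)
  have h := dirDeriv_comm_sub P.isOpen P.smooth_m P.smooth_X₁ P.smooth_X₂ hx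
  rw [hab, map_add, map_smul, map_smul] at h
  change _ = a • dirDeriv X₁ m x + b • dirDeriv X₂ m x at h
  have h1 := congrArg (lorentz (dirDeriv X₁ m x)) h
  have h2 := congrArg (lorentz (dirDeriv X₂ m x)) h
  simp only [lorentz_sub_right, lorentz_add_right, lorentz_smul_right, P.unit₁ x hx, P.orth x hx,
    P.unit₂ x hx, lorentz_comm (dirDeriv X₂ m x) (dirDeriv X₁ m x), P.e₁_d₁e₂ hx, P.e₁_d₂e₁ hx,
    P.e₂_d₁e₂ hx] at h1 h2
  rw [hab, show a = -lorentz (dirDeriv X₂ m x) (dirDeriv X₁ (dirDeriv X₁ m) x) by linarith,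
    show b = -lorentz (dirDeriv X₂ m x) (dirDeriv X₂ (dirDeriv X₁ m) x) by linarith]
  module

theorem dd_n₁₂ (hx : x ∈ V) : dirDeriv X₁ (dirDeriv X₂ n) x =
    -(k₂ x • dirDeriv X₁ (dirDeriv X₂ m) x + dirDeriv X₁ k₂ x • dirDeriv X₂ m x) := by
  rw [dirDeriv_congr P.isOpen P.dn₂ hx, dirDeriv_neg, dirDeriv_smul
    (P.smooth_k₂.differentiableAt_of_isOpen P.isOpen hx)
    (P.smooth_e₂.differentiableAt_of_isOpen P.isOpen hx)]

theorem dd_n₂₁ (hx : x ∈ V) : dirDeriv X₂ (dirDeriv X₁ n) x =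
    -(k₁ x • dirDeriv X₂ (dirDeriv X₁ m) x + dirDeriv X₂ k₁ x • dirDeriv X₁ m x) := by
  rw [dirDeriv_congr P.isOpen P.dn₁ hx, dirDeriv_neg, dirDeriv_smul
    (P.smooth_k₁.differentiableAt_of_isOpen P.isOpen hx)
    (P.smooth_e₁.differentiableAt_of_isOpen P.isOpen hx)]

/-- The Codazzi equations. -/
theorem codazzi (hx : x ∈ V) :
    dirDeriv X₂ k₁ x = (k₁ x - k₂ x) *
        lorentz (dirDeriv X₂ m x) (dirDeriv X₁ (dirDeriv X₁ m) x) ∧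
      dirDeriv X₁ k₂ x = (k₁ x - k₂ x) *
        lorentz (dirDeriv X₂ m x) (dirDeriv X₂ (dirDeriv X₁ m) x) := by
  -- The bracket acting on `n` is evaluated once by second derivatives and once by its coefficients;
  -- the `e₁` and `e₂` components are compared.
  have h := dirDeriv_comm_sub P.isOpen P.smooth_n P.smooth_X₁ P.smooth_X₂ hx
  rw [P.lieBracket_eq hx, map_sub, map_smul, map_smul, P.dd_n₁₂ hx, P.dd_n₂₁ hx] at h
  change _ = _ • dirDeriv X₁ n x - _ • dirDeriv X₂ n x at h
  rw [P.dn₁ x hx, P.dn₂ x hx] at h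
  have h1 := congrArg (lorentz (dirDeriv X₁ m x)) h
  have h2 := congrArg (lorentz (dirDeriv X₂ m x)) h
  simp only [lorentz_sub_right, lorentz_add_right, lorentz_smul_right, lorentz_neg_right,
    P.unit₁ x hx, P.orth x hx,
    P.unit₂ x hx, lorentz_comm (dirDeriv X₂ m x) (dirDeriv X₁ m x), P.e₁_d₁e₂ hx, P.e₁_d₂e₁ hx,
    P.e₂_d₁e₂ hx] at h1 h2
  constructor <;> linarith

end

end PrincipalField

namespace PrincipalField

variable {V : Set E2} {m n : E2 → L5} {l : L5} {k₁ k₂ : E2 → ℝ} {X₁ X₂ : E2 → E2} {x : E2}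
variable (P : PrincipalField V m n l k₁ k₂ X₁ X₂)
include P

/-! ### The contact condition for curves of constant angle -/

theorem smooth_combination (c s : ℝ) : ContDiffOn ℝ ∞ (fun y => c • X₁ y + s • X₂ y) V :=
  ContDiffOn.add (f := fun y => c • X₁ y) (g := fun y => s • X₂ y) (P.smooth_X₁.const_smul c)
    (P.smooth_X₂.const_smul s)

theorem dirDeriv_dirDeriv_combination (c s : ℝ) (hx : x ∈ V) :
    dirDeriv (fun y => c • X₁ y + s • X₂ y) (dirDeriv (fun y => c • X₁ y + s • X₂ y) m) x =
      (c * c) • dirDeriv X₁ (dirDeriv X₁ m) x + (c * s) • dirDeriv X₂ (dirDeriv X₁ m) x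
      + (c * s) • dirDeriv X₁ (dirDeriv X₂ m) x + (s * s) • dirDeriv X₂ (dirDeriv X₂ m) x := by
  have d₁ := P.smooth_e₁.differentiableAt_of_isOpen P.isOpen hx
  have d₂ := P.smooth_e₂.differentiableAt_of_isOpen P.isOpen hx
  rw [dirDeriv_combination c s m, dirDeriv_combination]
  simp only
  rw [dirDeriv_linear c s d₁ d₂, dirDeriv_linear c s d₁ d₂]
  module

theorem m_second (c s : ℝ) (hcs : c ^ 2 + s ^ 2 = 1) (hx : x ∈ V) :
    lorentz (m x) (dirDeriv (fun y => c • X₁ y + s • X₂ y)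
      (dirDeriv (fun y => c • X₁ y + s • X₂ y) m) x) = -1 := by
  rw [P.dirDeriv_dirDeriv_combination c s hx]
  simp only [lorentz_add_right, lorentz_smul_right, P.m_d₁e₁ hx, P.m_d₁e₂ hx, P.m_d₂e₁ hx,
    P.m_d₂e₂ hx]
  linarith

theorem n_second (c s : ℝ) (hx : x ∈ V) :
    lorentz (n x) (dirDeriv (fun y => c • X₁ y + s • X₂ y)
      (dirDeriv (fun y => c • X₁ y + s • X₂ y) m) x) = c ^ 2 * k₁ x + s ^ 2 * k₂ x := by
  rw [P.dirDeriv_dirDeriv_combination c s hx]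
  simp only [lorentz_add_right, lorentz_smul_right, P.n_d₁e₁ hx, P.n_d₁e₂ hx, P.n_d₂e₁ hx,
    P.n_d₂e₂ hx]
  ring

/-- With `T = c X₁ + s X₂` and `κ` the normal curvature, `⟨n + κ m, T T m⟩ = 0` holds identically.
Differentiating along `T` moves the third derivative onto `T (n + κ m)`, which involves only `m`,
`e₁`, `e₂`. The mixed terms `X₂ k₁` and `X₁ k₂` of `T κ` then cancel against the rotation
coefficients by the Codazzi equations. -/
theorem normal_sphere_third (c s : ℝ) (hcs : c ^ 2 + s ^ 2 = 1) (hx : x ∈ V) :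
    lorentz (n x + (c ^ 2 * k₁ x + s ^ 2 * k₂ x) • m x)
      (dirDeriv (fun y => c • X₁ y + s • X₂ y) (dirDeriv (fun y => c • X₁ y + s • X₂ y)
        (dirDeriv (fun y => c • X₁ y + s • X₂ y) m)) x) =
      c ^ 3 * dirDeriv X₁ k₁ x + s ^ 3 * dirDeriv X₂ k₂ x := by
  set T : E2 → E2 := fun y => c • X₁ y + s • X₂ y with hT
  have sT : ContDiffOn ℝ ∞ T V := P.smooth_combination c s
  have s2 : ContDiffOn ℝ ∞ (dirDeriv T (dirDeriv T m)) V :=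
    sT.dirDeriv P.isOpen (sT.dirDeriv P.isOpen P.smooth_m)
  have sκ : ContDiffOn ℝ ∞ (fun y => c ^ 2 * k₁ y + s ^ 2 * k₂ y) V :=
    (contDiffOn_const.mul P.smooth_k₁).add (contDiffOn_const.mul P.smooth_k₂)
  have sG : ContDiffOn ℝ ∞ (fun y => n y + (c ^ 2 * k₁ y + s ^ 2 * k₂ y) • m y) V :=
    P.smooth_n.add (sκ.smul P.smooth_m)
  have h := lorentz_dirDeriv_of_const (X := T) P.isOpen sG s2 (c := 0) (fun y hy => by
    rw [lorentz_add_left, lorentz_smul_left, P.n_second c s hy, P.m_second c s hcs hy]; ring) hx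
  have dκ : dirDeriv T (fun y => c ^ 2 * k₁ y + s ^ 2 * k₂ y) x =
      c ^ 2 * (c * dirDeriv X₁ k₁ x + s * dirDeriv X₂ k₁ x) +
        s ^ 2 * (c * dirDeriv X₁ k₂ x + s * dirDeriv X₂ k₂ x) := by
    have d₁ := P.smooth_k₁.differentiableAt_of_isOpen P.isOpen hx
    have d₂ := P.smooth_k₂.differentiableAt_of_isOpen P.isOpen hx
    have := dirDeriv_linear (X := T) (c ^ 2) (s ^ 2) d₁ d₂
    rw [show dirDeriv T k₁ x = _ from congrFun (dirDeriv_combination c s k₁) x,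
      show dirDeriv T k₂ x = _ from congrFun (dirDeriv_combination c s k₂) x] at this
    exact this
  have dG : dirDeriv T (fun y => n y + (c ^ 2 * k₁ y + s ^ 2 * k₂ y) • m y) x =
      dirDeriv T (fun y => c ^ 2 * k₁ y + s ^ 2 * k₂ y) x • m x
      - (c * s ^ 2 * (k₁ x - k₂ x)) • dirDeriv X₁ m x
      + (s * c ^ 2 * (k₁ x - k₂ x)) • dirDeriv X₂ m x := by
    rw [dirDeriv_add (g' := fun y => (c ^ 2 * k₁ y + s ^ 2 * k₂ y) • m y)
      (P.smooth_n.differentiableAt_of_isOpen P.isOpen hx)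
      ((sκ.smul P.smooth_m).differentiableAt_of_isOpen P.isOpen hx),
      dirDeriv_smul (sκ.differentiableAt_of_isOpen P.isOpen hx)
      (P.smooth_m.differentiableAt_of_isOpen P.isOpen hx), dirDeriv_combination c s n,
      dirDeriv_combination c s m]
    simp only
    rw [P.dn₁ x hx, P.dn₂ x hx]
    match_scalars
    · linear_combination (c * k₁ x) * hcs
    · linear_combination (s * k₂ x) * hcs
    · ring
  have he₁ : lorentz (dirDeriv X₁ m x) (dirDeriv T (dirDeriv T m) x) =
      -s * (c * lorentz (dirDeriv X₂ m x) (dirDeriv X₁ (dirDeriv X₁ m) x)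
        + s * lorentz (dirDeriv X₂ m x) (dirDeriv X₂ (dirDeriv X₁ m) x)) := by
    rw [P.dirDeriv_dirDeriv_combination c s hx]
    simp only [lorentz_add_right, lorentz_smul_right, P.e₁_d₁e₁ hx, P.e₁_d₁e₂ hx, P.e₁_d₂e₁ hx,
      P.e₁_d₂e₂ hx]
    ring
  have he₂ : lorentz (dirDeriv X₂ m x) (dirDeriv T (dirDeriv T m) x) =
      c * (c * lorentz (dirDeriv X₂ m x) (dirDeriv X₁ (dirDeriv X₁ m) x)
        + s * lorentz (dirDeriv X₂ m x) (dirDeriv X₂ (dirDeriv X₁ m) x)) := by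
    rw [P.dirDeriv_dirDeriv_combination c s hx]
    simp only [lorentz_add_right, lorentz_smul_right, P.e₂_d₁e₂ hx, P.e₂_d₂e₂ hx]
    ring
  obtain ⟨c₁, c₂⟩ := P.codazzi hx
  rw [dG, lorentz_add_left, lorentz_sub_left, lorentz_smul_left, lorentz_smul_left,
    lorentz_smul_left, P.m_second c s hcs hx, he₁, he₂, dκ, c₁, c₂] at h
  set w₁ := lorentz (dirDeriv X₂ m x) (dirDeriv X₁ (dirDeriv X₁ m) x)
  set w₂ := lorentz (dirDeriv X₂ m x) (dirDeriv X₂ (dirDeriv X₁ m) x)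
  linear_combination h - (c * s * (k₁ x - k₂ x) * (c * w₁ + s * w₂)) * hcs

/-- A tangent sphere that has contact of order three with a curve of constant angle exists only
where the ridge expression of that angle vanishes. -/
theorem ridge_of_contact {c s : ℝ} (hcs : c ^ 2 + s ^ 2 = 1) (hx : x ∈ V) {σ : L5}
    (hσ : IsSphere σ) (h₀ : lorentz σ (m x) = 0) (h₁ : lorentz σ (dirDeriv X₁ m x) = 0)
    (h₂ : lorentz σ (dirDeriv X₂ m x) = 0)
    (hs : lorentz σ (dirDeriv (fun y => c • X₁ y + s • X₂ y)
      (dirDeriv (fun y => c • X₁ y + s • X₂ y) m) x) = 0)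
    (ht : lorentz σ (dirDeriv (fun y => c • X₁ y + s • X₂ y)
      (dirDeriv (fun y => c • X₁ y + s • X₂ y)
        (dirDeriv (fun y => c • X₁ y + s • X₂ y) m)) x) = 0) :
    c ^ 3 * dirDeriv X₁ k₁ x + s ^ 3 * dirDeriv X₂ k₂ x = 0 := by
  have h := P.tangent_sphere_eq hx h₀ h₁ h₂
  set ε := lorentz σ (n x)
  set μ := lorentz σ l
  have hε : ε * ε = 1 := by
    have := hσ
    rw [IsSphere, h] at this
    simpa [lorentz_sub_left, lorentz_sub_right, lorentz_smul_left, lorentz_smul_right, P.nn x hx,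
      P.nm x hx, P.mm x hx, lorentz_comm (m x) (n x)] using this
  rw [h, lorentz_sub_left, lorentz_smul_left, lorentz_smul_left, P.n_second c s hx,
    P.m_second c s hcs hx] at hs
  -- Second-order contact leaves, up to the sign `ε`, only the sphere whose curvature is the normal
  -- curvature.
  have hG : σ = ε • (n x + (c ^ 2 * k₁ x + s ^ 2 * k₂ x) • m x) := by
    rw [h, smul_add, smul_smul, show μ = -(ε * (c ^ 2 * k₁ x + s ^ 2 * k₂ x)) by linarith]
    module
  rw [hG, lorentz_smul_left, P.normal_sphere_third c s hcs hx] at ht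
  exact (mul_eq_zero.mp ht).resolve_left (by rintro h0; rw [h0] at hε; norm_num at hε)

/-- Where the ridge expression vanishes there is a tangent sphere that has contact of order three
with the curves of constant angle. -/
theorem contact_of_ridge {c s : ℝ} (hcs : c ^ 2 + s ^ 2 = 1) (hx : x ∈ V)
    (h : c ^ 3 * dirDeriv X₁ k₁ x + s ^ 3 * dirDeriv X₂ k₂ x = 0) :
    ∃ σ : L5, IsSphere σ ∧ lorentz σ (m x) = 0 ∧ (∀ Y, lorentz σ (dirDeriv Y m x) = 0) ∧
    lorentz σ (dirDeriv (fun y => c • X₁ y + s • X₂ y)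
      (dirDeriv (fun y => c • X₁ y + s • X₂ y) m) x) = 0 ∧
    lorentz σ (dirDeriv (fun y => c • X₁ y + s • X₂ y)
      (dirDeriv (fun y => c • X₁ y + s • X₂ y)
        (dirDeriv (fun y => c • X₁ y + s • X₂ y) m)) x) = 0 := by
  refine ⟨n x + (c ^ 2 * k₁ x + s ^ 2 * k₂ x) • m x, ?_, ?_, fun Y => ?_, ?_, ?_⟩
  · simp [IsSphere, lorentz_add_left, lorentz_add_right, lorentz_smul_left, lorentz_smul_right,
      P.nn x hx, P.nm x hx, P.mm x hx, lorentz_comm (m x) (n x)]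
  · simp [lorentz_add_left, lorentz_smul_left, P.nm x hx, P.mm x hx]
  · obtain ⟨a, b, hab⟩ := P.exists_eq hx (Y x)
    have : dirDeriv Y m x = a • dirDeriv X₁ m x + b • dirDeriv X₂ m x := by
      simp [dirDeriv, hab]
    rw [this]
    simp [lorentz_add_left, lorentz_smul_left, lorentz_add_right, lorentz_smul_right, P.ne₁ x hx,
      P.ne₂ x hx, P.m_dirDeriv X₁ hx, P.m_dirDeriv X₂ hx]
  · rw [lorentz_add_left, lorentz_smul_left, P.n_second c s hx, P.m_second c s hcs hx]
    ring
  · rw [P.normal_sphere_third c s hcs hx, h]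

end PrincipalField

/-! ### Contact of curves with spheres -/

section Contact

variable {V : Set E2} {T : E2 → E2} {I : Set ℝ} {γ : ℝ → E2} {r : ℝ → ℝ} {g : E2 → ℝ} {t : ℝ}

theorem HasDerivAt.comp_dirDeriv (hV : IsOpen V) (hγ : HasDerivAt γ (r t • T (γ t)) t)
    (hm : γ t ∈ V) (hg : ContDiffOn ℝ ∞ g V) :
    HasDerivAt (fun s => g (γ s)) (r t * dirDeriv T g (γ t)) t := by
  have := (hg.differentiableAt_of_isOpen hV hm).hasFDerivAt.comp_hasDerivAt t hγ
  rw [map_smul] at this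
  exact this

/-- Contact of order three, at parameter `t`, of an arbitrarily parametrized integral curve of the
field `T` with the zero set of `g`. -/
theorem iteratedDeriv_comp_eq_zero_iff (hV : IsOpen V) (hI : IsOpen I) (hT : ContDiffOn ℝ ∞ T V)
    (hr : ContDiffOn ℝ ∞ r I) (hmaps : MapsTo γ I V)
    (hγ : ∀ s ∈ I, HasDerivAt γ (r s • T (γ s)) s) (hg : ContDiffOn ℝ ∞ g V) (ht : t ∈ I)
    (hr0 : r t ≠ 0) :
    (∀ j ≤ 3, iteratedDeriv j (fun s => g (γ s)) t = 0) ↔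
      g (γ t) = 0 ∧ dirDeriv T g (γ t) = 0 ∧ dirDeriv T (dirDeriv T g) (γ t) = 0 ∧
        dirDeriv T (dirDeriv T (dirDeriv T g)) (γ t) = 0 := by
  have s1 := hT.dirDeriv hV hg
  have s2 := hT.dirDeriv hV s1
  have hr1 : ContDiffOn ℝ ∞ (deriv r) I := hr.deriv_of_isOpen hI (by simp)
  have dr : ∀ s ∈ I, HasDerivAt r (deriv r s) s := fun s hs =>
    ((hr.contDiffAt (hI.mem_nhds hs)).differentiableAt (by simp)).hasDerivAt
  have dr1 : ∀ s ∈ I, HasDerivAt (deriv r) (deriv (deriv r) s) s := fun s hs =>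
    ((hr1.contDiffAt (hI.mem_nhds hs)).differentiableAt (by simp)).hasDerivAt
  -- The first three derivatives in the parameter are triangular combinations of the derivatives
  -- along `T`, with diagonal entries `r`, `r²`, `r³`; where `r` is nonzero, both systems vanish
  -- together.
  have e1 : ∀ s ∈ I, iteratedDeriv 1 (fun s => g (γ s)) s = r s * dirDeriv T g (γ s) :=
    fun s hs => by
      rw [iteratedDeriv_one]
      exact (HasDerivAt.comp_dirDeriv hV (hγ s hs) (hmaps hs) hg).deriv
  have e2 : ∀ s ∈ I, iteratedDeriv 2 (fun s => g (γ s)) s =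
      deriv r s * dirDeriv T g (γ s) + r s * (r s * dirDeriv T (dirDeriv T g) (γ s)) :=
    fun s hs => by
      rw [iteratedDeriv_succ, (EqOn.eventuallyEq_of_mem e1 (hI.mem_nhds hs)).deriv_eq]
      exact ((dr s hs).mul (HasDerivAt.comp_dirDeriv hV (hγ s hs) (hmaps hs) s1)).deriv
  have e3 : iteratedDeriv 3 (fun s => g (γ s)) t =
      (deriv (deriv r) t * dirDeriv T g (γ t) +
        deriv r t * (r t * dirDeriv T (dirDeriv T g) (γ t))) +
      (deriv r t * (r t * dirDeriv T (dirDeriv T g) (γ t)) +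
        r t * (deriv r t * dirDeriv T (dirDeriv T g) (γ t) +
          r t * (r t * dirDeriv T (dirDeriv T (dirDeriv T g)) (γ t)))) := by
    rw [iteratedDeriv_succ, (EqOn.eventuallyEq_of_mem e2 (hI.mem_nhds ht)).deriv_eq]
    exact (((dr1 t ht).mul (HasDerivAt.comp_dirDeriv hV (hγ t ht) (hmaps ht) s1)).add
      ((dr t ht).mul ((dr t ht).mul
        (HasDerivAt.comp_dirDeriv hV (hγ t ht) (hmaps ht) s2)))).deriv
  constructor
  · intro h
    have h0 : g (γ t) = 0 := by simpa using h 0 (by norm_num)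
    have h1 := h 1 (by norm_num)
    have h2 := h 2 (by norm_num)
    have h3 := h 3 (by norm_num)
    rw [e1 t ht] at h1
    rw [e2 t ht] at h2
    rw [e3] at h3
    have z1 := (mul_eq_zero.mp h1).resolve_left hr0
    rw [z1] at h2 h3
    have z2 : dirDeriv T (dirDeriv T g) (γ t) = 0 := by simpa [hr0] using h2
    rw [z2] at h3
    exact ⟨h0, z1, z2, by simpa [hr0] using h3⟩
  · rintro ⟨h0, z1, z2, z3⟩ j hj
    interval_cases j
    · simpa using h0
    · rw [e1 t ht, z1, mul_zero]
    · rw [e2 t ht, z1, z2]; ring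
    · rw [e3, z1, z2, z3]; ring

end Contact

/-! ### Lifting surfaces of Euclidean space to the light cone -/

/-- The point of the light cone with Lorentz product `-1` with `(1, 0, 0, 0, 1)`. -/
noncomputable def halfLift (x : E3) : L5 := (1 / 2 : ℝ) • lightLift x

/-- The vector `w` at the point `x` of Euclidean space as a vector of Lorentz space orthogonal to
the point: tangent to the light cone, or the plane through `x` with normal `w`. -/
noncomputable def tangentLift (x w : E3) : L5 := ![inner ℝ w x, w 0, w 1, w 2, inner ℝ w x]

theorem inner_E3 (x y : E3) : inner ℝ x y = x 0 * y 0 + x 1 * y 1 + x 2 * y 2 := by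
  simp [PiLp.inner_apply, Fin.sum_univ_three, mul_comm]

theorem norm_sq_E3 (x : E3) : ‖x‖ ^ 2 = x 0 * x 0 + x 1 * x 1 + x 2 * x 2 := by
  rw [← real_inner_self_eq_norm_sq, inner_E3]

theorem lorentz_halfLift_self (x : E3) : lorentz (halfLift x) (halfLift x) = 0 := by
  simp [halfLift, lightLift, lorentz, norm_sq_E3]; ring

theorem lorentz_tangentLift_halfLift (x w : E3) : lorentz (tangentLift x w) (halfLift x) = 0 := by
  simp [halfLift, lightLift, tangentLift, lorentz, norm_sq_E3, inner_E3]; ring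

theorem lorentz_tangentLift (x w w' : E3) :
    lorentz (tangentLift x w) (tangentLift x w') = inner ℝ w w' := by
  simp [tangentLift, lorentz, inner_E3]; ring

theorem lorentz_pole_halfLift (x : E3) : lorentz ![1, 0, 0, 0, 1] (halfLift x) = -1 := by
  simp [halfLift, lightLift, lorentz]; ring

theorem lorentz_pole_tangentLift (x w : E3) :
    lorentz ![1, 0, 0, 0, 1] (tangentLift x w) = 0 := by
  simp [tangentLift, lorentz]

theorem lorentz_pole_self : lorentz ![1, 0, 0, 0, 1] ![1, 0, 0, 0, 1] = 0 := by
  simp [lorentz]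

theorem tangentLift_smul (x w : E3) (c : ℝ) : tangentLift x (c • w) = c • tangentLift x w := by
  ext i; fin_cases i <;> simp [tangentLift, inner_smul_left]

theorem tangentLift_neg (x w : E3) : tangentLift x (-w) = -tangentLift x w := by
  ext i; fin_cases i <;> simp [tangentLift]

theorem contDiff_lightLift : ContDiff ℝ ∞ lightLift := by
  have hsq : ContDiff ℝ ∞ fun x : E3 => ‖x‖ ^ 2 := contDiff_norm_sq ℝ
  rw [contDiff_pi]
  intro i
  fin_cases i <;> simp [lightLift] <;> fun_prop

theorem contDiff_halfLift : ContDiff ℝ ∞ halfLift := contDiff_lightLift.const_smul _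

theorem contDiffOn_tangentLift {V : Set E2} {F G : E2 → E3} (hF : ContDiffOn ℝ ∞ F V)
    (hG : ContDiffOn ℝ ∞ G V) : ContDiffOn ℝ ∞ (fun y => tangentLift (F y) (G y)) V := by
  have hin : ContDiffOn ℝ ∞ (fun y => (inner ℝ (G y) (F y) : ℝ)) V := hG.inner ℝ hF
  rw [contDiffOn_pi]
  intro i
  fin_cases i <;> simp [tangentLift] <;> fun_prop

theorem dirDeriv_apply_E3 {X : E2 → E2} {F : E2 → E3} {x : E2} (hF : DifferentiableAt ℝ F x)
    (i : Fin 3) : dirDeriv X (fun y => F y i) x = dirDeriv X F x i := by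
  have := ((EuclideanSpace.proj (𝕜 := ℝ) i).hasFDerivAt.comp x hF.hasFDerivAt).fderiv
  change fderiv ℝ (fun y => F y i) x = _ at this
  simp [dirDeriv, this]

theorem dirDeriv_apply_L5 {X : E2 → E2} {G : E2 → L5} {x : E2} (hG : DifferentiableAt ℝ G x)
    (i : Fin 5) : dirDeriv X G x i = dirDeriv X (fun y => G y i) x := by
  have := ((ContinuousLinearMap.proj (R := ℝ) (φ := fun _ : Fin 5 => ℝ) i).hasFDerivAt.comp x
    hG.hasFDerivAt).fderiv
  change fderiv ℝ (fun y => G y i) x = _ at this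
  simp [dirDeriv, this]

theorem dirDeriv_inner {X : E2 → E2} {F G : E2 → E3} {x : E2} (hF : DifferentiableAt ℝ F x)
    (hG : DifferentiableAt ℝ G x) : dirDeriv X (fun y => (inner ℝ (F y) (G y) : ℝ)) x =
      inner ℝ (F x) (dirDeriv X G x) + inner ℝ (dirDeriv X F x) (G x) := by
  simp [dirDeriv, fderiv_inner_apply ℝ hF hG]

/-- The factor `1 / 2` in `halfLift` makes it isometric: by `lorentz_tangentLift`, Euclidean inner
products of tangent vectors become Lorentz products. -/
theorem dirDeriv_halfLift {X : E2 → E2} {F : E2 → E3} {x : E2} (hF : DifferentiableAt ℝ F x) :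
    dirDeriv X (fun y => halfLift (F y)) x = tangentLift (F x) (dirDeriv X F x) := by
  have hd : DifferentiableAt ℝ (fun y => halfLift (F y)) x :=
    (contDiff_halfLift.differentiable (by simp) (F x)).comp x hF
  have hsq : dirDeriv X (fun y => ‖F y‖ ^ 2) x = 2 * inner ℝ (dirDeriv X F x) (F x) := by
    have : (fun y => ‖F y‖ ^ 2) = fun y => (inner ℝ (F y) (F y) : ℝ) := by
      ext y; rw [real_inner_self_eq_norm_sq]
    rw [this, dirDeriv_inner hF hF, real_inner_comm]; ring
  have hdsq : DifferentiableAt ℝ (fun y => ‖F y‖ ^ 2) x := hF.norm_sq ℝ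
  have key : ∀ i : Fin 3, dirDeriv X (fun y => (1 / 2 : ℝ) * (2 * F y i)) x = dirDeriv X F x i := by
    intro i
    rw [← dirDeriv_apply_E3 hF]
    congr 1
    ext y; ring
  have hplus : ∀ c : ℝ, dirDeriv X (fun y => (1 / 2 : ℝ) * (‖F y‖ ^ 2 + c)) x =
      inner ℝ (dirDeriv X F x) (F x) := by
    intro c
    have := dirDeriv_const_smul (X := X) (1 / 2 : ℝ) (hdsq.add_const c)
    simp only [smul_eq_mul] at this
    rw [this, dirDeriv_add hdsq (differentiableAt_const c), hsq]
    simp [dirDeriv]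
  ext i
  rw [dirDeriv_apply_L5 hd]
  fin_cases i <;> simp only [halfLift, lightLift, tangentLift, Pi.smul_apply, smul_eq_mul]
  · exact hplus 1
  · exact key 0
  · exact key 1
  · exact key 2
  · simpa [sub_eq_add_neg] using hplus (-1)

/-- The base point enters only through the outer entries `⟨G, F⟩`, and orthogonality of `G` to the
derivative of `F` removes its contribution. -/
theorem dirDeriv_tangentLift {X : E2 → E2} {F G : E2 → E3} {x : E2} (hF : DifferentiableAt ℝ F x)
    (hG : DifferentiableAt ℝ G x) (hGF : inner ℝ (G x) (dirDeriv X F x) = 0) :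
    dirDeriv X (fun y => tangentLift (F y) (G y)) x = tangentLift (F x) (dirDeriv X G x) := by
  have hi : dirDeriv X (fun y => (inner ℝ (G y) (F y) : ℝ)) x = inner ℝ (dirDeriv X G x) (F x) := by
    rw [dirDeriv_inner hG hF, hGF, zero_add]
  have hd : DifferentiableAt ℝ (fun y => tangentLift (F y) (G y)) x := by
    have hin : DifferentiableAt ℝ (fun y => (inner ℝ (G y) (F y) : ℝ)) x := hG.inner ℝ hF
    rw [differentiableAt_pi]
    intro i
    fin_cases i <;> simp [tangentLift] <;> fun_prop
  ext i
  rw [dirDeriv_apply_L5 hd]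
  fin_cases i
  · exact hi
  · exact dirDeriv_apply_E3 hG 0
  · exact dirDeriv_apply_E3 hG 1
  · exact dirDeriv_apply_E3 hG 2
  · exact hi

/-! ### Parametrized surfaces -/

/-- A parametrized immersed surface with a unit normal field. -/
structure SurfacePatch (F G : E2 → E3) (V : Set E2) : Prop where
  isOpen : IsOpen V
  smooth : ContDiffOn ℝ ∞ F V
  smooth_normal : ContDiffOn ℝ ∞ G V
  norm_normal : ∀ x ∈ V, ‖G x‖ = 1
  normal : ∀ x ∈ V, ∀ v, inner ℝ (G x) (fderiv ℝ F x v) = 0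
  immersion : ∀ x ∈ V, ∀ v, fderiv ℝ F x v = 0 → v = 0

/-- An oriented orthonormal principal frame field along a parametrized surface. -/
structure FrameField (F G : E2 → E3) (V : Set E2) (k₁ k₂ : E2 → ℝ) (X₁ X₂ : E2 → E2) : Prop
    extends SurfacePatch F G V where
  smooth_k₁ : ContDiffOn ℝ ∞ k₁ V
  smooth_k₂ : ContDiffOn ℝ ∞ k₂ V
  smooth_X₁ : ContDiffOn ℝ ∞ X₁ V
  smooth_X₂ : ContDiffOn ℝ ∞ X₂ V
  lt : ∀ x ∈ V, k₂ x < k₁ x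
  principal₁ : ∀ x ∈ V, fderiv ℝ G x (X₁ x) = -(k₁ x • fderiv ℝ F x (X₁ x))
  principal₂ : ∀ x ∈ V, fderiv ℝ G x (X₂ x) = -(k₂ x • fderiv ℝ F x (X₂ x))
  norm₁ : ∀ x ∈ V, ‖fderiv ℝ F x (X₁ x)‖ = 1
  norm₂ : ∀ x ∈ V, ‖fderiv ℝ F x (X₂ x)‖ = 1
  orth : ∀ x ∈ V, inner ℝ (fderiv ℝ F x (X₁ x)) (fderiv ℝ F x (X₂ x)) = 0
  oriented : ∀ x ∈ V,
    0 < (Matrix.of ![⇑(fderiv ℝ F x (X₁ x)), ⇑(fderiv ℝ F x (X₂ x)), ⇑(G x)]).det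

/-- Both lifts differentiate to `tangentLift` of the Euclidean derivatives, so the equation `dN = -k
df` and the orthonormality of the frame carry over verbatim. -/
theorem FrameField.toPrincipalField {F G : E2 → E3} {V : Set E2} {k₁ k₂ : E2 → ℝ}
    {X₁ X₂ : E2 → E2} (P : FrameField F G V k₁ k₂ X₁ X₂) :
    PrincipalField V (fun y => halfLift (F y)) (fun y => tangentLift (F y) (G y)) ![1, 0, 0, 0, 1]
      k₁ k₂ X₁ X₂ := by
  have dF : ∀ x ∈ V, DifferentiableAt ℝ F x := fun x hx =>
    P.smooth.differentiableAt_of_isOpen P.isOpen hx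
  have dG : ∀ x ∈ V, DifferentiableAt ℝ G x := fun x hx =>
    P.smooth_normal.differentiableAt_of_isOpen P.isOpen hx
  have em : ∀ (Y : E2 → E2), ∀ x ∈ V, dirDeriv Y (fun y => halfLift (F y)) x =
      tangentLift (F x) (fderiv ℝ F x (Y x)) := fun Y x hx => dirDeriv_halfLift (dF x hx)
  have en : ∀ (Y : E2 → E2), ∀ x ∈ V, dirDeriv Y (fun y => tangentLift (F y) (G y)) x =
      tangentLift (F x) (fderiv ℝ G x (Y x)) := fun Y x hx =>
    dirDeriv_tangentLift (dF x hx) (dG x hx) (P.normal x hx _)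
  exact
  { isOpen := P.isOpen
    smooth_m := contDiff_halfLift.comp_contDiffOn P.smooth
    smooth_n := contDiffOn_tangentLift P.smooth P.smooth_normal
    smooth_k₁ := P.smooth_k₁
    smooth_k₂ := P.smooth_k₂
    smooth_X₁ := P.smooth_X₁
    smooth_X₂ := P.smooth_X₂
    lt := P.lt
    mm := fun x _ => lorentz_halfLift_self _
    nm := fun x _ => lorentz_tangentLift_halfLift _ _
    nn := fun x hx => by
      rw [lorentz_tangentLift, real_inner_self_eq_norm_sq, P.norm_normal x hx]; norm_num
    ll := lorentz_pole_self
    lm := fun x _ => lorentz_pole_halfLift _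
    ln := fun x _ => lorentz_pole_tangentLift _ _
    ne₁ := fun x hx => by rw [em X₁ x hx, lorentz_tangentLift, P.normal x hx]
    ne₂ := fun x hx => by rw [em X₂ x hx, lorentz_tangentLift, P.normal x hx]
    dn₁ := fun x hx => by
      rw [em X₁ x hx, en X₁ x hx, P.principal₁ x hx, tangentLift_neg, tangentLift_smul]
    dn₂ := fun x hx => by
      rw [em X₂ x hx, en X₂ x hx, P.principal₂ x hx, tangentLift_neg, tangentLift_smul]
    unit₁ := fun x hx => by
      rw [em X₁ x hx, lorentz_tangentLift, real_inner_self_eq_norm_sq, P.norm₁ x hx]; norm_num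
    unit₂ := fun x hx => by
      rw [em X₂ x hx, lorentz_tangentLift, real_inner_self_eq_norm_sq, P.norm₂ x hx]; norm_num
    orth := fun x hx => by rw [em X₁ x hx, em X₂ x hx, lorentz_tangentLift, P.orth x hx] }

theorem sq_det_of_orthonormal {a b c : E3} (ha : ‖a‖ = 1) (hb : ‖b‖ = 1) (hc : ‖c‖ = 1)
    (hab : inner ℝ a b = 0) (hca : inner ℝ c a = 0) (hcb : inner ℝ c b = 0) :
    (Matrix.of ![⇑a, ⇑b, ⇑c]).det * (Matrix.of ![⇑a, ⇑b, ⇑c]).det = 1 := by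
  have ha' := norm_sq_E3 a
  have hb' := norm_sq_E3 b
  have hc' := norm_sq_E3 c
  rw [ha] at ha'
  rw [hb] at hb'
  rw [hc] at hc'
  rw [inner_E3] at hab hca hcb
  have : Matrix.of ![⇑a, ⇑b, ⇑c] * (Matrix.of ![⇑a, ⇑b, ⇑c]).transpose = 1 := by
    ext i j
    fin_cases i <;> fin_cases j <;>
      simp [Matrix.mul_apply, Fin.sum_univ_three] <;> linarith
  have h := congrArg Matrix.det this
  rwa [Matrix.det_mul, Matrix.det_transpose, Matrix.det_one] at h

theorem det_smul_middle (a b c : E3) (r : ℝ) :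
    (Matrix.of ![⇑a, ⇑(r • b), ⇑c]).det = r * (Matrix.of ![⇑a, ⇑b, ⇑c]).det := by
  simp only [Matrix.det_fin_three, Matrix.of_apply, Matrix.cons_val, PiLp.smul_apply, smul_eq_mul]
  ring

/-! ### Symmetry of the second fundamental form and normalization of principal fields. -/

namespace SurfacePatch

variable {F G : E2 → E3} {V : Set E2} {x : E2} (S : SurfacePatch F G V)
include S

/-- Differentiating `⟨G, dF v⟩ = 0` along `u` turns each side into minus the normal component of a
second derivative of `F`, and second derivatives commute. -/
theorem symm_second (hx : x ∈ V) (u v : E2) :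
    inner ℝ (fderiv ℝ G x u) (fderiv ℝ F x v) = inner ℝ (fderiv ℝ G x v) (fderiv ℝ F x u) := by
  have key : ∀ u v : E2, inner ℝ (G x) (dirDeriv (fun _ => u) (dirDeriv (fun _ => v) F) x) +
      inner ℝ (fderiv ℝ G x u) (fderiv ℝ F x v) = 0 := by
    intro u v
    have := dirDeriv_inner (X := fun _ => u)
      (S.smooth_normal.differentiableAt_of_isOpen S.isOpen hx)
      ((ContDiffOn.dirDeriv S.isOpen (contDiffOn_const (c := v)) S.smooth).differentiableAt_of_isOpen
        S.isOpen hx)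
    exact this.symm.trans (dirDeriv_const_on S.isOpen (fun y hy => S.normal y hy v) hx)
  have hc := dirDeriv_comm_sub S.isOpen S.smooth (contDiffOn_const (c := u))
    (contDiffOn_const (c := v)) hx
  rw [VectorField.lieBracket] at hc
  simp only [fderiv_fun_const, Pi.zero_apply, _root_.zero_apply, sub_zero, map_zero] at hc
  have h1 := key u v
  have h2 := key v u
  rw [sub_eq_zero.mp hc] at h1
  linarith

/-- Fields of principal vectors can be normalized to an oriented principal frame field. -/
theorem exists_frameField {k₁ k₂ : E2 → ℝ} {Y₁ Y₂ : E2 → E2} (hY₁ : ContDiffOn ℝ ∞ Y₁ V)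
    (hY₂ : ContDiffOn ℝ ∞ Y₂ V) (h₁ : ∀ x ∈ V, Y₁ x ≠ 0) (h₂ : ∀ x ∈ V, Y₂ x ≠ 0)
    (lt : ∀ x ∈ V, k₂ x < k₁ x)
    (p₁ : ∀ x ∈ V, fderiv ℝ G x (Y₁ x) = -(k₁ x • fderiv ℝ F x (Y₁ x)))
    (p₂ : ∀ x ∈ V, fderiv ℝ G x (Y₂ x) = -(k₂ x • fderiv ℝ F x (Y₂ x))) :
    ∃ a b : E2 → ℝ, (∀ x ∈ V, a x ≠ 0) ∧ (∀ x ∈ V, b x ≠ 0) ∧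
      FrameField F G V k₁ k₂ (fun x => a x • Y₁ x) (fun x => b x • Y₂ x) := by
  have smF : ∀ Y : E2 → E2, ContDiffOn ℝ ∞ Y V → ContDiffOn ℝ ∞ (fun x => fderiv ℝ F x (Y x)) V :=
    fun Y hY => hY.dirDeriv S.isOpen S.smooth
  have smG : ∀ Y : E2 → E2, ContDiffOn ℝ ∞ Y V → ContDiffOn ℝ ∞ (fun x => fderiv ℝ G x (Y x)) V :=
    fun Y hY => hY.dirDeriv S.isOpen S.smooth_normal
  have ne : ∀ Y : E2 → E2, (∀ x ∈ V, Y x ≠ 0) → ∀ x ∈ V, fderiv ℝ F x (Y x) ≠ 0 :=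
    fun Y hY x hx h => hY x hx (S.immersion x hx _ h)
  have smk : ∀ (Y : E2 → E2) (k : E2 → ℝ), ContDiffOn ℝ ∞ Y V → (∀ x ∈ V, Y x ≠ 0) →
      (∀ x ∈ V, fderiv ℝ G x (Y x) = -(k x • fderiv ℝ F x (Y x))) → ContDiffOn ℝ ∞ k V := by
    intro Y k hY h hp
    have : ContDiffOn ℝ ∞ (fun x => -(inner ℝ (fderiv ℝ G x (Y x)) (fderiv ℝ F x (Y x))) /
        (inner ℝ (fderiv ℝ F x (Y x)) (fderiv ℝ F x (Y x)) : ℝ)) V :=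
      (((smG Y hY).inner ℝ (smF Y hY)).neg).div ((smF Y hY).inner ℝ (smF Y hY))
        (fun x hx => inner_self_ne_zero.mpr (ne Y h x hx))
    refine this.congr fun x hx => ?_
    have := inner_self_ne_zero (𝕜 := ℝ).mpr (ne Y h x hx)
    rw [hp x hx, inner_neg_left, inner_smul_left]
    field_simp
    simp
  have sn : ∀ Y : E2 → E2, ContDiffOn ℝ ∞ Y V → (∀ x ∈ V, Y x ≠ 0) →
      ContDiffOn ℝ ∞ (fun x => ‖fderiv ℝ F x (Y x)‖⁻¹) V := fun Y hY h =>
    ((smF Y hY).norm ℝ (ne Y h)).inv (fun x hx => norm_ne_zero_iff.mpr (ne Y h x hx))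
  have horth : ∀ x ∈ V, inner ℝ (fderiv ℝ F x (Y₁ x)) (fderiv ℝ F x (Y₂ x)) = 0 := by
    intro x hx
    have h := S.symm_second hx (Y₁ x) (Y₂ x)
    rw [p₁ x hx, p₂ x hx, inner_neg_left, inner_neg_left, inner_smul_left, inner_smul_left,
      real_inner_comm] at h
    have h' : (k₁ x - k₂ x) * inner ℝ (fderiv ℝ F x (Y₂ x)) (fderiv ℝ F x (Y₁ x)) = 0 := by
      simp only [conj_trivial] at h
      linarith
    rw [real_inner_comm]
    exact (mul_eq_zero.mp h').resolve_left (by linarith [lt x hx])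
  set a : E2 → ℝ := fun x => ‖fderiv ℝ F x (Y₁ x)‖⁻¹ with ha
  set b₀ : E2 → ℝ := fun x => ‖fderiv ℝ F x (Y₂ x)‖⁻¹ with hb₀
  have a0 : ∀ x ∈ V, a x ≠ 0 := fun x hx => inv_ne_zero (norm_ne_zero_iff.mpr (ne Y₁ h₁ x hx))
  have b0 : ∀ x ∈ V, b₀ x ≠ 0 := fun x hx => inv_ne_zero (norm_ne_zero_iff.mpr (ne Y₂ h₂ x hx))
  have sX₁ : ContDiffOn ℝ ∞ (fun x => a x • Y₁ x) V := (sn Y₁ hY₁ h₁).smul hY₁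
  have sX₂ : ContDiffOn ℝ ∞ (fun x => b₀ x • Y₂ x) V := (sn Y₂ hY₂ h₂).smul hY₂
  have n₁ : ∀ x ∈ V, ‖fderiv ℝ F x (a x • Y₁ x)‖ = 1 := fun x hx => by
    rw [map_smul, norm_smul, ha, norm_inv, norm_norm]
    exact inv_mul_cancel₀ (norm_ne_zero_iff.mpr (ne Y₁ h₁ x hx))
  have n₂ : ∀ x ∈ V, ‖fderiv ℝ F x (b₀ x • Y₂ x)‖ = 1 := fun x hx => by
    rw [map_smul, norm_smul, hb₀, norm_inv, norm_norm]
    exact inv_mul_cancel₀ (norm_ne_zero_iff.mpr (ne Y₂ h₂ x hx))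
  -- The determinant of an orthonormal frame is smooth with square `1`. Multiplying the second field
  -- by it orients the frame without a choice of sign.
  set δ : E2 → ℝ := fun x => (Matrix.of ![⇑(fderiv ℝ F x (a x • Y₁ x)),
    ⇑(fderiv ℝ F x (b₀ x • Y₂ x)), ⇑(G x)]).det with hδ
  have δ1 : ∀ x ∈ V, δ x * δ x = 1 := fun x hx =>
    sq_det_of_orthonormal (n₁ x hx) (n₂ x hx) (S.norm_normal x hx)
      (by simp [inner_smul_left, inner_smul_right, horth x hx]) (S.normal x hx _) (S.normal x hx _)
  have δabs : ∀ x ∈ V, ‖δ x‖ = 1 := fun x hx => by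
    rw [Real.norm_eq_abs]
    exact (abs_eq one_pos.le).mpr (mul_self_eq_one_iff.mp (δ1 x hx))
  have sδ : ContDiffOn ℝ ∞ δ V := by
    have e₁ := smF _ sX₁
    have e₂ := smF _ sX₂
    have c : ∀ {H : E2 → E3}, ContDiffOn ℝ ∞ H V → ∀ i, ContDiffOn ℝ ∞ (fun x => H x i) V :=
      fun hH i => (EuclideanSpace.proj (𝕜 := ℝ) i).contDiff.comp_contDiffOn hH
    simp only [hδ, Matrix.det_fin_three, Matrix.of_apply, Matrix.cons_val]
    have := c e₁ 0
    have := c e₁ 1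
    have := c e₁ 2
    have := c e₂ 0
    have := c e₂ 1
    have := c e₂ 2
    have := c S.smooth_normal 0
    have := c S.smooth_normal 1
    have := c S.smooth_normal 2
    fun_prop
  have δ0 : ∀ x ∈ V, δ x ≠ 0 := fun x hx h => by simpa [h] using δ1 x hx
  refine ⟨a, fun x => δ x * b₀ x, a0, fun x hx => mul_ne_zero (δ0 x hx) (b0 x hx), ?_⟩
  exact
  { S with
    smooth_k₁ := smk Y₁ k₁ hY₁ h₁ p₁
    smooth_k₂ := smk Y₂ k₂ hY₂ h₂ p₂
    smooth_X₁ := sX₁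
    smooth_X₂ := by
      simp only [mul_smul]
      exact sδ.smul sX₂
    lt := lt
    principal₁ := fun x hx => by rw [map_smul, map_smul, p₁ x hx]; module
    principal₂ := fun x hx => by rw [map_smul, map_smul, p₂ x hx]; module
    norm₁ := n₁
    norm₂ := fun x hx => by
      rw [mul_smul, map_smul, norm_smul, n₂ x hx, δabs x hx, one_mul]
    orth := fun x hx => by simp [inner_smul_left, inner_smul_right, horth x hx]
    oriented := fun x hx => by
      have : (Matrix.of ![⇑(fderiv ℝ F x (a x • Y₁ x)), ⇑(fderiv ℝ F x ((δ x * b₀ x) • Y₂ x)),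
          ⇑(G x)]).det = δ x * δ x := by
        rw [mul_smul, map_smul (fderiv ℝ F x) (δ x), det_smul_middle]
      rw [this, δ1 x hx]
      exact one_pos }

end SurfacePatch

theorem eq_single_add_single (y : E2) :
    y = y 0 • EuclideanSpace.single 0 (1 : ℝ) + y 1 • EuclideanSpace.single 1 (1 : ℝ) := by
  ext i
  fin_cases i <;> simp

/-- The discriminant of the characteristic polynomial of a pair of quadratic forms, the first of
which is positive definite. -/
theorem discriminant_pos {a b d p q r : ℝ} (ha : 0 < a) (hΔ : 0 < a * d - b * b)
    (h : ¬ ∃ k, p - k * a = 0 ∧ q - k * b = 0 ∧ r - k * d = 0) :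
    0 < (a * r + d * p - 2 * b * q) ^ 2 - 4 * (a * d - b * b) * (p * r - q * q) := by
  by_contra hle
  push Not at hle
  -- Completing squares: a discriminant that is not positive forces both squares to vanish, and then
  -- the two forms are proportional.
  have hid : a ^ 2 * ((a * r + d * p - 2 * b * q) ^ 2 - 4 * (a * d - b * b) * (p * r - q * q)) =
      (a * (a * r - d * p) - 2 * b * (a * q - b * p)) ^ 2 +
        4 * (a * d - b * b) * (a * q - b * p) ^ 2 := by ring
  have hle' : a ^ 2 * ((a * r + d * p - 2 * b * q) ^ 2 - 4 * (a * d - b * b) * (p * r - q * q)) ≤ 0 :=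
    mul_nonpos_of_nonneg_of_nonpos (sq_nonneg a) hle
  have hq : a * q - b * p = 0 := by
    by_contra hne
    have : 0 < 4 * (a * d - b * b) * (a * q - b * p) ^ 2 := by positivity
    nlinarith [sq_nonneg (a * (a * r - d * p) - 2 * b * (a * q - b * p))]
  have hr : a * r - d * p = 0 := by
    rw [hq] at hid
    by_contra hne
    have : 0 < (a * (a * r - d * p) - 2 * b * 0) ^ 2 := by
      have : a * (a * r - d * p) - 2 * b * 0 ≠ 0 := by
        rw [mul_zero, sub_zero]; exact mul_ne_zero ha.ne' hne
      positivity
    nlinarith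
  refine h ⟨p / a, ?_, ?_, ?_⟩
  · field_simp; ring
  · field_simp; linarith
  · field_simp; linarith

/-! ### Existence of smooth principal frame fields away from umbilic points. -/

namespace SurfacePatch

variable {F G : E2 → E3} {V : Set E2} (S : SurfacePatch F G V)
include S

theorem mono {W : Set E2} (hW : IsOpen W) (h : W ⊆ V) : SurfacePatch F G W where
  isOpen := hW
  smooth := S.smooth.mono h
  smooth_normal := S.smooth_normal.mono h
  norm_normal x hx := S.norm_normal x (h hx)
  normal x hx := S.normal x (h hx)
  immersion x hx := S.immersion x (h hx)

theorem inner_normal_fderiv_normal {x : E2} (hx : x ∈ V) (y : E2) :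
    inner ℝ (G x) (fderiv ℝ G x y) = 0 := by
  have dG := S.smooth_normal.differentiableAt_of_isOpen S.isOpen hx
  have h := dirDeriv_inner (X := fun _ => y) dG dG
  rw [dirDeriv_const_on S.isOpen (c := (1 : ℝ)) (fun z hz => by
    rw [real_inner_self_eq_norm_sq, S.norm_normal z hz]; norm_num) hx, dirDeriv,
    real_inner_comm (fderiv ℝ G x y)] at h
  rw [real_inner_comm]
  linarith

theorem eq_zero_of_orthogonal {x : E2} (hx : x ∈ V) {w : E3} (hG : inner ℝ w (G x) = 0)
    (hF : ∀ i, inner ℝ w (fderiv ℝ F x (EuclideanSpace.single i 1)) = 0) : w = 0 := by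
  have hli : LinearIndependent ℝ ![fderiv ℝ F x (EuclideanSpace.single 0 1),
      fderiv ℝ F x (EuclideanSpace.single 1 1), G x] := by
    rw [Fintype.linearIndependent_iff]
    intro c hc
    rw [Fin.sum_univ_three] at hc
    simp only [Matrix.cons_val] at hc
    have h2 : c 2 = 0 := by
      have := congrArg (inner ℝ (G x)) hc
      simpa [inner_add_right, inner_smul_right, S.normal x hx, S.norm_normal x hx] using this
    rw [h2, zero_smul, add_zero, ← map_smul, ← map_smul, ← map_add] at hc
    have h0 := S.immersion x hx _ hc
    have c0 : c 0 = 0 := by simpa using congrArg (fun y : E2 => y 0) h0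
    have c1 : c 1 = 0 := by simpa using congrArg (fun y : E2 => y 1) h0
    intro i
    fin_cases i
    exacts [c0, c1, h2]
  have hspan := hli.span_eq_top_of_card_eq_finrank (by simp)
  have hall : ∀ z ∈ Submodule.span ℝ (Set.range ![fderiv ℝ F x (EuclideanSpace.single 0 1),
      fderiv ℝ F x (EuclideanSpace.single 1 1), G x]), inner ℝ w z = 0 := by
    intro z hz
    induction hz using Submodule.span_induction with
    | mem z hz =>
      obtain ⟨i, rfl⟩ := hz
      fin_cases i
      exacts [hF 0, hF 1, hG]
    | zero => simp
    | add a b _ _ ha hb => rw [inner_add_right, ha, hb, add_zero]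
    | smul c a _ ha => rw [inner_smul_right, ha, mul_zero]
  have := hall w (by rw [hspan]; trivial)
  exact inner_self_eq_zero.mp this

/-- Principal vectors are the solutions of a linear system with the coefficients of the fundamental
forms. -/
theorem principal_of_system {x : E2} (hx : x ∈ V) {k : ℝ} {y : E2}
    (h : ∀ i, inner ℝ (fderiv ℝ G x (EuclideanSpace.single i 1)) (fderiv ℝ F x y) +
      k * inner ℝ (fderiv ℝ F x (EuclideanSpace.single i 1)) (fderiv ℝ F x y) = 0) :
    fderiv ℝ G x y = -(k • fderiv ℝ F x y) := by
  rw [eq_neg_iff_add_eq_zero]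
  refine S.eq_zero_of_orthogonal hx ?_ fun i => ?_
  · rw [real_inner_comm, inner_add_right, inner_smul_right, S.normal x hx,
      S.inner_normal_fderiv_normal hx, mul_zero, add_zero]
  · rw [inner_add_left, inner_smul_left, S.symm_second hx,
      real_inner_comm (fderiv ℝ F x (EuclideanSpace.single i 1))]
    simpa using h i

/-- Around a point of a surface patch without umbilic points there is a principal frame field. -/
theorem exists_principal (hu : ∀ x ∈ V, ¬ ∃ k : ℝ, ∀ y, fderiv ℝ G x y = -(k • fderiv ℝ F x y))
    {z : E2} (hz : z ∈ V) : ∃ (W : Set E2) (k₁ k₂ : E2 → ℝ) (X₁ X₂ : E2 → E2),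
      z ∈ W ∧ W ⊆ V ∧ FrameField F G W k₁ k₂ X₁ X₂ := by
  set u : E2 := EuclideanSpace.single 0 1
  set v : E2 := EuclideanSpace.single 1 1
  have smF : ∀ y : E2, ContDiffOn ℝ ∞ (fun x => fderiv ℝ F x y) V :=
    fun y => (contDiffOn_const (c := y)).dirDeriv S.isOpen S.smooth
  have smG : ∀ y : E2, ContDiffOn ℝ ∞ (fun x => fderiv ℝ G x y) V :=
    fun y => (contDiffOn_const (c := y)).dirDeriv S.isOpen S.smooth_normal
  -- The first fundamental form has coefficients `a, b, d`, the second has `p, q, r`.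
  obtain ⟨a, ha⟩ : ∃ a : E2 → ℝ, a = fun x => inner ℝ (fderiv ℝ F x u) (fderiv ℝ F x u) := ⟨_, rfl⟩
  obtain ⟨b, hb⟩ : ∃ b : E2 → ℝ, b = fun x => inner ℝ (fderiv ℝ F x u) (fderiv ℝ F x v) := ⟨_, rfl⟩
  obtain ⟨d, hd⟩ : ∃ d : E2 → ℝ, d = fun x => inner ℝ (fderiv ℝ F x v) (fderiv ℝ F x v) := ⟨_, rfl⟩
  obtain ⟨p, hp⟩ : ∃ p : E2 → ℝ, p = fun x => -inner ℝ (fderiv ℝ G x u) (fderiv ℝ F x u) :=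
    ⟨_, rfl⟩
  obtain ⟨q, hq⟩ : ∃ q : E2 → ℝ, q = fun x => -inner ℝ (fderiv ℝ G x u) (fderiv ℝ F x v) :=
    ⟨_, rfl⟩
  obtain ⟨r, hr⟩ : ∃ r : E2 → ℝ, r = fun x => -inner ℝ (fderiv ℝ G x v) (fderiv ℝ F x v) :=
    ⟨_, rfl⟩
  have sa : ContDiffOn ℝ ∞ a V := by rw [ha]; exact (smF u).inner ℝ (smF u)
  have sb : ContDiffOn ℝ ∞ b V := by rw [hb]; exact (smF u).inner ℝ (smF v)
  have sd : ContDiffOn ℝ ∞ d V := by rw [hd]; exact (smF v).inner ℝ (smF v)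
  have sp : ContDiffOn ℝ ∞ p V := by rw [hp]; exact ((smG u).inner ℝ (smF u)).neg
  have sq : ContDiffOn ℝ ∞ q V := by rw [hq]; exact ((smG u).inner ℝ (smF v)).neg
  have sr : ContDiffOn ℝ ∞ r V := by rw [hr]; exact ((smG v).inner ℝ (smF v)).neg
  have principal : ∀ x ∈ V, ∀ (k : ℝ) (y : E2),
      (p x - k * a x) * y 0 + (q x - k * b x) * y 1 = 0 →
      (q x - k * b x) * y 0 + (r x - k * d x) * y 1 = 0 →
      fderiv ℝ G x y = -(k • fderiv ℝ F x y) := by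
    intro x hx k y h1 h2
    refine S.principal_of_system hx fun i => ?_
    have hy := congrArg (fderiv ℝ F x) (eq_single_add_single y)
    rw [map_add, map_smul, map_smul] at hy
    rw [hy]
    have hs := S.symm_second hx u v
    have hc := real_inner_comm (fderiv ℝ F x u) (fderiv ℝ F x v)
    simp only [ha, hb, hd, hp, hq, hr] at h1 h2
    fin_cases i
    · simp only [inner_add_right, inner_smul_right, Fin.zero_eta]
      linarith
    · simp only [inner_add_right, inner_smul_right, Fin.mk_one]
      rw [show inner ℝ (fderiv ℝ G x (EuclideanSpace.single 1 1))
        (fderiv ℝ F x (EuclideanSpace.single 0 1)) = _ from hs.symm, show inner ℝ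
        (fderiv ℝ F x (EuclideanSpace.single 1 1)) (fderiv ℝ F x (EuclideanSpace.single 0 1)) = _
        from hc]
      linarith
  have not_umb : ∀ x ∈ V, ¬ ∃ k, p x - k * a x = 0 ∧ q x - k * b x = 0 ∧ r x - k * d x = 0 := by
    rintro x hx ⟨k, h1, h2, h3⟩
    exact hu x hx ⟨k, fun y => principal x hx k y (by rw [h1, h2]; ring) (by rw [h2, h3]; ring)⟩
  have a_pos : ∀ x ∈ V, 0 < a x := by
    intro x hx
    rw [ha]
    refine real_inner_self_pos.mpr fun h => ?_
    simpa [u] using congrArg (fun y : E2 => y 0) (S.immersion x hx u h)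
  have Δ_pos : ∀ x ∈ V, 0 < a x * d x - b x * b x := by
    intro x hx
    have hne : fderiv ℝ F x (a x • v - b x • u) ≠ 0 := fun h => by
      have h' := congrArg (fun y : E2 => y 1) (S.immersion x hx _ h)
      simp [u, v] at h'
      exact (a_pos x hx).ne' h'
    have h := real_inner_self_pos.mpr hne
    have hc := real_inner_comm (fderiv ℝ F x u) (fderiv ℝ F x v)
    have : inner ℝ (fderiv ℝ F x (a x • v - b x • u)) (fderiv ℝ F x (a x • v - b x • u)) =
        a x * (a x * d x - b x * b x) := by
      simp only [map_sub, map_smul, inner_sub_left, inner_sub_right, inner_smul_left,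
        inner_smul_right, conj_trivial, hc]
      simp only [ha, hb, hd]
      ring
    rw [this] at h
    exact pos_of_mul_pos_right h (a_pos x hx).le
  obtain ⟨D, hD⟩ : ∃ D : E2 → ℝ, D = fun x => (a x * r x + d x * p x - 2 * b x * q x) ^ 2 -
      4 * (a x * d x - b x * b x) * (p x * r x - q x * q x) := ⟨_, rfl⟩
  have D_pos : ∀ x ∈ V, 0 < D x := fun x hx => by
    rw [hD]; exact discriminant_pos (a_pos x hx) (Δ_pos x hx) (not_umb x hx)
  have sD : ContDiffOn ℝ ∞ D V := by rw [hD]; fun_prop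
  have sR : ContDiffOn ℝ ∞ (fun x => √(D x)) V := sD.sqrt fun x hx => (D_pos x hx).ne'
  -- For `ε = ±1` these are the roots `k` of `det (II - k I) = 0`; they are smooth because the
  -- discriminant `D` is positive.
  have sk : ∀ ε : ℝ, ContDiffOn ℝ ∞ (fun x => (a x * r x + d x * p x - 2 * b x * q x +
      ε * √(D x)) / (2 * (a x * d x - b x * b x))) V := by
    intro ε
    refine ContDiffOn.div (by fun_prop) (by fun_prop) fun x hx => ?_
    have := Δ_pos x hx
    positivity
  have root : ∀ ε : ℝ, ε * ε = 1 → ∀ x ∈ V, ∀ k, k = (a x * r x + d x * p x - 2 * b x * q x +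
      ε * √(D x)) / (2 * (a x * d x - b x * b x)) →
      (p x - k * a x) * (r x - k * d x) - (q x - k * b x) * (q x - k * b x) = 0 := by
    intro ε hε x hx k hk
    have hΔ := Δ_pos x hx
    have hsq := Real.mul_self_sqrt (D_pos x hx).le
    have h2 : 2 * (a x * d x - b x * b x) * k - (a x * r x + d x * p x - 2 * b x * q x) =
        ε * √(D x) := by
      have := div_mul_cancel₀ (a x * r x + d x * p x - 2 * b x * q x + ε * √(D x))
        (show 2 * (a x * d x - b x * b x) ≠ 0 by positivity)
      rw [← hk] at this
      linarith
    have h3 : (2 * (a x * d x - b x * b x) * k - (a x * r x + d x * p x - 2 * b x * q x)) ^ 2 =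
        D x := by
      rw [h2]; linear_combination ε * ε * hsq + D x * hε
    have h4 : 4 * (a x * d x - b x * b x) *
        ((p x - k * a x) * (r x - k * d x) - (q x - k * b x) * (q x - k * b x)) = 0 := by
      rw [hD] at h3
      linear_combination h3
    exact (mul_eq_zero.mp h4).resolve_left (by positivity)
  -- The symmetric matrix `II - k I` is singular, so either of its rows turned by a right angle lies
  -- in its kernel. A row that is nonzero at `z` is used, on the open set where the resulting field
  -- stays nonzero.
  have direction : ∀ k : E2 → ℝ, ContDiffOn ℝ ∞ k V →
      (∀ x ∈ V, (p x - k x * a x) * (r x - k x * d x) -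
        (q x - k x * b x) * (q x - k x * b x) = 0) →
      ∃ (W : Set E2) (Y : E2 → E2), IsOpen W ∧ z ∈ W ∧ W ⊆ V ∧ ContDiffOn ℝ ∞ Y W ∧
        (∀ x ∈ W, Y x ≠ 0) ∧ ∀ x ∈ W, fderiv ℝ G x (Y x) = -(k x • fderiv ℝ F x (Y x)) := by
    intro k hk hroot
    have build : ∀ Y : E2 → E2, ContDiffOn ℝ ∞ Y V → Y z ≠ 0 →
        (∀ x ∈ V, fderiv ℝ G x (Y x) = -(k x • fderiv ℝ F x (Y x))) →
        ∃ (W : Set E2) (Y : E2 → E2), IsOpen W ∧ z ∈ W ∧ W ⊆ V ∧ ContDiffOn ℝ ∞ Y W ∧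
          (∀ x ∈ W, Y x ≠ 0) ∧ ∀ x ∈ W, fderiv ℝ G x (Y x) = -(k x • fderiv ℝ F x (Y x)) :=
      fun Y sY hne hY => ⟨V ∩ Y ⁻¹' {0}ᶜ, Y,
        sY.continuousOn.isOpen_inter_preimage S.isOpen isOpen_compl_singleton, ⟨hz, hne⟩,
        inter_subset_left, sY.mono inter_subset_left, fun x hx => hx.2, fun x hx => hY x hx.1⟩
    have sY : ∀ {α β : E2 → ℝ}, ContDiffOn ℝ ∞ α V → ContDiffOn ℝ ∞ β V →
        ContDiffOn ℝ ∞ (fun x => α x • u + β x • v) V := fun hα hβ =>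
      ContDiffOn.add (hα.smul contDiffOn_const) (hβ.smul contDiffOn_const)
    by_cases h1 : p z - k z * a z = 0 ∧ q z - k z * b z = 0
    · have h2 : r z - k z * d z ≠ 0 := fun h => not_umb z hz ⟨k z, h1.1, h1.2, h⟩
      refine build (fun x => (-(r x - k x * d x)) • u + (q x - k x * b x) • v)
        (sY (by fun_prop) (by fun_prop)) (fun h => ?_) fun x hx => ?_
      · have := congrArg (fun y : E2 => y 0) h
        simp [u, v] at this
        exact h2 (by linarith)
      · refine principal x hx _ _ ?_ ?_ <;> simp [u, v]
        · linear_combination - hroot x hx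
        · ring
    · refine build (fun x => (-(q x - k x * b x)) • u + (p x - k x * a x) • v)
        (sY (by fun_prop) (by fun_prop)) (fun h => ?_) fun x hx => ?_
      · have e0 := congrArg (fun y : E2 => y 0) h
        have e1 := congrArg (fun y : E2 => y 1) h
        simp [u, v] at e0 e1
        exact h1 ⟨e1, by linarith⟩
      · refine principal x hx _ _ ?_ ?_ <;> simp [u, v]
        · ring
        · linear_combination hroot x hx
  obtain ⟨W₁, Y₁, o₁, z₁, i₁, s₁, n₁, p₁⟩ := direction _ (sk 1) fun x hx =>
    root 1 (by norm_num) x hx _ rfl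
  obtain ⟨W₂, Y₂, o₂, z₂, i₂, s₂, n₂, p₂⟩ := direction _ (sk (-1)) fun x hx =>
    root (-1) (by norm_num) x hx _ rfl
  have SW := S.mono (o₁.inter o₂) (inter_subset_left.trans i₁)
  have lt : ∀ x ∈ W₁ ∩ W₂, (a x * r x + d x * p x - 2 * b x * q x + -1 * √(D x)) /
      (2 * (a x * d x - b x * b x)) < (a x * r x + d x * p x - 2 * b x * q x + 1 * √(D x)) /
      (2 * (a x * d x - b x * b x)) := by
    intro x hx
    have hΔ := Δ_pos x (i₁ hx.1)
    have hD := Real.sqrt_pos.mpr (D_pos x (i₁ hx.1))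
    gcongr
    norm_num
  obtain ⟨α, β, -, -, h⟩ := SW.exists_frameField (s₁.mono inter_subset_left)
    (s₂.mono inter_subset_right) (fun x hx => n₁ x hx.1) (fun x hx => n₂ x hx.2) lt
    (fun x hx => p₁ x hx.1) (fun x hx => p₂ x hx.2)
  exact ⟨W₁ ∩ W₂, _, _, _, _, ⟨z₁, z₂⟩, inter_subset_left.trans i₁, h⟩

end SurfacePatch

/-! ### Surfaces in charts -/

section Charts

variable {M : Type*} [TopologicalSpace M] [ChartedSpace E2 M]
  {φ : OpenPartialHomeomorph M E2} {p : M}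

/-- The differential of a chart. -/
noncomputable def chartDeriv (φ : OpenPartialHomeomorph M E2) (p : M) : E2 →L[ℝ] E2 :=
  mfderiv (𝓡 2) (𝓡 2) φ p

theorem mdifferentiable_of_mem_maximalAtlas (hφ : φ ∈ IsManifold.maximalAtlas (𝓡 2) ∞ M) :
    φ.MDifferentiable (𝓡 2) (𝓡 2) :=
  ⟨(contMDiffOn_of_mem_maximalAtlas hφ).mdifferentiableOn (by simp),
    (contMDiffOn_symm_of_mem_maximalAtlas hφ).mdifferentiableOn (by simp)⟩

variable {F : Type*} [NormedAddCommGroup F] [NormedSpace ℝ F] {g : M → F}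

theorem contDiffOn_comp_symm (hφ : φ ∈ IsManifold.maximalAtlas (𝓡 2) ∞ M)
    (hg : ContMDiff (𝓡 2) 𝓘(ℝ, F) ∞ g) : ContDiffOn ℝ ∞ (g ∘ φ.symm) φ.target :=
  contMDiffOn_iff_contDiffOn.mp
    (hg.comp_contMDiffOn (contMDiffOn_symm_of_mem_maximalAtlas hφ))

theorem chartDeriv_bijective (hφ : φ ∈ IsManifold.maximalAtlas (𝓡 2) ∞ M) (hp : p ∈ φ.source) :
    Function.Bijective (chartDeriv φ p) :=
  (mdifferentiable_of_mem_maximalAtlas hφ).mfderiv_bijective hp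

theorem surfDeriv_eq_comp (hφ : φ ∈ IsManifold.maximalAtlas (𝓡 2) ∞ M) (hp : p ∈ φ.source)
    (hg : ContMDiff (𝓡 2) 𝓘(ℝ, F) ∞ g) (v : E2) :
    surfDeriv g p v = fderiv ℝ (g ∘ φ.symm) (φ p) (chartDeriv φ p v) := by
  have h1 : g =ᶠ[nhds p] (g ∘ φ.symm) ∘ φ := by
    filter_upwards [φ.open_source.mem_nhds hp] with q hq
    simp [φ.left_inv hq]
  have hd : DifferentiableAt ℝ (g ∘ φ.symm) (φ p) :=
    (contDiffOn_comp_symm hφ hg).differentiableAt_of_isOpen φ.open_target (φ.map_source hp)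
  have h2 : mfderiv (𝓡 2) 𝓘(ℝ, F) ((g ∘ φ.symm) ∘ φ) p =
      (mfderiv (𝓡 2) 𝓘(ℝ, F) (g ∘ φ.symm) (φ p)).comp (mfderiv (𝓡 2) (𝓡 2) φ p) :=
    mfderiv_comp p hd.mdifferentiableAt ((mdifferentiable_of_mem_maximalAtlas hφ).mdifferentiableAt hp)
  rw [mfderiv_eq_fderiv] at h2
  rw [surfDeriv, h1.mfderiv_eq, h2]
  rfl

variable {f N : M → E3}

theorem IsOrientedSurface.surfacePatch (hf : IsOrientedSurface f N)
    (hφ : φ ∈ IsManifold.maximalAtlas (𝓡 2) ∞ M) :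
    SurfacePatch (f ∘ φ.symm) (N ∘ φ.symm) φ.target where
  isOpen := φ.open_target
  smooth := contDiffOn_comp_symm hφ hf.smooth
  smooth_normal := contDiffOn_comp_symm hφ hf.smooth_normal
  norm_normal x _ := hf.norm_normal _
  normal x hx v := by
    have hp := φ.map_target hx
    obtain ⟨w, rfl⟩ := (chartDeriv_bijective hφ hp).2 v
    have := hf.normal (φ.symm x) w
    rwa [surfDeriv_eq_comp hφ hp hf.smooth, φ.right_inv hx] at this
  immersion x hx v hv := by
    have hp := φ.map_target hx
    obtain ⟨w, rfl⟩ := (chartDeriv_bijective hφ hp).2 v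
    have := surfDeriv_eq_comp hφ hp hf.smooth w
    rw [φ.right_inv hx, hv] at this
    rw [hf.immersion _ (this.trans (map_zero _).symm), map_zero]

theorem not_umbilic_chart (hf : IsOrientedSurface f N) (hu : ∀ p, ¬ IsUmbilic f N p)
    (hφ : φ ∈ IsManifold.maximalAtlas (𝓡 2) ∞ M) : ∀ x ∈ φ.target,
      ¬ ∃ k : ℝ, ∀ y, fderiv ℝ (N ∘ φ.symm) x y = -(k • fderiv ℝ (f ∘ φ.symm) x y) := by
  rintro x hx ⟨k, hk⟩
  refine hu (φ.symm x) ⟨k, fun v => ?_⟩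
  rw [surfDeriv_eq_comp hφ (φ.map_target hx) hf.smooth,
    surfDeriv_eq_comp hφ (φ.map_target hx) hf.smooth_normal, φ.right_inv hx, hk]

theorem isPrincipalVector_iff (hf : IsOrientedSurface f N)
    (hφ : φ ∈ IsManifold.maximalAtlas (𝓡 2) ∞ M) (hp : p ∈ φ.source) (k : ℝ) (e : E3) :
    IsPrincipalVector f N p k e ↔ ∃ w : E2, fderiv ℝ (f ∘ φ.symm) (φ p) w = e ∧
      fderiv ℝ (N ∘ φ.symm) (φ p) w = -(k • e) := by
  constructor
  · rintro ⟨v, h1, h2⟩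
    exact ⟨chartDeriv φ p v, by rw [← h1, surfDeriv_eq_comp hφ hp hf.smooth],
      by rw [← h2, surfDeriv_eq_comp hφ hp hf.smooth_normal]⟩
  · rintro ⟨w, h1, h2⟩
    obtain ⟨v, rfl⟩ := (chartDeriv_bijective hφ hp).2 w
    exact ⟨v, by rw [← h1, surfDeriv_eq_comp hφ hp hf.smooth],
      by rw [← h2, surfDeriv_eq_comp hφ hp hf.smooth_normal]⟩

variable {V : Set E2} {k₁ k₂ : E2 → ℝ} {X₁ X₂ : E2 → E2}

theorem FrameField.isPrincipalFrame (hf : IsOrientedSurface f N)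
    (hφ : φ ∈ IsManifold.maximalAtlas (𝓡 2) ∞ M)
    (P : FrameField (f ∘ φ.symm) (N ∘ φ.symm) V k₁ k₂ X₁ X₂) (hp : p ∈ φ.source) (hV : φ p ∈ V) :
    IsPrincipalFrame f N p (k₁ (φ p)) (k₂ (φ p)) (fderiv ℝ (f ∘ φ.symm) (φ p) (X₁ (φ p)))
      (fderiv ℝ (f ∘ φ.symm) (φ p) (X₂ (φ p))) where
  lt := P.lt _ hV
  principal₁ := (isPrincipalVector_iff hf hφ hp _ _).mpr ⟨_, rfl, P.principal₁ _ hV⟩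
  principal₂ := (isPrincipalVector_iff hf hφ hp _ _).mpr ⟨_, rfl, P.principal₂ _ hV⟩
  norm₁ := P.norm₁ _ hV
  norm₂ := P.norm₂ _ hV
  orthogonal := P.orth _ hV
  oriented := by
    have := P.oriented _ hV
    rwa [Function.comp_apply (f := N), φ.left_inv hp] at this

/-- A principal vector is a multiple of one of the vectors of a principal frame. -/
theorem FrameField.principal_vector_cases {F G : E2 → E3} (P : FrameField F G V k₁ k₂ X₁ X₂)
    {x : E2} (hx : x ∈ V) {k : ℝ} {w : E2} (hn : ‖fderiv ℝ F x w‖ = 1)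
    (hw : fderiv ℝ G x w = -(k • fderiv ℝ F x w)) :
    (k = k₁ x ∧ ∃ ε : ℝ, ε * ε = 1 ∧ w = ε • X₁ x) ∨
      (k = k₂ x ∧ ∃ ε : ℝ, ε * ε = 1 ∧ w = ε • X₂ x) := by
  obtain ⟨a, b, rfl⟩ := P.toPrincipalField.exists_eq hx w
  have h11 : inner ℝ (fderiv ℝ F x (X₁ x)) (fderiv ℝ F x (X₁ x)) = (1 : ℝ) := by
    rw [real_inner_self_eq_norm_sq, P.norm₁ x hx]; norm_num
  have h22 : inner ℝ (fderiv ℝ F x (X₂ x)) (fderiv ℝ F x (X₂ x)) = (1 : ℝ) := by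
    rw [real_inner_self_eq_norm_sq, P.norm₂ x hx]; norm_num
  have h12 := P.orth x hx
  have h21 := (real_inner_comm (fderiv ℝ F x (X₁ x)) (fderiv ℝ F x (X₂ x))).trans h12
  have hn' : a * a + b * b = 1 := by
    have : inner ℝ (fderiv ℝ F x (a • X₁ x + b • X₂ x)) (fderiv ℝ F x (a • X₁ x + b • X₂ x)) =
        (1 : ℝ) := by
      rw [real_inner_self_eq_norm_sq, hn]; norm_num
    rw [map_add, map_smul, map_smul] at this
    simp only [inner_add_left, inner_add_right, inner_smul_left, inner_smul_right, h11, h22, h12,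
      h21, conj_trivial] at this
    linarith
  rw [map_add, map_add, map_smul, map_smul, map_smul, map_smul, P.principal₁ x hx,
    P.principal₂ x hx] at hw
  have e1 := congrArg (inner ℝ (fderiv ℝ F x (X₁ x))) hw
  have e2 := congrArg (inner ℝ (fderiv ℝ F x (X₂ x))) hw
  simp only [inner_add_right, inner_smul_right, inner_neg_right, smul_neg, smul_smul, h11, h22,
    h12, h21] at e1 e2
  have e1' : a * (k - k₁ x) = 0 := by linarith
  have e2' : b * (k - k₂ x) = 0 := by linarith
  rcases mul_eq_zero.mp e1' with ha | hk
  · right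
    subst ha
    have hb : b ≠ 0 := by rintro rfl; norm_num at hn'
    exact ⟨by linarith [(mul_eq_zero.mp e2').resolve_left hb], b, by linarith, by simp⟩
  · left
    have hb : b = 0 := (mul_eq_zero.mp e2').resolve_right (by linarith [P.lt x hx])
    subst hb
    exact ⟨by linarith, a, by linarith, by simp⟩

/-- Principal frames are unique up to a common sign. -/
theorem FrameField.eq_of_isPrincipalFrame (hf : IsOrientedSurface f N)
    (hφ : φ ∈ IsManifold.maximalAtlas (𝓡 2) ∞ M)
    (P : FrameField (f ∘ φ.symm) (N ∘ φ.symm) V k₁ k₂ X₁ X₂) (hp : p ∈ φ.source) (hV : φ p ∈ V)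
    {κ₁ κ₂ : ℝ} {e₁ e₂ : E3} (h : IsPrincipalFrame f N p κ₁ κ₂ e₁ e₂) :
    ∃ ε : ℝ, ε * ε = 1 ∧ e₁ = ε • fderiv ℝ (f ∘ φ.symm) (φ p) (X₁ (φ p)) ∧
      e₂ = ε • fderiv ℝ (f ∘ φ.symm) (φ p) (X₂ (φ p)) := by
  obtain ⟨w₁, hw₁, hw₁'⟩ := (isPrincipalVector_iff hf hφ hp _ _).mp h.principal₁
  obtain ⟨w₂, hw₂, hw₂'⟩ := (isPrincipalVector_iff hf hφ hp _ _).mp h.principal₂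
  have c₁ := P.principal_vector_cases hV (by rw [hw₁, h.norm₁]) (by rw [hw₁', hw₁])
  have c₂ := P.principal_vector_cases hV (by rw [hw₂, h.norm₂]) (by rw [hw₂', hw₂])
  have hlt := h.lt
  have hlt' := P.lt _ hV
  rcases c₁ with ⟨hk₁, ε, hε, rfl⟩ | ⟨hk₁, -⟩
  · rcases c₂ with ⟨hk₂, -⟩ | ⟨-, δ, hδ, rfl⟩
    · linarith
    · rw [map_smul] at hw₁ hw₂
      subst hw₁ hw₂
      have hor := h.oriented
      have hor' := P.oriented _ hV
      rw [Function.comp_apply (f := N), φ.left_inv hp] at hor'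
      rw [det_smul_middle, show ∀ (a b c : E3) (r : ℝ), (Matrix.of ![⇑(r • a), ⇑b, ⇑c]).det =
        r * (Matrix.of ![⇑a, ⇑b, ⇑c]).det from fun a b c r => by
          simp only [Matrix.det_fin_three, Matrix.of_apply, Matrix.cons_val, PiLp.smul_apply,
            smul_eq_mul]
          ring, ← mul_assoc] at hor
      have hpos := pos_of_mul_pos_left hor hor'.le
      -- Both frames are positively oriented, so the two signs have positive product.
      have : δ = ε := by
        have h0 : (δ - ε) * (δ + ε) = 0 := by ring_nf; nlinarith
        rcases mul_eq_zero.mp h0 with h0 | h0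
        · linarith
        · nlinarith
      exact ⟨ε, hε, rfl, by rw [this]⟩
  · rcases c₂ with ⟨hk₂, -⟩ | ⟨hk₂, -⟩ <;> linarith

variable [IsManifold (𝓡 2) ∞ M]

/-- Every point of a surface without umbilic points has a chart with a principal frame field. -/
theorem exists_frameField_chart (hf : IsOrientedSurface f N) (hu : ∀ p, ¬ IsUmbilic f N p) (p : M) :
    ∃ (φ : OpenPartialHomeomorph M E2) (V : Set E2) (k₁ k₂ : E2 → ℝ) (X₁ X₂ : E2 → E2),
      φ ∈ IsManifold.maximalAtlas (𝓡 2) ∞ M ∧ p ∈ φ.source ∧ φ p ∈ V ∧ V ⊆ φ.target ∧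
      FrameField (f ∘ φ.symm) (N ∘ φ.symm) V k₁ k₂ X₁ X₂ := by
  have hφ : chartAt E2 p ∈ IsManifold.maximalAtlas (𝓡 2) ∞ M :=
    IsManifold.chart_mem_maximalAtlas p
  obtain ⟨W, k₁, k₂, X₁, X₂, hz, hW, P⟩ := (hf.surfacePatch hφ).exists_principal
    (not_umbilic_chart hf hu hφ) ((chartAt E2 p).map_source (mem_chart_source E2 p))
  exact ⟨chartAt E2 p, W, k₁, k₂, X₁, X₂, hφ, mem_chart_source E2 p, hz, hW, P⟩

end Charts

/-! ### Leaves of the constant-angle foliations -/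

section Leaves

/-- The equation `γ' = T ∘ γ` raises the regularity of `γ` by one at each step. This makes the
differentiable integral curves provided by the existence theorem smooth, as leaves are required to
be. -/
theorem contDiffOn_of_hasDerivAt_comp {V : Set E2} {T : E2 → E2} {I : Set ℝ} {γ : ℝ → E2}
    (hI : IsOpen I) (hT : ContDiffOn ℝ ∞ T V) (hmaps : MapsTo γ I V)
    (hγ : ∀ s ∈ I, HasDerivAt γ (T (γ s)) s) : ContDiffOn ℝ ∞ γ I := by
  rw [contDiffOn_infty]
  intro n
  induction n with
  | zero =>
    exact contDiffOn_zero.mpr fun s hs => (hγ s hs).continuousAt.continuousWithinAt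
  | succ n ih =>
    rw [Nat.cast_succ, contDiffOn_succ_iff_deriv_of_isOpen hI]
    refine ⟨fun s hs => (hγ s hs).differentiableAt.differentiableWithinAt, by simp, ?_⟩
    exact ((hT.of_le (by exact_mod_cast le_top)).comp ih hmaps).congr fun s hs => (hγ s hs).deriv

/-- The unit vector of angle `θ` with the first field of a frame. -/
noncomputable def angleField (X₁ X₂ : E2 → E2) (θ : ℝ) : E2 → E2 :=
  fun y => Real.cos θ • X₁ y + Real.sin θ • X₂ y

variable {M : Type*} [TopologicalSpace M] [ChartedSpace E2 M]
  {φ : OpenPartialHomeomorph M E2} {f N : M → E3} {V : Set E2} {k₁ k₂ : E2 → ℝ} {X₁ X₂ : E2 → E2}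

theorem FrameField.smooth_angleField {F G : E2 → E3} (P : FrameField F G V k₁ k₂ X₁ X₂) (θ : ℝ) :
    ContDiffOn ℝ ∞ (angleField X₁ X₂ θ) V :=
  P.toPrincipalField.smooth_combination _ _

theorem FrameField.inner_angleField {F G : E2 → E3} (P : FrameField F G V k₁ k₂ X₁ X₂) (θ : ℝ)
    {x : E2} (hx : x ∈ V) : inner ℝ (fderiv ℝ F x (angleField X₁ X₂ θ x))
      (fderiv ℝ F x (angleField X₁ X₂ θ x)) = (1 : ℝ) := by
  have h11 : inner ℝ (fderiv ℝ F x (X₁ x)) (fderiv ℝ F x (X₁ x)) = (1 : ℝ) := by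
    rw [real_inner_self_eq_norm_sq, P.norm₁ x hx]; norm_num
  have h22 : inner ℝ (fderiv ℝ F x (X₂ x)) (fderiv ℝ F x (X₂ x)) = (1 : ℝ) := by
    rw [real_inner_self_eq_norm_sq, P.norm₂ x hx]; norm_num
  have h12 := P.orth x hx
  have h21 := (real_inner_comm (fderiv ℝ F x (X₁ x)) (fderiv ℝ F x (X₂ x))).trans h12
  simp only [angleField, map_add, map_smul, inner_add_left, inner_add_right, inner_smul_left,
    inner_smul_right, h11, h22, h12, h21, conj_trivial]
  linarith [Real.sin_sq_add_cos_sq θ]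

/-- Through every point of a principal frame field there is a leaf of every angle. -/
theorem FrameField.exists_leafArc (hf : IsOrientedSurface f N)
    (hφ : φ ∈ IsManifold.maximalAtlas (𝓡 2) ∞ M)
    (P : FrameField (f ∘ φ.symm) (N ∘ φ.symm) V k₁ k₂ X₁ X₂) (hV : V ⊆ φ.target) {x : E2}
    (hx : x ∈ V) (θ : ℝ) : ∃ (c : ℝ → M) (a b t : ℝ), t ∈ Ioo a b ∧ c t = φ.symm x ∧
      MapsTo c (Ioo a b) (φ.symm '' V) ∧ IsLeafArc f N θ c a b := by
  have hT := P.smooth_angleField θ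
  obtain ⟨γ, hγ0, ε, hε, hγ⟩ :=
    ((hT.contDiffAt (P.isOpen.mem_nhds hx)).of_le
      (by exact_mod_cast le_top : (1 : ℕ∞ω) ≤ ∞)).exists_forall_mem_closedBall_exists_eq_forall_mem_Ioo_hasDerivAt₀ 0
  have hcont : ContinuousAt γ 0 := (hγ 0 ⟨by linarith, by linarith⟩).continuousAt
  have hnhds : γ ⁻¹' V ∈ nhds (0 : ℝ) := hcont.preimage_mem_nhds (by
    rw [hγ0]; exact P.isOpen.mem_nhds hx)
  obtain ⟨δ, hδ, hball⟩ := Metric.mem_nhds_iff.mp hnhds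
  set η := min ε δ
  have hη : 0 < η := lt_min hε hδ
  have hmaps : MapsTo γ (Ioo (-η) η) V := fun s hs => hball (by
    rw [Metric.mem_ball, Real.dist_eq, sub_zero, abs_lt]
    exact ⟨by linarith [hs.1, min_le_right ε δ], by linarith [hs.2, min_le_right ε δ]⟩)
  have hder : ∀ s ∈ Ioo (-η) η, HasDerivAt γ (angleField X₁ X₂ θ (γ s)) s := fun s hs =>
    hγ s ⟨by linarith [hs.1, min_le_left ε δ], by linarith [hs.2, min_le_left ε δ]⟩
  have hsm := contDiffOn_of_hasDerivAt_comp isOpen_Ioo hT hmaps hder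
  refine ⟨φ.symm ∘ γ, -η, η, 0, ⟨by linarith, hη⟩, by simp [hγ0], fun s hs => ⟨γ s, hmaps hs, rfl⟩,
    ?_, fun s hs => ?_⟩
  · exact (contMDiffOn_symm_of_mem_maximalAtlas hφ).comp (contMDiffOn_iff_contDiffOn.mpr hsm)
      fun s hs => hV (hmaps hs)
  · have hp : φ.symm (γ s) ∈ φ.source := φ.map_target (hV (hmaps hs))
    have hr : φ (φ.symm (γ s)) = γ s := φ.right_inv (hV (hmaps hs))
    have hfr := P.isPrincipalFrame hf hφ hp (by rw [hr]; exact hmaps hs)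
    refine ⟨_, _, _, _, 1, hfr, one_ne_zero, ?_⟩
    have hd : HasDerivAt (fun s => (f ∘ φ.symm) (γ s)) _ s :=
      (P.smooth.differentiableAt_of_isOpen P.isOpen (hmaps hs)).hasFDerivAt.comp_hasDerivAt s
        (hder s hs)
    rw [show f ∘ φ.symm ∘ γ = fun s => (f ∘ φ.symm) (γ s) from rfl, hd.deriv, hr, one_smul,
      angleField, map_add, map_smul, map_smul]

/-- In a chart, a leaf is an arbitrarily parametrized integral curve of the field of the given
angle. -/
theorem FrameField.leafArc_chart (hf : IsOrientedSurface f N)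
    (hφ : φ ∈ IsManifold.maximalAtlas (𝓡 2) ∞ M)
    (P : FrameField (f ∘ φ.symm) (N ∘ φ.symm) V k₁ k₂ X₁ X₂) {θ : ℝ} {c : ℝ → M} {a b t : ℝ}
    (hc : IsLeafArc f N θ c a b) (ht : t ∈ Ioo a b) (hp : c t ∈ φ.source) (hV : φ (c t) ∈ V) :
    ∃ (I : Set ℝ) (r : ℝ → ℝ), IsOpen I ∧ t ∈ I ∧ MapsTo c I φ.source ∧
      MapsTo (fun s => φ (c s)) I V ∧ ContDiffOn ℝ ∞ r I ∧ r t ≠ 0 ∧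
      ∀ s ∈ I, HasDerivAt (fun s => φ (c s)) (r s • angleField X₁ X₂ θ (φ (c s))) s := by
  obtain ⟨hsm, hleaf⟩ := hc
  have hcont := hsm.continuousOn
  have hO : IsOpen (φ.source ∩ φ ⁻¹' V) := φ.isOpen_inter_preimage P.isOpen
  set I := Ioo a b ∩ c ⁻¹' (φ.source ∩ φ ⁻¹' V) with hIdef
  have hI : IsOpen I := hcont.isOpen_inter_preimage isOpen_Ioo hO
  set γ : ℝ → E2 := fun s => φ (c s) with hγdef
  have hγsm : ContDiffOn ℝ ∞ γ I := contMDiffOn_iff_contDiffOn.mp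
    ((contMDiffOn_of_mem_maximalAtlas hφ).comp (hsm.mono inter_subset_left) fun s hs => hs.2.1)
  have hmV : MapsTo γ I V := fun s hs => hs.2.2
  have hdγ : ∀ s ∈ I, HasDerivAt γ (deriv γ s) s := fun s hs =>
    ((hγsm.contDiffAt (hI.mem_nhds hs)).differentiableAt (by simp)).hasDerivAt
  have hfc : ∀ s ∈ I, deriv (f ∘ c) s = fderiv ℝ (f ∘ φ.symm) (γ s) (deriv γ s) := by
    intro s hs
    have he : f ∘ c =ᶠ[nhds s] fun s => (f ∘ φ.symm) (γ s) := by
      filter_upwards [hI.mem_nhds hs] with s' hs'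
      simp [hγdef, φ.left_inv hs'.2.1]
    rw [he.deriv_eq]
    exact ((P.smooth.differentiableAt_of_isOpen P.isOpen (hmV hs)).hasFDerivAt.comp_hasDerivAt s
      (hdγ s hs)).deriv
  have hex : ∀ s ∈ I, ∃ ρ : ℝ, ρ ≠ 0 ∧ deriv γ s = ρ • angleField X₁ X₂ θ (γ s) := by
    intro s hs
    obtain ⟨κ₁, κ₂, e₁, e₂, ρ, hfr, hρ, hd⟩ := hleaf s hs.1
    obtain ⟨ε, hε, he₁, he₂⟩ := P.eq_of_isPrincipalFrame hf hφ hs.2.1 hs.2.2 hfr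
    refine ⟨ρ * ε, mul_ne_zero hρ (by rintro rfl; norm_num at hε), ?_⟩
    rw [hfc s hs, he₁, he₂] at hd
    have h0 : fderiv ℝ (f ∘ φ.symm) (γ s) (deriv γ s - (ρ * ε) • angleField X₁ X₂ θ (γ s)) = 0 := by
      rw [map_sub, hd, angleField, map_smul, map_add, map_smul, map_smul]
      module
    exact sub_eq_zero.mp (P.immersion _ (hmV hs) _ h0)
  have hT := P.smooth_angleField θ
  -- The definition of a leaf gives frames and factors separately at each time, without regularity
  -- and with an undetermined sign. The inner product with the unit field of angle `θ` recovers a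
  -- smooth signed speed.
  set r : ℝ → ℝ := fun s => inner ℝ (fderiv ℝ (f ∘ φ.symm) (γ s) (deriv γ s))
    (fderiv ℝ (f ∘ φ.symm) (γ s) (angleField X₁ X₂ θ (γ s))) with hr
  have hreq : ∀ s ∈ I, ∀ ρ : ℝ, deriv γ s = ρ • angleField X₁ X₂ θ (γ s) → r s = ρ := by
    intro s hs ρ h
    rw [hr]
    simp only [h, map_smul, inner_smul_left, P.inner_angleField θ (hmV hs)]
    simp
  refine ⟨I, r, hI, ⟨ht, hp, hV⟩, fun s hs => hs.2.1, hmV, ?_, ?_, fun s hs => ?_⟩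
  · have h1 : ContDiffOn ℝ ∞ (fun s => fderiv ℝ (f ∘ φ.symm) (γ s)) I :=
      (P.smooth.fderiv_of_isOpen P.isOpen (by simp)).comp hγsm hmV
    exact (h1.clm_apply (hγsm.deriv_of_isOpen hI (by simp))).inner ℝ
      (h1.clm_apply (hT.comp hγsm hmV))
  · obtain ⟨ρ, hρ, h⟩ := hex t ⟨ht, hp, hV⟩
    rwa [hreq t ⟨ht, hp, hV⟩ ρ h]
  · obtain ⟨ρ, hρ, h⟩ := hex s hs
    rw [hreq s hs ρ h, ← h]
    exact hdγ s hs

theorem lorentz_lightLift (σ : L5) (x : E3) :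
    lorentz σ (lightLift x) = lorentz ((2 : ℝ) • σ) (halfLift x) := by
  rw [halfLift, lorentz_smul_left, lorentz_smul_right]; ring

theorem sphereTangentAt_iff (hf : IsOrientedSurface f N)
    (hφ : φ ∈ IsManifold.maximalAtlas (𝓡 2) ∞ M)
    (P : FrameField (f ∘ φ.symm) (N ∘ φ.symm) V k₁ k₂ X₁ X₂) {p : M} (hp : p ∈ φ.source)
    (hV : φ p ∈ V) (σ : L5) : SphereTangentAt f σ p ↔
      lorentz σ (halfLift ((f ∘ φ.symm) (φ p))) = 0 ∧
        ∀ Y, lorentz σ (dirDeriv Y (fun y => halfLift ((f ∘ φ.symm) y)) (φ p)) = 0 := by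
  have hsm : ContMDiff (𝓡 2) 𝓘(ℝ, ℝ) ∞ (fun q => lorentz σ (lightLift (f q))) :=
    ((lorentzBilin σ).contDiff.comp contDiff_lightLift).contMDiff.comp hf.smooth
  have hd : ∀ v, fderiv ℝ ((fun q => lorentz σ (lightLift (f q))) ∘ φ.symm) (φ p) v =
      2 * lorentz σ (dirDeriv (fun _ => v) (fun y => halfLift ((f ∘ φ.symm) y)) (φ p)) := by
    intro v
    have := dirDeriv_lorentz (X := fun _ => v) (g := fun _ => (2 : ℝ) • σ) (x := φ p)
      (differentiableAt_const _) ((P.toPrincipalField.smooth_m).differentiableAt_of_isOpen P.isOpen hV)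
    simp only [dirDeriv_const_on isOpen_univ (g := fun _ => (2 : ℝ) • σ) (fun _ _ => rfl)
      (mem_univ _), lorentz_zero_left, zero_add, lorentz_smul_left] at this
    rw [← this, dirDeriv]
    congr 2
    ext y
    simp [← lorentz_smul_left, lorentz_lightLift]
  refine and_congr ?_ ⟨fun h Y => ?_, fun h => ?_⟩
  · rw [lorentz_lightLift, lorentz_smul_left, Function.comp_apply, φ.left_inv hp]
    simp
  · obtain ⟨w, hw⟩ := (chartDeriv_bijective hφ hp).2 (Y (φ p))
    have h1 := surfDeriv_eq_comp hφ hp hsm w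
    rw [h, hw, hd] at h1
    have h2 : (0 : ℝ) = 2 * lorentz σ
      (dirDeriv (fun _ => Y (φ p)) (fun y => halfLift ((f ∘ φ.symm) y)) (φ p)) := h1
    change lorentz σ (dirDeriv (fun _ => Y (φ p)) _ _) = 0
    linarith
  · ext v
    rw [surfDeriv_eq_comp hφ hp hsm, hd, h, mul_zero]
    rfl

/-- At a point of a leaf of angle `θ` the Darboux condition is the vanishing of the ridge expression
of angle `θ`. -/
theorem FrameField.darboux_iff (hf : IsOrientedSurface f N)
    (hφ : φ ∈ IsManifold.maximalAtlas (𝓡 2) ∞ M)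
    (P : FrameField (f ∘ φ.symm) (N ∘ φ.symm) V k₁ k₂ X₁ X₂) {θ : ℝ} {c : ℝ → M} {a b t : ℝ}
    (hc : IsLeafArc f N θ c a b) (ht : t ∈ Ioo a b) (hp : c t ∈ φ.source) (hV : φ (c t) ∈ V) :
    (∃ σ : L5, IsSphere σ ∧ OsculatesAt (f ∘ c) σ t ∧ SphereTangentAt f σ (c t)) ↔
      Real.cos θ ^ 3 * dirDeriv X₁ k₁ (φ (c t)) + Real.sin θ ^ 3 * dirDeriv X₂ k₂ (φ (c t)) = 0 := by
  obtain ⟨I, r, hI, htI, hms, hmV, hr, hr0, hγ⟩ := P.leafArc_chart hf hφ hc ht hp hV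
  have Q := P.toPrincipalField
  have hT := P.smooth_angleField θ
  set m : E2 → L5 := fun y => halfLift ((f ∘ φ.symm) y) with hm
  have s1 := hT.dirDeriv P.isOpen Q.smooth_m
  have s2 := hT.dirDeriv P.isOpen s1
  have hcs : Real.cos θ ^ 2 + Real.sin θ ^ 2 = 1 := by rw [add_comm]; exact Real.sin_sq_add_cos_sq θ
  have dσ : ∀ (τ : L5) (u : E2 → L5), ContDiffOn ℝ ∞ u V → ∀ y ∈ V,
      dirDeriv (angleField X₁ X₂ θ) (fun y => lorentz τ (u y)) y =
        lorentz τ (dirDeriv (angleField X₁ X₂ θ) u y) := by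
    intro τ u hu y hy
    rw [dirDeriv_lorentz (g := fun _ => τ) (differentiableAt_const _)
      (hu.differentiableAt_of_isOpen P.isOpen hy), dirDeriv_const_on isOpen_univ (g := fun _ => τ)
      (fun _ _ => rfl) (mem_univ _), lorentz_zero_left, zero_add]
  have osc : ∀ σ : L5, OsculatesAt (f ∘ c) σ t ↔ lorentz σ (m (φ (c t))) = 0 ∧
      lorentz σ (dirDeriv (angleField X₁ X₂ θ) m (φ (c t))) = 0 ∧
      lorentz σ (dirDeriv (angleField X₁ X₂ θ) (dirDeriv (angleField X₁ X₂ θ) m) (φ (c t))) = 0 ∧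
      lorentz σ (dirDeriv (angleField X₁ X₂ θ) (dirDeriv (angleField X₁ X₂ θ)
        (dirDeriv (angleField X₁ X₂ θ) m)) (φ (c t))) = 0 := by
    intro σ
    -- The factor `2` between `lightLift` and `halfLift` is absorbed in the sphere and does not
    -- affect vanishing.
    have he : (fun s => lorentz σ (lightLift ((f ∘ c) s))) =ᶠ[nhds t]
        fun s => (fun y => lorentz ((2 : ℝ) • σ) (m y)) (φ (c s)) := by
      filter_upwards [hI.mem_nhds htI] with s hs
      simp [hm, φ.left_inv (hms hs), lorentz_lightLift]
    have sg : ContDiffOn ℝ ∞ (fun y => lorentz ((2 : ℝ) • σ) (m y)) V :=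
      ContDiffOn.lorentz contDiffOn_const Q.smooth_m
    have key := iteratedDeriv_comp_eq_zero_iff P.isOpen hI hT hr hmV hγ sg htI hr0
    have d1 := dσ ((2 : ℝ) • σ) m Q.smooth_m
    have d2 : ∀ y ∈ V, _ = _ := fun y hy => (dirDeriv_congr (X := angleField X₁ X₂ θ) P.isOpen d1
      hy).trans (dσ ((2 : ℝ) • σ) _ s1 y hy)
    have d3 : ∀ y ∈ V, _ = _ := fun y hy => (dirDeriv_congr (X := angleField X₁ X₂ θ) P.isOpen d2
      hy).trans (dσ ((2 : ℝ) • σ) _ s2 y hy)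
    rw [d1 _ hV, d2 _ hV, d3 _ hV] at key
    simp only [lorentz_smul_left, mul_eq_zero, OfNat.ofNat_ne_zero, false_or] at key
    rw [← key]
    refine forall_congr' fun j => forall_congr' fun _ => ?_
    rw [he.iteratedDeriv_eq j]
    simp only [lorentz_smul_left]
  constructor
  · rintro ⟨σ, hσ, ho, htan⟩
    obtain ⟨h0, -, h2, h3⟩ := (osc σ).mp ho
    have htan' := ((sphereTangentAt_iff hf hφ P hp hV σ).mp htan).2
    exact Q.ridge_of_contact hcs hV hσ h0 (htan' X₁) (htan' X₂) h2 h3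
  · intro h
    obtain ⟨σ, hσ, h0, h1, h2, h3⟩ := Q.contact_of_ridge hcs hV h
    exact ⟨σ, hσ, (osc σ).mpr ⟨h0, h1 _, h2, h3⟩,
      (sphereTangentAt_iff hf hφ P hp hV σ).mpr ⟨h0, h1⟩⟩

theorem FrameField.deriv_leaf_ne_zero (hf : IsOrientedSurface f N)
    (hφ : φ ∈ IsManifold.maximalAtlas (𝓡 2) ∞ M)
    (P : FrameField (f ∘ φ.symm) (N ∘ φ.symm) V k₁ k₂ X₁ X₂) {θ : ℝ} {c : ℝ → M} {a b t : ℝ}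
    (hc : IsLeafArc f N θ c a b) (ht : t ∈ Ioo a b) (hp : c t ∈ φ.source) (hV : φ (c t) ∈ V) :
    deriv (f ∘ c) t ≠ 0 := by
  obtain ⟨κ₁, κ₂, e₁, e₂, ρ, hfr, hρ, hd⟩ := hc.2 t ht
  obtain ⟨ε, hε, he₁, he₂⟩ := P.eq_of_isPrincipalFrame hf hφ hp hV hfr
  have hT := P.inner_angleField θ hV
  rw [hd, he₁, he₂]
  have : Real.cos θ • ε • fderiv ℝ (f ∘ φ.symm) (φ (c t)) (X₁ (φ (c t))) +
      Real.sin θ • ε • fderiv ℝ (f ∘ φ.symm) (φ (c t)) (X₂ (φ (c t))) =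
      ε • fderiv ℝ (f ∘ φ.symm) (φ (c t)) (angleField X₁ X₂ θ (φ (c t))) := by
    rw [angleField, map_add, map_smul, map_smul]; module
  rw [this]
  refine smul_ne_zero hρ (smul_ne_zero (by rintro rfl; norm_num at hε) fun h => ?_)
  rw [h, inner_zero_left] at hT
  norm_num at hT

/-- Darboux leaves of both signs of an oblique angle force the ridge derivatives to vanish. -/
theorem FrameField.ridge_of_leavesAreDarboux (hf : IsOrientedSurface f N)
    (hφ : φ ∈ IsManifold.maximalAtlas (𝓡 2) ∞ M)
    (P : FrameField (f ∘ φ.symm) (N ∘ φ.symm) V k₁ k₂ X₁ X₂) (hV : V ⊆ φ.target) {U : Set M}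
    (hU : MapsTo φ.symm V U) {α : ℝ} (hα : α ∈ Ioo (-(Real.pi / 2)) (Real.pi / 2)) (hα0 : α ≠ 0)
    (h : LeavesAreDarboux f N α U) {x : E2} (hx : x ∈ V) :
    dirDeriv X₁ k₁ x = 0 ∧ dirDeriv X₂ k₂ x = 0 := by
  have key : ∀ θ, (θ = α ∨ θ = -α) →
      Real.cos θ ^ 3 * dirDeriv X₁ k₁ x + Real.sin θ ^ 3 * dirDeriv X₂ k₂ x = 0 := by
    intro θ hθ
    obtain ⟨c, a, b, t, ht, hct, hmaps, hleaf⟩ := P.exists_leafArc hf hφ hV hx θ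
    have hD := h c a b (fun s hs => by
      obtain ⟨y, hy, hys⟩ := hmaps hs
      rw [← hys]
      exact hU hy) (by rcases hθ with rfl | rfl <;> simp [hleaf])
    have hp : c t ∈ φ.source := by rw [hct]; exact φ.map_target (hV hx)
    have hr : φ (c t) = x := by rw [hct]; exact φ.right_inv (hV hx)
    have := (P.darboux_iff hf hφ hleaf ht hp (by rwa [hr])).mp (hD.2 t ht).2
    rwa [hr] at this
  have h1 := key α (Or.inl rfl)
  have h2 := key (-α) (Or.inr rfl)
  -- Cosine is even and sine odd, so sum and difference of the two equations isolate the two ridge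
  -- derivatives.
  rw [Real.cos_neg, Real.sin_neg] at h2
  have hc : Real.cos α ^ 3 ≠ 0 := pow_ne_zero 3 (Real.cos_pos_of_mem_Ioo hα).ne'
  have hs : Real.sin α ^ 3 ≠ 0 := by
    refine pow_ne_zero 3 fun h0 => hα0 ?_
    exact (Real.sin_eq_zero_iff_of_lt_of_lt (by linarith [hα.1, Real.pi_pos])
      (by linarith [hα.2, Real.pi_pos])).mp h0
  constructor
  · exact (mul_eq_zero.mp (show Real.cos α ^ 3 * dirDeriv X₁ k₁ x = 0 by linarith)).resolve_left hc
  · exact (mul_eq_zero.mp (show Real.sin α ^ 3 * dirDeriv X₂ k₂ x = 0 by linarith)).resolve_left hs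

/-- If the ridge derivatives vanish, all leaves of constant angle are Darboux curves. -/
theorem leavesAreDarboux_of_ridge (hf : IsOrientedSurface f N) {U : Set M}
    (h : ∀ p ∈ U, ∃ (φ : OpenPartialHomeomorph M E2) (V : Set E2) (k₁ k₂ : E2 → ℝ)
      (X₁ X₂ : E2 → E2), φ ∈ IsManifold.maximalAtlas (𝓡 2) ∞ M ∧ p ∈ φ.source ∧ φ p ∈ V ∧
      FrameField (f ∘ φ.symm) (N ∘ φ.symm) V k₁ k₂ X₁ X₂ ∧
      dirDeriv X₁ k₁ (φ p) = 0 ∧ dirDeriv X₂ k₂ (φ p) = 0) (α : ℝ) :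
    LeavesAreDarboux f N α U := by
  have key : ∀ θ c a b, MapsTo c (Ioo a b) U → IsLeafArc f N θ c a b → IsDarbouxArc f c a b := by
    intro θ c a b hmaps hleaf
    refine ⟨hleaf.1, fun t ht => ?_⟩
    obtain ⟨φ, V, k₁, k₂, X₁, X₂, hφ, hp, hV, P, h1, h2⟩ := h _ (hmaps ht)
    exact ⟨P.deriv_leaf_ne_zero hf hφ hleaf ht hp hV,
      (P.darboux_iff hf hφ hleaf ht hp hV).mpr (by rw [h1, h2]; ring)⟩
  rintro c a b hmaps (hl | hl)
  exacts [key _ c a b hmaps hl, key _ c a b hmaps hl]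

end Leaves

/-! ### Conformally normalized principal fields of a surface with vanishing ridge derivatives -/

/-- The two families of curvature spheres of a surface patch, each of them constant along its family
of lines of curvature, with commuting conformally normalized principal fields. -/
structure CyclideField (V : Set E2) (s₁ s₂ : E2 → L5) (X₁ X₂ : E2 → E2) : Prop where
  isOpen : IsOpen V
  smooth_s₁ : ContDiffOn ℝ ∞ s₁ V
  smooth_s₂ : ContDiffOn ℝ ∞ s₂ V
  smooth_X₁ : ContDiffOn ℝ ∞ X₁ V
  smooth_X₂ : ContDiffOn ℝ ∞ X₂ V
  d₁s₁ : ∀ x ∈ V, dirDeriv X₁ s₁ x = 0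
  d₂s₂ : ∀ x ∈ V, dirDeriv X₂ s₂ x = 0
  s₁₁ : ∀ x ∈ V, lorentz (s₁ x) (s₁ x) = 1
  s₂₂ : ∀ x ∈ V, lorentz (s₂ x) (s₂ x) = 1
  s₁₂ : ∀ x ∈ V, lorentz (s₁ x) (s₂ x) = 1
  unit₁ : ∀ x ∈ V, lorentz (dirDeriv X₁ s₂ x) (dirDeriv X₁ s₂ x) = 1
  unit₂ : ∀ x ∈ V, lorentz (dirDeriv X₂ s₁ x) (dirDeriv X₂ s₁ x) = 1
  bracket : ∀ x ∈ V, VectorField.lieBracket ℝ X₁ X₂ x = 0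

theorem dirDeriv_smul_field {F : Type*} [NormedAddCommGroup F] [NormedSpace ℝ F] (a : E2 → ℝ)
    (X : E2 → E2) (g : E2 → F) (x : E2) :
    dirDeriv (fun y => a y • X y) g x = a x • dirDeriv X g x := by
  simp [dirDeriv]

namespace PrincipalField

variable {V : Set E2} {m n : E2 → L5} {l : L5} {k₁ k₂ : E2 → ℝ} {X₁ X₂ : E2 → E2} {x : E2}
  (P : PrincipalField V m n l k₁ k₂ X₁ X₂)
include P

theorem gap_ne_zero (hx : x ∈ V) : k₁ x - k₂ x ≠ 0 := (sub_pos.mpr (P.lt x hx)).ne'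

theorem smooth_inv_gap : ContDiffOn ℝ ∞ (fun y => (k₁ y - k₂ y)⁻¹) V :=
  (P.smooth_k₁.sub P.smooth_k₂).inv fun _ hx => P.gap_ne_zero hx

theorem dirDeriv_inv_gap (Y : E2 → E2) (hx : x ∈ V) :
    dirDeriv Y (fun y => (k₁ y - k₂ y)⁻¹) x =
      -((k₁ x - k₂ x)⁻¹ * (k₁ x - k₂ x)⁻¹ * (dirDeriv Y k₁ x - dirDeriv Y k₂ x)) := by
  have d₁ := P.smooth_k₁.differentiableAt_of_isOpen P.isOpen hx
  have d₂ := P.smooth_k₂.differentiableAt_of_isOpen P.isOpen hx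
  have h := dirDeriv_mul (X := Y) (P.smooth_inv_gap.differentiableAt_of_isOpen P.isOpen hx)
    (d₁.fun_sub d₂)
  rw [dirDeriv_const_on P.isOpen (c := (1 : ℝ)) (fun y hy => inv_mul_cancel₀ (P.gap_ne_zero hy)) hx,
    dirDeriv_sub d₁ d₂] at h
  have hne := P.gap_ne_zero hx
  field_simp at h ⊢
  linear_combination -h

theorem dirDeriv_sphere (Y : E2 → E2) {k : E2 → ℝ} (hk : ContDiffOn ℝ ∞ k V) (hx : x ∈ V) :
    dirDeriv Y (fun y => n y + k y • m y) x =
      dirDeriv Y n x + (k x • dirDeriv Y m x + dirDeriv Y k x • m x) := by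
  have dk := hk.differentiableAt_of_isOpen P.isOpen hx
  have dm := P.smooth_m.differentiableAt_of_isOpen P.isOpen hx
  rw [dirDeriv_add (P.smooth_n.differentiableAt_of_isOpen P.isOpen hx) (dk.fun_smul dm),
    dirDeriv_smul dk dm]

theorem lorentz_spheres (a b : ℝ) (hx : x ∈ V) :
    lorentz (n x + a • m x) (n x + b • m x) = 1 := by
  simp [lorentz_add_left, lorentz_add_right, lorentz_smul_left, lorentz_smul_right, P.nn x hx,
    P.nm x hx, P.mm x hx, lorentz_comm (m x) (n x)]

/-- If the ridge derivatives vanish, the conformally normalized principal fields commute. -/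
theorem cyclideField (h₁ : ∀ x ∈ V, dirDeriv X₁ k₁ x = 0) (h₂ : ∀ x ∈ V, dirDeriv X₂ k₂ x = 0) :
    CyclideField V (fun y => n y + k₁ y • m y) (fun y => n y + k₂ y • m y)
      (fun y => (k₁ y - k₂ y)⁻¹ • X₁ y) (fun y => (k₁ y - k₂ y)⁻¹ • X₂ y) where
  isOpen := P.isOpen
  smooth_s₁ := P.smooth_n.add (P.smooth_k₁.smul P.smooth_m)
  smooth_s₂ := P.smooth_n.add (P.smooth_k₂.smul P.smooth_m)
  smooth_X₁ := P.smooth_inv_gap.smul P.smooth_X₁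
  smooth_X₂ := P.smooth_inv_gap.smul P.smooth_X₂
  d₁s₁ x hx := by
    rw [dirDeriv_smul_field, P.dirDeriv_sphere X₁ P.smooth_k₁ hx, P.dn₁ x hx, h₁ x hx]
    module
  d₂s₂ x hx := by
    rw [dirDeriv_smul_field, P.dirDeriv_sphere X₂ P.smooth_k₂ hx, P.dn₂ x hx, h₂ x hx]
    module
  s₁₁ x hx := P.lorentz_spheres _ _ hx
  s₂₂ x hx := P.lorentz_spheres _ _ hx
  s₁₂ x hx := P.lorentz_spheres _ _ hx
  unit₁ x hx := by
    rw [dirDeriv_smul_field, P.dirDeriv_sphere X₁ P.smooth_k₂ hx, P.dn₁ x hx]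
    -- The derivative of `s₂` along `X₁` is `-(k₁ - k₂) e₁` plus a multiple of `m`; the normalizing
    -- factor makes it a unit vector.
    have hne := P.gap_ne_zero hx
    simp only [lorentz_add_left, lorentz_add_right, lorentz_smul_left, lorentz_smul_right,
      lorentz_neg_left, lorentz_neg_right, P.unit₁ x hx, P.m_dirDeriv X₁ hx, P.mm x hx,
      lorentz_comm (dirDeriv X₁ m x) (m x)]
    field_simp
    ring
  unit₂ x hx := by
    rw [dirDeriv_smul_field, P.dirDeriv_sphere X₂ P.smooth_k₁ hx, P.dn₂ x hx]
    have hne := P.gap_ne_zero hx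
    simp only [lorentz_add_left, lorentz_add_right, lorentz_smul_left, lorentz_smul_right,
      lorentz_neg_left, lorentz_neg_right, P.unit₂ x hx, P.m_dirDeriv X₂ hx, P.mm x hx,
      lorentz_comm (dirDeriv X₂ m x) (m x)]
    field_simp
    ring
  bracket x hx := by
    have hne := P.gap_ne_zero hx
    have da := P.smooth_inv_gap.differentiableAt_of_isOpen P.isOpen hx
    have d₁ := P.smooth_X₁.differentiableAt_of_isOpen P.isOpen hx
    have d₂ := P.smooth_X₂.differentiableAt_of_isOpen P.isOpen hx
    -- With the ridge derivatives zero, the Codazzi equations make the derivatives of `(k₁ - k₂)⁻¹`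
    -- cancel exactly the coefficients of `[X₁, X₂]`.
    obtain ⟨c₁, c₂⟩ := P.codazzi hx
    change dirDeriv (fun y => (k₁ y - k₂ y)⁻¹ • X₁ y) (fun y => (k₁ y - k₂ y)⁻¹ • X₂ y) x -
      dirDeriv (fun y => (k₁ y - k₂ y)⁻¹ • X₂ y) (fun y => (k₁ y - k₂ y)⁻¹ • X₁ y) x = 0
    have hb : dirDeriv X₁ X₂ x - dirDeriv X₂ X₁ x = _ := P.lieBracket_eq hx
    rw [sub_eq_iff_eq_add] at hb
    rw [dirDeriv_smul_field, dirDeriv_smul_field, dirDeriv_smul da d₁, dirDeriv_smul da d₂,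
      P.dirDeriv_inv_gap X₁ hx, P.dirDeriv_inv_gap X₂ hx, h₁ x hx, h₂ x hx, c₁, c₂, hb]
    match_scalars <;> field_simp <;> ring

end PrincipalField

namespace CyclideField

variable {V : Set E2} {s₁ s₂ : E2 → L5} {X₁ X₂ : E2 → E2} {x : E2}

theorem swap (C : CyclideField V s₁ s₂ X₁ X₂) : CyclideField V s₂ s₁ X₂ X₁ where
  isOpen := C.isOpen
  smooth_s₁ := C.smooth_s₂
  smooth_s₂ := C.smooth_s₁
  smooth_X₁ := C.smooth_X₂
  smooth_X₂ := C.smooth_X₁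
  d₁s₁ := C.d₂s₂
  d₂s₂ := C.d₁s₁
  s₁₁ := C.s₂₂
  s₂₂ := C.s₁₁
  s₁₂ x hx := by rw [lorentz_comm, C.s₁₂ x hx]
  unit₁ := C.unit₂
  unit₂ := C.unit₁
  bracket x hx := by rw [VectorField.lieBracket_swap, C.bracket x hx, neg_zero]

/-- The acceleration of the curve of curvature spheres of the first family. -/
noncomputable def accel (s₁ : E2 → L5) (X₂ : E2 → E2) : E2 → L5 := dirDeriv X₂ (dirDeriv X₂ s₁)

/-- The squared norm of the acceleration. -/
noncomputable def accelSq (s₁ : E2 → L5) (X₂ : E2 → E2) : E2 → ℝ :=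
  fun x => lorentz (accel s₁ X₂ x) (accel s₁ X₂ x)

section
variable (C : CyclideField V s₁ s₂ X₁ X₂)
include C

theorem smooth_velocity : ContDiffOn ℝ ∞ (dirDeriv X₂ s₁) V := C.smooth_X₂.dirDeriv C.isOpen C.smooth_s₁

theorem smooth_accel : ContDiffOn ℝ ∞ (accel s₁ X₂) V :=
  C.smooth_X₂.dirDeriv C.isOpen C.smooth_velocity

theorem smooth_accelSq : ContDiffOn ℝ ∞ (accelSq s₁ X₂) V := C.smooth_accel.lorentz C.smooth_accel

theorem dirDeriv_comm {F : Type*} [NormedAddCommGroup F] [NormedSpace ℝ F] {g : E2 → F}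
    (hg : ContDiffOn ℝ ∞ g V) (hx : x ∈ V) :
    dirDeriv X₁ (dirDeriv X₂ g) x = dirDeriv X₂ (dirDeriv X₁ g) x := by
  have := dirDeriv_comm_sub C.isOpen hg C.smooth_X₁ C.smooth_X₂ hx
  rwa [C.bracket x hx, map_zero, sub_eq_zero] at this

/-- The fields commute and `s₁` is constant along `X₁`, hence so are its derivatives along `X₂`: the
first family of spheres is a curve with parameter along `X₂`. -/
theorem d₁_velocity (hx : x ∈ V) : dirDeriv X₁ (dirDeriv X₂ s₁) x = 0 := by
  rw [C.dirDeriv_comm C.smooth_s₁ hx]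
  exact dirDeriv_const_on C.isOpen C.d₁s₁ hx

theorem d₁_accel (hx : x ∈ V) : dirDeriv X₁ (accel s₁ X₂) x = 0 := by
  rw [accel, C.dirDeriv_comm C.smooth_velocity hx]
  exact dirDeriv_const_on C.isOpen (fun y hy => C.d₁_velocity hy) hx

theorem velocity_s₁ (hx : x ∈ V) : lorentz (dirDeriv X₂ s₁ x) (s₁ x) = 0 := by
  rw [lorentz_comm]
  exact lorentz_self_dirDeriv_of_const C.isOpen C.smooth_s₁ C.s₁₁ hx

theorem velocity_s₂ (hx : x ∈ V) : lorentz (dirDeriv X₂ s₁ x) (s₂ x) = 0 := by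
  have := lorentz_dirDeriv_of_const (X := X₂) C.isOpen C.smooth_s₁ C.smooth_s₂ C.s₁₂ hx
  rwa [C.d₂s₂ x hx, lorentz_zero_right, add_zero] at this

theorem velocity_velocity (hx : x ∈ V) : lorentz (dirDeriv X₂ s₁ x) (dirDeriv X₁ s₂ x) = 0 := by
  have := lorentz_dirDeriv_of_const (X := X₁) C.isOpen C.smooth_velocity C.smooth_s₂
    (fun y hy => C.velocity_s₂ hy) hx
  rwa [C.d₁_velocity hx, lorentz_zero_left, zero_add] at this

theorem accel_velocity (hx : x ∈ V) : lorentz (accel s₁ X₂ x) (dirDeriv X₂ s₁ x) = 0 := by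
  rw [lorentz_comm]
  exact lorentz_self_dirDeriv_of_const C.isOpen C.smooth_velocity C.unit₂ hx

theorem accel_s₁ (hx : x ∈ V) : lorentz (accel s₁ X₂ x) (s₁ x) = -1 := by
  have := lorentz_dirDeriv_of_const (X := X₂) C.isOpen C.smooth_velocity C.smooth_s₁
    (fun y hy => C.velocity_s₁ hy) hx
  change lorentz (accel s₁ X₂ x) (s₁ x) + _ = 0 at this
  linarith [C.unit₂ x hx]

theorem accel_s₂ (hx : x ∈ V) : lorentz (accel s₁ X₂ x) (s₂ x) = 0 := by
  have := lorentz_dirDeriv_of_const (X := X₂) C.isOpen C.smooth_velocity C.smooth_s₂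
    (fun y hy => C.velocity_s₂ hy) hx
  rwa [C.d₂s₂ x hx, lorentz_zero_right, add_zero] at this

theorem accel_velocity' (hx : x ∈ V) : lorentz (accel s₁ X₂ x) (dirDeriv X₁ s₂ x) = 0 := by
  have := lorentz_dirDeriv_of_const (X := X₂) C.isOpen C.smooth_velocity C.swap.smooth_velocity
    (fun y hy => C.velocity_velocity hy) hx
  rwa [C.swap.d₁_velocity hx, lorentz_zero_right, add_zero] at this

theorem accel_accel (hx : x ∈ V) : lorentz (accel s₁ X₂ x) (accel s₂ X₁ x) = 0 := by
  have := lorentz_dirDeriv_of_const (X := X₁) C.isOpen C.smooth_accel C.swap.smooth_velocity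
    (fun y hy => C.accel_velocity' hy) hx
  rwa [C.d₁_accel hx, lorentz_zero_left, zero_add] at this

/-- The accelerations of the two curves of curvature spheres determine each other. -/
theorem accel_swap (hx : x ∈ V) : accel s₂ X₁ x =
    -(accelSq s₁ X₂ x • s₁ x + (1 - accelSq s₁ X₂ x) • s₂ x + accel s₁ X₂ x) := by
  set q := accelSq s₁ X₂ x with hq
  have hqq : lorentz (accel s₁ X₂ x) (accel s₁ X₂ x) = q := rfl
  clear_value q
  clear hq
  have a1 := C.accel_s₁ hx
  have a2 := C.accel_s₂ hx
  have a3 := C.accel_velocity hx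
  have a4 := C.accel_velocity' hx
  have v1 := C.velocity_s₁ hx
  have v2 := C.velocity_s₂ hx
  have v3 := C.velocity_velocity hx
  have w1 := C.swap.velocity_s₁ hx
  have w2 := C.swap.velocity_s₂ hx
  have w3 := C.swap.velocity_velocity hx
  have a1' := (lorentz_comm _ _).trans a1
  have a2' := (lorentz_comm _ _).trans a2
  have a3' := (lorentz_comm _ _).trans a3
  have a4' := (lorentz_comm _ _).trans a4
  have v1' := (lorentz_comm _ _).trans v1
  have v2' := (lorentz_comm _ _).trans v2
  have w1' := (lorentz_comm _ _).trans w1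
  have w2' := (lorentz_comm _ _).trans w2
  have u1 := C.unit₁ x hx
  have u2 := C.unit₂ x hx
  have s11 := C.s₁₁ x hx
  have s22 := C.s₂₂ x hx
  have s12 := C.s₁₂ x hx
  have s21 := C.swap.s₁₂ x hx
  -- The first list consists of the two velocities, `s₁`, `s₂` and `a`; the second is its dual
  -- basis. The acceleration of `s₂` is orthogonal to every vector of the first list except `s₂`,
  -- with which its product is `-1`, so only the fourth dual vector survives.
  have h := eq_sum_of_lorentz_dual
    ![dirDeriv X₁ s₂ x, dirDeriv X₂ s₁ x, s₁ x, s₂ x, accel s₁ X₂ x]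
    ![dirDeriv X₁ s₂ x, dirDeriv X₂ s₁ x, q • s₂ x - q • s₁ x - accel s₁ X₂ x,
      q • s₁ x + (1 - q) • s₂ x + accel s₁ X₂ x, s₂ x - s₁ x] (by
    intro i j
    fin_cases i <;> fin_cases j <;>
      simp [lorentz_add_right, lorentz_sub_right, lorentz_smul_right, *]) (accel s₂ X₁ x)
  have b1 := C.swap.accel_s₁ hx
  have b2 := C.swap.accel_s₂ hx
  have b3 := C.swap.accel_velocity hx
  have b4 := C.swap.accel_velocity' hx
  rw [lorentz_comm] at b1 b2 b3 b4
  rw [Fin.sum_univ_five] at h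
  simp only [Matrix.cons_val, b1, b2, b3, b4, C.accel_accel hx] at h
  rw [h]
  module

/-- Pairing `accel_swap` with the acceleration of `s₂` leaves only the `s₂` term. The two values
have sum `1`, so at least one acceleration is spacelike. -/
theorem accelSq_swap (hx : x ∈ V) : accelSq s₂ X₁ x = 1 - accelSq s₁ X₂ x := by
  have h1 := C.swap.accel_s₁ hx
  have h2 := C.swap.accel_s₂ hx
  have h3 := C.accel_accel hx
  rw [accelSq]
  nth_rewrite 1 [C.accel_swap hx]
  rw [lorentz_comm] at h1 h2
  simp only [lorentz_neg_left, lorentz_add_left, lorentz_smul_left, h1, h2, h3]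
  ring

/-- The acceleration of `s₂` does not change along `X₂`, so the derivative of `accel_swap` along
`X₂` is zero. Its product with `a` says that `X₂ q` equals half of itself; what then remains is the
equation `X₂ a = -q v` of a conic. -/
theorem d_accelSq (hx : x ∈ V) : dirDeriv X₁ (accelSq s₁ X₂) x = 0 ∧
    dirDeriv X₂ (accelSq s₁ X₂) x = 0 ∧
    dirDeriv X₂ (accel s₁ X₂) x = -(accelSq s₁ X₂ x • dirDeriv X₂ s₁ x) := by
  have dA := C.smooth_accel.differentiableAt_of_isOpen C.isOpen hx
  have dq := C.smooth_accelSq.differentiableAt_of_isOpen C.isOpen hx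
  have d1 := C.smooth_s₁.differentiableAt_of_isOpen C.isOpen hx
  have d2 := C.smooth_s₂.differentiableAt_of_isOpen C.isOpen hx
  have h1 : dirDeriv X₁ (accelSq s₁ X₂) x = 0 := by
    have := dirDeriv_lorentz (X := X₁) dA dA
    rwa [C.d₁_accel hx, lorentz_zero_left, lorentz_zero_right, add_zero] at this
  have h2 : dirDeriv X₂ (accelSq s₁ X₂) x =
      2 * lorentz (dirDeriv X₂ (accel s₁ X₂) x) (accel s₁ X₂ x) := by
    have := dirDeriv_lorentz (X := X₂) dA dA
    rw [lorentz_comm (accel s₁ X₂ x)] at this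
    refine this.trans ?_
    ring
  have h3 : dirDeriv X₂ (accel s₂ X₁) x = 0 := C.swap.d₁_accel hx
  rw [dirDeriv_congr C.isOpen (fun y hy => C.accel_swap hy) hx, dirDeriv_neg,
    dirDeriv_add ((dq.fun_smul d1).fun_add ((dq.const_sub 1).fun_smul d2)) dA,
    dirDeriv_add (dq.fun_smul d1) ((dq.const_sub 1).fun_smul d2), dirDeriv_smul dq d1,
    dirDeriv_smul (dq.const_sub 1) d2, dirDeriv_sub (differentiableAt_const _) dq,
    dirDeriv_const_on isOpen_univ (g := fun _ => (1 : ℝ)) (fun _ _ => rfl) (mem_univ x),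
    C.d₂s₂ x hx, neg_eq_zero] at h3
  have h4 := congrArg (fun y => lorentz y (accel s₁ X₂ x)) h3
  simp only [lorentz_add_left, lorentz_smul_left, lorentz_zero_left] at h4
  rw [lorentz_comm (s₁ x), lorentz_comm (s₂ x), C.accel_s₁ hx, C.accel_s₂ hx, lorentz_comm
    (dirDeriv X₂ s₁ x), C.accel_velocity hx] at h4
  have h5 : dirDeriv X₂ (accelSq s₁ X₂) x = 0 := by linarith
  refine ⟨h1, h5, ?_⟩
  rw [h5] at h3
  rw [eq_neg_iff_add_eq_zero, ← h3]
  module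

/-- The sum `ds₁ + ds₂` maps the two fields to the two velocities, which are orthonormal. -/
theorem exists_eq (hx : x ∈ V) (z : E2) : ∃ a b : ℝ, z = a • X₁ x + b • X₂ x := by
  have e1 : (fderiv ℝ s₁ x + fderiv ℝ s₂ x) (X₁ x) = dirDeriv X₁ s₂ x := by
    change dirDeriv X₁ s₁ x + dirDeriv X₁ s₂ x = _
    rw [C.d₁s₁ x hx, zero_add]
  have e2 : (fderiv ℝ s₁ x + fderiv ℝ s₂ x) (X₂ x) = dirDeriv X₂ s₁ x := by
    change dirDeriv X₂ s₁ x + dirDeriv X₂ s₂ x = _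
    rw [C.d₂s₂ x hx, add_zero]
  refine exists_eq_smul_add_smul (L := ((fderiv ℝ s₁ x + fderiv ℝ s₂ x : E2 →L[ℝ] L5) : E2 →ₗ[ℝ] L5))
    ?_ ?_ ?_ z
  · rw [ContinuousLinearMap.coe_coe, e1, C.unit₁ x hx]; norm_num
  · rw [ContinuousLinearMap.coe_coe, e2, C.unit₂ x hx]; norm_num
  · rw [ContinuousLinearMap.coe_coe, e1, e2, lorentz_comm, C.velocity_velocity hx]

theorem eventually_const {F : Type*} [NormedAddCommGroup F] [NormedSpace ℝ F] {g : E2 → F}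
    (hg : ContDiffOn ℝ ∞ g V) (h₁ : ∀ x ∈ V, dirDeriv X₁ g x = 0)
    (h₂ : ∀ x ∈ V, dirDeriv X₂ g x = 0) (hx : x ∈ V) : ∀ᶠ y in nhds x, g y = g x := by
  obtain ⟨r, hr, hball⟩ := Metric.mem_nhds_iff.mp (C.isOpen.mem_nhds hx)
  filter_upwards [Metric.ball_mem_nhds x hr] with y hy
  refine Metric.isOpen_ball.is_const_of_fderiv_eq_zero (𝕜 := ℝ)
    (convex_ball x r).isPreconnected (hg.mono hball |>.differentiableOn (by simp))
    (fun z hz => ?_) hy (Metric.mem_ball_self hr)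
  ext v
  obtain ⟨a, b, rfl⟩ := C.exists_eq (hball hz) v
  rw [map_add, map_smul, map_smul]
  change _ = (0 : F)
  rw [show fderiv ℝ g z (X₁ z) = 0 from h₁ z (hball hz),
    show fderiv ℝ g z (X₂ z) = 0 from h₂ z (hball hz), smul_zero, smul_zero, add_zero]

theorem accelSq_eventually (hx : x ∈ V) :
    ∀ᶠ y in nhds x, accelSq s₁ X₂ y = accelSq s₁ X₂ x :=
  C.eventually_const C.smooth_accelSq (fun _ hy => (C.d_accelSq hy).1)
    (fun _ hy => (C.d_accelSq hy).2.1) hx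

/-- Along `X₂` the derivative `-q v` of `a` cancels the derivative `q v` of `q s₁`. -/
theorem center_eventually (hx : x ∈ V) :
    ∀ᶠ y in nhds x, accel s₁ X₂ y + accelSq s₁ X₂ y • s₁ y =
      accel s₁ X₂ x + accelSq s₁ X₂ x • s₁ x := by
  refine C.eventually_const (g := fun y => accel s₁ X₂ y + accelSq s₁ X₂ y • s₁ y)
    (C.smooth_accel.add (C.smooth_accelSq.smul C.smooth_s₁)) (fun y hy => ?_) (fun y hy => ?_) hx
  all_goals
    have dA := C.smooth_accel.differentiableAt_of_isOpen C.isOpen hy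
    have dq := C.smooth_accelSq.differentiableAt_of_isOpen C.isOpen hy
    have d1 := C.smooth_s₁.differentiableAt_of_isOpen C.isOpen hy
    obtain ⟨h1, h2, h3⟩ := C.d_accelSq hy
    rw [dirDeriv_add dA (dq.fun_smul d1), dirDeriv_smul dq d1]
  · rw [C.d₁_accel hy, C.d₁s₁ y hy, h1]; simp
  · rw [h3, h2]; simp

/-- This is conservation of energy for `v' = a`, `a' = -q v`: the two squares have opposite
derivatives. -/
theorem quadric_eventually (hx : x ∈ V) (z : L5) :
    ∀ᶠ y in nhds x, accelSq s₁ X₂ y * lorentz (dirDeriv X₂ s₁ y) z ^ 2 +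
        lorentz (accel s₁ X₂ y) z ^ 2 =
      accelSq s₁ X₂ x * lorentz (dirDeriv X₂ s₁ x) z ^ 2 + lorentz (accel s₁ X₂ x) z ^ 2 := by
  have sv : ContDiffOn ℝ ∞ (fun y => lorentz (dirDeriv X₂ s₁ y) z) V :=
    C.smooth_velocity.lorentz contDiffOn_const
  have sa : ContDiffOn ℝ ∞ (fun y => lorentz (accel s₁ X₂ y) z) V :=
    C.smooth_accel.lorentz contDiffOn_const
  have sv2 : ContDiffOn ℝ ∞ (fun y => lorentz (dirDeriv X₂ s₁ y) z * lorentz (dirDeriv X₂ s₁ y) z) V :=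
    sv.mul sv
  have key : ∀ (Y : E2 → E2), ∀ y ∈ V, dirDeriv Y (fun y => accelSq s₁ X₂ y *
      (lorentz (dirDeriv X₂ s₁ y) z * lorentz (dirDeriv X₂ s₁ y) z) +
      lorentz (accel s₁ X₂ y) z * lorentz (accel s₁ X₂ y) z) y =
      dirDeriv Y (accelSq s₁ X₂) y * lorentz (dirDeriv X₂ s₁ y) z ^ 2 + 2 * accelSq s₁ X₂ y *
        lorentz (dirDeriv X₂ s₁ y) z * lorentz (dirDeriv Y (dirDeriv X₂ s₁) y) z +
        2 * lorentz (accel s₁ X₂ y) z * lorentz (dirDeriv Y (accel s₁ X₂) y) z := by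
    intro Y y hy
    have dz : ∀ {u : E2 → L5}, ContDiffOn ℝ ∞ u V →
        dirDeriv Y (fun y => lorentz (u y) z) y = lorentz (dirDeriv Y u y) z := fun hu => by
      rw [dirDeriv_lorentz (g' := fun _ => z) (hu.differentiableAt_of_isOpen C.isOpen hy)
        (differentiableAt_const _), dirDeriv_const_on isOpen_univ (g := fun _ => z)
        (fun _ _ => rfl) (mem_univ _), lorentz_zero_right, add_zero]
    have dq := C.smooth_accelSq.differentiableAt_of_isOpen C.isOpen hy
    have dv := sv.differentiableAt_of_isOpen C.isOpen hy
    have dv2 := sv2.differentiableAt_of_isOpen C.isOpen hy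
    have da := sa.differentiableAt_of_isOpen C.isOpen hy
    rw [dirDeriv_add (dq.fun_mul dv2) (da.fun_mul da), dirDeriv_mul dq dv2, dirDeriv_mul dv dv,
      dirDeriv_mul da da, dz C.smooth_velocity, dz C.smooth_accel]
    ring
  have := C.eventually_const (g := fun y => accelSq s₁ X₂ y *
      (lorentz (dirDeriv X₂ s₁ y) z * lorentz (dirDeriv X₂ s₁ y) z) +
      lorentz (accel s₁ X₂ y) z * lorentz (accel s₁ X₂ y) z)
    ((C.smooth_accelSq.mul sv2).add (sa.mul sa)) (fun y hy => ?_) (fun y hy => ?_) hx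
  · simpa only [pow_two] using this
  · rw [key X₁ y hy, (C.d_accelSq hy).1, C.d₁_velocity hy, C.d₁_accel hy, lorentz_zero_left]
    ring
  · rw [key X₂ y hy, (C.d_accelSq hy).2.1, (C.d_accelSq hy).2.2, lorentz_neg_left,
      lorentz_smul_left, show dirDeriv X₂ (dirDeriv X₂ s₁) y = accel s₁ X₂ y from rfl]
    ring

end

end CyclideField

/-! ### Charts rectifying commuting fields -/

namespace CyclideField

variable {V : Set E2} {s₁ s₂ : E2 → L5} {X₁ X₂ : E2 → E2} (C : CyclideField V s₁ s₂ X₁ X₂)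
include C

/-- A smooth one-form that is constant on the two fields has a local primitive. -/
theorem exists_primitive {W : Set E2} (hW : Convex ℝ W) (hWo : IsOpen W) (hWV : W ⊆ V)
    {η : E2 → E2 →L[ℝ] ℝ} (hη : ContDiffOn ℝ ∞ η V) {c₁ c₂ : ℝ} (h₁ : ∀ x ∈ V, η x (X₁ x) = c₁)
    (h₂ : ∀ x ∈ V, η x (X₂ x) = c₂) : ∃ u : E2 → ℝ, ∀ x ∈ W, HasFDerivAt u (η x) x := by
  refine hW.exists_forall_hasFDerivAt_of_fderiv_symmetric hWo
    ((hη.mono hWV).differentiableOn (by simp)) fun x hxW v w => ?_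
  -- Closedness: `dη (X₁, X₂)` equals `X₁ (η X₂) - X₂ (η X₁) - η [X₁, X₂]`, where every term
  -- vanishes, and the fields span the plane. The Poincaré lemma on the convex set gives the
  -- primitive.
  have hx := hWV hxW
  have dη := (hη.contDiffAt (C.isOpen.mem_nhds hx)).differentiableAt (by simp)
  have e : ∀ (X Y : E2 → E2), ContDiffOn ℝ ∞ Y V → ∀ c : ℝ, (∀ x ∈ V, η x (Y x) = c) →
      fderiv ℝ η x (X x) (Y x) = -η x (fderiv ℝ Y x (X x)) := by
    intro X Y hY c h
    have h0 : dirDeriv X (fun y => η y (Y y)) x = 0 := dirDeriv_const_on C.isOpen h hx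
    rw [dirDeriv, fderiv_clm_apply dη (hY.differentiableAt_of_isOpen C.isOpen hx)] at h0
    simp only [add_apply, ContinuousLinearMap.comp_apply,
      ContinuousLinearMap.flip_apply] at h0
    linarith
  have h12 : fderiv ℝ η x (X₁ x) (X₂ x) = fderiv ℝ η x (X₂ x) (X₁ x) := by
    rw [e X₁ X₂ C.smooth_X₂ c₂ h₂, e X₂ X₁ C.smooth_X₁ c₁ h₁]
    have hb := C.bracket x hx
    rw [VectorField.lieBracket, sub_eq_zero] at hb
    rw [hb]
  obtain ⟨a, b, rfl⟩ := C.exists_eq hx v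
  obtain ⟨a', b', rfl⟩ := C.exists_eq hx w
  simp only [map_add, map_smul, add_apply, smul_apply, smul_eq_mul, h12]
  ring

/-- Around each point there are coordinates whose coordinate fields are the two fields. -/
theorem exists_rectifying {x₀ : E2} (hx₀ : x₀ ∈ V) :
    ∃ Φ : OpenPartialHomeomorph E2 E2, x₀ ∈ Φ.source ∧ Φ.source ⊆ V ∧
      ContDiffOn ℝ ∞ Φ Φ.source ∧ ContDiffOn ℝ ∞ Φ.symm Φ.target ∧
      ∀ y ∈ Φ.target, fderiv ℝ Φ.symm y (EuclideanSpace.single 0 1) = X₁ (Φ.symm y) ∧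
        fderiv ℝ Φ.symm y (EuclideanSpace.single 1 1) = X₂ (Φ.symm y) := by
  obtain ⟨ρ, hρ, hball⟩ := Metric.mem_nhds_iff.mp (C.isOpen.mem_nhds hx₀)
  set W := Metric.ball x₀ ρ
  have smooth_form : ∀ (u s : E2 → L5), ContDiffOn ℝ ∞ u V → ContDiffOn ℝ ∞ s V →
      ContDiffOn ℝ ∞ (fun x => (lorentzBilin (u x)).comp (fderiv ℝ s x)) V := fun u s hu hs =>
    (lorentzBilin.contDiff.comp_contDiffOn hu).clm_comp (hs.fderiv_of_isOpen C.isOpen (by simp))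
  -- The forms `⟨X₁ s₂, ds₂⟩` and `⟨X₂ s₁, ds₁⟩` are dual to the fields, since each `sᵢ` is constant
  -- along `Xᵢ` and the velocities are unit. Their primitives are the coordinates.
  obtain ⟨η₁, hη₁⟩ : ∃ η : E2 → E2 →L[ℝ] ℝ, η = fun x =>
    (lorentzBilin (dirDeriv X₁ s₂ x)).comp (fderiv ℝ s₂ x) := ⟨_, rfl⟩
  obtain ⟨η₂, hη₂⟩ : ∃ η : E2 → E2 →L[ℝ] ℝ, η = fun x =>
    (lorentzBilin (dirDeriv X₂ s₁ x)).comp (fderiv ℝ s₁ x) := ⟨_, rfl⟩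
  have sη₁ : ContDiffOn ℝ ∞ η₁ V := by
    rw [hη₁]; exact smooth_form _ _ C.swap.smooth_velocity C.smooth_s₂
  have sη₂ : ContDiffOn ℝ ∞ η₂ V := by
    rw [hη₂]; exact smooth_form _ _ C.smooth_velocity C.smooth_s₁
  have e11 : ∀ x ∈ V, η₁ x (X₁ x) = 1 := fun x hx => by rw [hη₁]; exact C.unit₁ x hx
  have e22 : ∀ x ∈ V, η₂ x (X₂ x) = 1 := fun x hx => by rw [hη₂]; exact C.unit₂ x hx
  have e12 : ∀ x ∈ V, η₁ x (X₂ x) = 0 := fun x hx => by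
    rw [hη₁]
    change lorentz _ (dirDeriv X₂ s₂ x) = 0
    rw [C.d₂s₂ x hx, lorentz_zero_right]
  have e21 : ∀ x ∈ V, η₂ x (X₁ x) = 0 := fun x hx => by
    rw [hη₂]
    change lorentz _ (dirDeriv X₁ s₁ x) = 0
    rw [C.d₁s₁ x hx, lorentz_zero_right]
  obtain ⟨u₁, hu₁⟩ := C.exists_primitive (convex_ball x₀ ρ) Metric.isOpen_ball hball sη₁ e11 e12
  obtain ⟨u₂, hu₂⟩ := C.exists_primitive (convex_ball x₀ ρ) Metric.isOpen_ball hball sη₂ e21 e22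
  have smooth_u : ∀ (u : E2 → ℝ) (η : E2 → E2 →L[ℝ] ℝ), ContDiffOn ℝ ∞ η V →
      (∀ x ∈ W, HasFDerivAt u (η x) x) → ContDiffOn ℝ ∞ u W := by
    intro u η hη h
    rw [contDiffOn_infty_iff_fderiv_of_isOpen Metric.isOpen_ball]
    exact ⟨fun x hx => (h x hx).differentiableAt.differentiableWithinAt,
      (hη.mono hball).congr fun x hx => (h x hx).fderiv⟩
  set u : E2 → E2 := fun x => WithLp.toLp 2 ![u₁ x, u₂ x] with hu
  have su : ContDiffOn ℝ ∞ u W := by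
    rw [contDiffOn_piLp]
    intro i
    fin_cases i
    exacts [smooth_u u₁ η₁ sη₁ hu₁, smooth_u u₂ η₂ sη₂ hu₂]
  have du : ∀ x ∈ W, ∀ v, fderiv ℝ u x v = WithLp.toLp 2 ![η₁ x v, η₂ x v] := by
    intro x hx v
    have hd := ((su.contDiffAt (Metric.isOpen_ball.mem_nhds hx)).differentiableAt
      (by simp)).hasFDerivAt
    have hi := fun i : Fin 2 => (EuclideanSpace.proj (𝕜 := ℝ) i : E2 →L[ℝ] ℝ).hasFDerivAt.comp x hd
    ext i
    fin_cases i
    · exact DFunLike.congr_fun ((hi 0).unique (hu₁ x hx)) v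
    · exact DFunLike.congr_fun ((hi 1).unique (hu₂ x hx)) v
  have d₁ : ∀ x ∈ W, fderiv ℝ u x (X₁ x) = EuclideanSpace.single 0 1 := fun x hx => by
    rw [du x hx, e11 x (hball hx), e21 x (hball hx)]
    ext i; fin_cases i <;> simp
  have d₂ : ∀ x ∈ W, fderiv ℝ u x (X₂ x) = EuclideanSpace.single 1 1 := fun x hx => by
    rw [du x hx, e22 x (hball hx), e12 x (hball hx)]
    ext i; fin_cases i <;> simp
  have hequiv : ∀ x ∈ W, ∃ L : E2 ≃L[ℝ] E2, HasFDerivAt u (L : E2 →L[ℝ] E2) x := by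
    intro x hx
    have hsurj : Function.Surjective (fderiv ℝ u x : E2 →ₗ[ℝ] E2) := fun y =>
      ⟨y 0 • X₁ x + y 1 • X₂ x, by
        rw [ContinuousLinearMap.coe_coe, map_add, map_smul, map_smul, d₁ x hx, d₂ x hx]
        exact (eq_single_add_single y).symm⟩
    have hinj := LinearMap.injective_iff_surjective.mpr hsurj
    refine ⟨(LinearEquiv.ofBijective _ ⟨hinj, hsurj⟩).toContinuousLinearEquiv, ?_⟩
    have hd := ((su.contDiffAt (Metric.isOpen_ball.mem_nhds hx)).differentiableAt
      (by simp)).hasFDerivAt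
    exact hd
  have hx₀W : x₀ ∈ W := Metric.mem_ball_self hρ
  obtain ⟨L, hL⟩ := hequiv x₀ hx₀W
  have hc := su.contDiffAt (Metric.isOpen_ball.mem_nhds hx₀W)
  set Φ := (hc.toOpenPartialHomeomorph u hL (by simp)).restrOpen W Metric.isOpen_ball with hΦ
  have hΦu : ∀ x, Φ x = u x := fun x => rfl
  have hsrc : Φ.source ⊆ W := fun x hx => hx.2
  have hsymm : ∀ y ∈ Φ.target, Φ.symm y ∈ W := fun y hy => hsrc (Φ.map_target hy)
  have ssymm : ContDiffOn ℝ ∞ Φ.symm Φ.target := fun y hy => by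
    obtain ⟨L', hL'⟩ := hequiv _ (hsymm y hy)
    exact (Φ.contDiffAt_symm hy hL'
      (su.contDiffAt (Metric.isOpen_ball.mem_nhds (hsymm y hy)))).contDiffWithinAt
  refine ⟨Φ, ⟨hc.mem_toOpenPartialHomeomorph_source hL (by simp), hx₀W⟩, hsrc.trans hball,
    su.mono hsrc, ssymm, fun y hy => ?_⟩
  have hcomp : ∀ v, fderiv ℝ Φ.symm y (fderiv ℝ u (Φ.symm y) v) = v := by
    intro v
    have h1 : (Φ.symm ∘ u) =ᶠ[nhds (Φ.symm y)] id := by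
      filter_upwards [Φ.open_source.mem_nhds (Φ.map_target hy)] with z hz
      exact Φ.left_inv hz
    have h2 := h1.fderiv_eq (𝕜 := ℝ)
    have huy : u (Φ.symm y) = y := Φ.right_inv hy
    have dS : DifferentiableAt ℝ Φ.symm (u (Φ.symm y)) := by
      rw [huy]; exact (ssymm.contDiffAt (Φ.open_target.mem_nhds hy)).differentiableAt (by simp)
    rw [fderiv_comp _ dS ((su.contDiffAt (Metric.isOpen_ball.mem_nhds
      (hsymm y hy))).differentiableAt (by simp)), huy, fderiv_id] at h2
    exact DFunLike.congr_fun h2 v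
  constructor
  · rw [← d₁ _ (hsymm y hy), hcomp]
  · rw [← d₂ _ (hsymm y hy), hcomp]

end CyclideField

section Charts

variable {M : Type*} [TopologicalSpace M] [ChartedSpace E2 M] [IsManifold (𝓡 2) ∞ M]
  {φ : OpenPartialHomeomorph M E2} {f N : M → E3} {V : Set E2} {k₁ k₂ : E2 → ℝ} {X₁ X₂ : E2 → E2}

/-- If the ridge derivatives vanish, there are principal charts. -/
theorem FrameField.exists_isPrincipalChart (hφ : φ ∈ IsManifold.maximalAtlas (𝓡 2) ∞ M)
    (P : FrameField (f ∘ φ.symm) (N ∘ φ.symm) V k₁ k₂ X₁ X₂)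
    (h₁ : ∀ x ∈ V, dirDeriv X₁ k₁ x = 0) (h₂ : ∀ x ∈ V, dirDeriv X₂ k₂ x = 0)
    {p : M} (hp : p ∈ φ.source) (hpV : φ p ∈ V) :
    ∃ (ψ : OpenPartialHomeomorph M E2) (κ₁ κ₂ : E2 → ℝ), p ∈ ψ.source ∧
      IsPrincipalChart f N ψ κ₁ κ₂ ∧ RidgeDerivativesVanish ψ κ₁ κ₂ := by
  have C := P.toPrincipalField.cyclideField h₁ h₂
  obtain ⟨Φ, hpΦ, hΦV, sΦ, sΦ', hd⟩ := C.exists_rectifying hpV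
  have hsrc : ∀ q ∈ (φ ≫ₕ Φ).source, q ∈ φ.source ∧ φ q ∈ Φ.source := fun q hq => by
    simpa using hq
  have htgt : ∀ y ∈ (φ ≫ₕ Φ).target, y ∈ Φ.target ∧ Φ.symm y ∈ φ.target := fun y hy => by
    simpa using hy
  have chain : ∀ {F : Type} [NormedAddCommGroup F] [NormedSpace ℝ F] (g : E2 → F),
      ContDiffOn ℝ ∞ g V → ∀ y ∈ Φ.target,
      fderiv ℝ (g ∘ Φ.symm) y (EuclideanSpace.single 0 1) =
        (k₁ (Φ.symm y) - k₂ (Φ.symm y))⁻¹ • dirDeriv X₁ g (Φ.symm y) ∧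
      fderiv ℝ (g ∘ Φ.symm) y (EuclideanSpace.single 1 1) =
        (k₁ (Φ.symm y) - k₂ (Φ.symm y))⁻¹ • dirDeriv X₂ g (Φ.symm y) := by
    intro F _ _ g hg y hy
    have hyV := hΦV (Φ.map_target hy)
    rw [fderiv_comp _ (hg.differentiableAt_of_isOpen P.isOpen hyV)
      (sΦ'.differentiableAt_of_isOpen Φ.open_target hy)]
    simp only [ContinuousLinearMap.comp_apply, hd y hy, map_smul]
    exact ⟨rfl, rfl⟩
  refine ⟨φ ≫ₕ Φ, k₁ ∘ Φ.symm, k₂ ∘ Φ.symm, by simp [hp, hpΦ], ⟨?_, fun y hy => ?_,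
    fun y hy => ?_, fun y hy => ?_⟩, fun y hy => ?_⟩
  · refine OpenPartialHomeomorph.mem_maximalAtlas_of_contMDiffOn _ ?_ ?_
    · exact (contMDiffOn_iff_contDiffOn.mpr sΦ).comp ((contMDiffOn_of_mem_maximalAtlas hφ).mono
        fun q hq => (hsrc q hq).1) fun q hq => (hsrc q hq).2
    · exact (contMDiffOn_symm_of_mem_maximalAtlas hφ).comp
        ((contMDiffOn_iff_contDiffOn.mpr sΦ').mono fun y hy => (htgt y hy).1)
        fun y hy => (htgt y hy).2
  · exact P.lt _ (hΦV (Φ.map_target (htgt y hy).1))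
  · have h := (htgt y hy).1
    change fderiv ℝ ((N ∘ φ.symm) ∘ Φ.symm) y _ = -(_ • fderiv ℝ ((f ∘ φ.symm) ∘ Φ.symm) y _)
    rw [(chain _ P.smooth_normal y h).1, (chain _ P.smooth y h).1, dirDeriv, dirDeriv,
      P.principal₁ _ (hΦV (Φ.map_target h))]
    simp only [Function.comp_apply]
    module
  · have h := (htgt y hy).1
    change fderiv ℝ ((N ∘ φ.symm) ∘ Φ.symm) y _ = -(_ • fderiv ℝ ((f ∘ φ.symm) ∘ Φ.symm) y _)
    rw [(chain _ P.smooth_normal y h).2, (chain _ P.smooth y h).2, dirDeriv, dirDeriv,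
      P.principal₂ _ (hΦV (Φ.map_target h))]
    simp only [Function.comp_apply]
    module
  · have h := (htgt y hy).1
    have hV := hΦV (Φ.map_target h)
    rw [(chain _ P.smooth_k₁ y h).1, (chain _ P.smooth_k₂ y h).2, h₁ _ hV, h₂ _ hV]
    simp

omit [IsManifold (𝓡 2) ∞ M] in
/-- A principal chart carries a principal frame field along its coordinate fields. -/
theorem IsPrincipalChart.exists_frameField (hf : IsOrientedSurface f N)
    (h : IsPrincipalChart f N φ k₁ k₂) : ∃ X₁ X₂ : E2 → E2,
      FrameField (f ∘ φ.symm) (N ∘ φ.symm) φ.target k₁ k₂ X₁ X₂ ∧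
      (RidgeDerivativesVanish φ k₁ k₂ ↔
        ∀ x ∈ φ.target, dirDeriv X₁ k₁ x = 0 ∧ dirDeriv X₂ k₂ x = 0) := by
  obtain ⟨a, b, ha, hb, P⟩ := (hf.surfacePatch h.chart).exists_frameField
    (Y₁ := fun _ => EuclideanSpace.single 0 1) (Y₂ := fun _ => EuclideanSpace.single 1 1)
    contDiffOn_const contDiffOn_const (fun x _ => by simp) (fun x _ => by simp) h.lt
    h.principal₁ h.principal₂
  refine ⟨_, _, P, forall_congr' fun x => forall_congr' fun hx => ?_⟩
  rw [dirDeriv_smul_field, dirDeriv_smul_field, smul_eq_zero, smul_eq_zero]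
  simp only [ha x hx, hb x hx, false_or]
  rfl

end Charts

/-! ### Invariants of the curvature spheres under changes of charts -/

namespace CyclideField

variable {V V' W : Set E2} {s₁ s₂ s₁' s₂' : E2 → L5} {X₁ X₂ X₁' X₂' τ : E2 → E2} {x : E2}

/-- The velocity of the first family of curvature spheres is determined up to sign, and their
acceleration is determined, independently of coordinates. -/
theorem transition (C : CyclideField V s₁ s₂ X₁ X₂) (C' : CyclideField V' s₁' s₂' X₁' X₂')
    (hW : IsOpen W) (hWV : W ⊆ V) (hτ : ContDiffOn ℝ ∞ τ W) (hmaps : MapsTo τ W V')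
    (h₁ : ∀ y ∈ W, s₁ y = s₁' (τ y)) (h₂ : ∀ y ∈ W, s₂ y = s₂' (τ y)) (hx : x ∈ W) :
    accel s₁ X₂ x = accel s₁' X₂' (τ x) ∧
      ∃ ε : ℝ, ε * ε = 1 ∧ dirDeriv X₂ s₁ x = ε • dirDeriv X₂' s₁' (τ x) := by
  have chain : ∀ {g g' : E2 → L5}, ContDiffOn ℝ ∞ g' V' → (∀ y ∈ W, g y = g' (τ y)) → ∀ y ∈ W,
      dirDeriv X₂ g y = fderiv ℝ g' (τ y) (dirDeriv X₂ τ y) := by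
    intro g g' hg' h y hy
    rw [dirDeriv_congr hW h hy, dirDeriv]
    have := fderiv_comp y (hg'.differentiableAt_of_isOpen C'.isOpen (hmaps hy))
      (hτ.differentiableAt_of_isOpen hW hy)
    exact DFunLike.congr_fun this (X₂ y)
  obtain ⟨ε, hε⟩ : ∃ ε : E2 → ℝ, ε = fun y =>
    lorentz (dirDeriv X₂ s₁ y) (dirDeriv X₂' s₁' (τ y)) := ⟨_, rfl⟩
  -- Constancy of `s₂` along `X₂` excludes a component along `X₁'`; the unit velocity of `s₁` makes
  -- the remaining coefficient a sign.
  have key : ∀ y ∈ W, dirDeriv X₂ τ y = ε y • X₂' (τ y) ∧ ε y * ε y = 1 := by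
    intro y hy
    obtain ⟨a, b, hab⟩ := C'.exists_eq (hmaps hy) (dirDeriv X₂ τ y)
    have e₂ := chain C'.smooth_s₂ h₂ y hy
    have e₁ := chain C'.smooth_s₁ h₁ y hy
    rw [hab, map_add, map_smul, map_smul] at e₁ e₂
    change _ = a • dirDeriv X₁' s₂' (τ y) + b • dirDeriv X₂' s₂' (τ y) at e₂
    change _ = a • dirDeriv X₁' s₁' (τ y) + b • dirDeriv X₂' s₁' (τ y) at e₁
    rw [C.d₂s₂ y (hWV hy), C'.d₂s₂ _ (hmaps hy), smul_zero, add_zero] at e₂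
    rw [C'.d₁s₁ _ (hmaps hy), smul_zero, zero_add] at e₁
    have ha : a = 0 := by
      have := congrArg (lorentz (dirDeriv X₁' s₂' (τ y))) e₂
      rw [lorentz_zero_right, lorentz_smul_right, C'.unit₁ _ (hmaps hy), mul_one] at this
      exact this.symm
    have hb : ε y = b := by
      rw [hε]
      simp only [e₁, lorentz_smul_left, C'.unit₂ _ (hmaps hy), mul_one]
    have hbb := C.unit₂ y (hWV hy)
    rw [e₁, lorentz_smul_left, lorentz_smul_right, C'.unit₂ _ (hmaps hy), mul_one] at hbb
    rw [hab, ha, hb, zero_smul, zero_add]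
    exact ⟨rfl, hbb⟩
  have hvel : ∀ y ∈ W, dirDeriv X₂ s₁ y = ε y • dirDeriv X₂' s₁' (τ y) := fun y hy => by
    rw [chain C'.smooth_s₁ h₁ y hy, (key y hy).1, map_smul]
    rfl
  have svel : ContDiffOn ℝ ∞ (fun y => dirDeriv X₂' s₁' (τ y)) W :=
    C'.smooth_velocity.comp hτ hmaps
  have sε : ContDiffOn ℝ ∞ ε W := by
    rw [hε]
    exact (C.smooth_velocity.mono hWV).lorentz svel
  have hne : ε x ≠ 0 := by
    intro h
    have := (key x hx).2
    rw [h] at this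
    norm_num at this
  -- As `ε² = 1` and `ε` is smooth, the sign has zero derivative. It occurs twice in the
  -- acceleration and drops out.
  have dε : dirDeriv X₂ ε x = 0 := by
    have dd := sε.differentiableAt_of_isOpen hW hx
    have h := dirDeriv_mul (X := X₂) dd dd
    rw [dirDeriv_const_on hW (fun y hy => (key y hy).2) hx] at h
    have : ε x * dirDeriv X₂ ε x = 0 := by linarith
    exact (mul_eq_zero.mp this).resolve_left hne
  refine ⟨?_, ε x, (key x hx).2, hvel x hx⟩
  rw [accel, dirDeriv_congr hW hvel hx, dirDeriv_smul (sε.differentiableAt_of_isOpen hW hx)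
    (svel.differentiableAt_of_isOpen hW hx), dε, zero_smul, add_zero,
    chain (g := fun y => dirDeriv X₂' s₁' (τ y)) C'.smooth_velocity (fun _ _ => rfl) x hx,
    (key x hx).1, map_smul, smul_smul, (key x hx).2, one_smul]
  rfl

/-- The locally constant invariants of the curvature spheres. -/
noncomputable def invariants (s₁ : E2 → L5) (X₂ : E2 → E2) (z : L5) (x : E2) : ℝ × L5 × ℝ :=
  (accelSq s₁ X₂ x, accel s₁ X₂ x + accelSq s₁ X₂ x • s₁ x,
    accelSq s₁ X₂ x * lorentz (dirDeriv X₂ s₁ x) z ^ 2 + lorentz (accel s₁ X₂ x) z ^ 2)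

theorem invariants_eventually (C : CyclideField V s₁ s₂ X₁ X₂) (z : L5) (hx : x ∈ V) :
    ∀ᶠ y in nhds x, invariants s₁ X₂ z y = invariants s₁ X₂ z x := by
  filter_upwards [C.accelSq_eventually hx, C.center_eventually hx, C.quadric_eventually hx z]
    with y h1 h2 h3
  exact Prod.ext h1 (Prod.ext h2 h3)

theorem invariants_transition (C : CyclideField V s₁ s₂ X₁ X₂)
    (C' : CyclideField V' s₁' s₂' X₁' X₂') (hW : IsOpen W) (hWV : W ⊆ V) (hτ : ContDiffOn ℝ ∞ τ W)
    (hmaps : MapsTo τ W V') (h₁ : ∀ y ∈ W, s₁ y = s₁' (τ y)) (h₂ : ∀ y ∈ W, s₂ y = s₂' (τ y))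
    (hx : x ∈ W) (z : L5) : invariants s₁ X₂ z x = invariants s₁' X₂' z (τ x) := by
  obtain ⟨ha, ε, hε, hv⟩ := C.transition C' hW hWV hτ hmaps h₁ h₂ hx
  have hε' : ε ^ 2 = 1 := by rw [pow_two, hε]
  simp only [invariants, accelSq, ha, hv, h₁ x hx, lorentz_smul_left, mul_pow, hε', one_mul]

/-- The quadratic equations satisfied by the points of a surface, in terms of the invariants. -/
theorem invariants_point (C : CyclideField V s₁ s₂ X₁ X₂) (hx : x ∈ V) :
    (invariants s₁ X₂ (s₁ x - s₂ x) x).2.2 = 1 ∧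
      lorentz (invariants s₁ X₂ (s₁ x - s₂ x) x).2.1 (s₁ x - s₂ x) = -1 := by
  simp [invariants, lorentz_sub_right, lorentz_add_left, lorentz_smul_left, C.accel_s₁ hx,
    C.accel_s₂ hx, C.velocity_s₁ hx, C.velocity_s₂ hx, C.s₁₁ x hx, C.s₁₂ x hx]

end CyclideField

/-! ### Gluing the local invariants over a connected surface. -/

section Global

variable {M : Type*} [TopologicalSpace M] [ChartedSpace E2 M]

/-- The maps `S₁`, `S₂` to de Sitter space are given by cyclide fields in suitable charts. -/
def AreCyclideSpheres (S₁ S₂ : M → L5) : Prop :=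
  ∀ p, ∃ (φ : OpenPartialHomeomorph M E2) (V : Set E2) (s₁ s₂ : E2 → L5) (X₁ X₂ : E2 → E2),
    φ ∈ IsManifold.maximalAtlas (𝓡 2) ∞ M ∧ p ∈ φ.source ∧ φ p ∈ V ∧
    CyclideField V s₁ s₂ X₁ X₂ ∧ ∀ x ∈ V, s₁ x = S₁ (φ.symm x) ∧ s₂ x = S₂ (φ.symm x)

theorem AreCyclideSpheres.swap {S₁ S₂ : M → L5} (h : AreCyclideSpheres S₁ S₂) :
    AreCyclideSpheres S₂ S₁ := fun p => by
  obtain ⟨φ, V, s₁, s₂, X₁, X₂, hφ, hp, hpV, C, hs⟩ := h p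
  exact ⟨φ, V, s₂, s₁, X₂, X₁, hφ, hp, hpV, C.swap, fun x hx => (hs x hx).symm⟩

/-- On a connected surface the invariants at one point determine the equations of all points. -/
theorem AreCyclideSpheres.point_equations [PreconnectedSpace M] {S₁ S₂ : M → L5}
    (h : AreCyclideSpheres S₁ S₂) {φ : OpenPartialHomeomorph M E2} {V : Set E2} {s₁ s₂ : E2 → L5}
    {X₁ X₂ : E2 → E2} (hφ : φ ∈ IsManifold.maximalAtlas (𝓡 2) ∞ M) {p₀ : M} (hp : p₀ ∈ φ.source)
    (hpV : φ p₀ ∈ V) (C : CyclideField V s₁ s₂ X₁ X₂)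
    (hs : ∀ x ∈ V, s₁ x = S₁ (φ.symm x) ∧ s₂ x = S₂ (φ.symm x)) (p : M) :
    (CyclideField.invariants s₁ X₂ (S₁ p - S₂ p) (φ p₀)).2.2 = 1 ∧
      lorentz (CyclideField.invariants s₁ X₂ (S₁ p - S₂ p) (φ p₀)).2.1 (S₁ p - S₂ p) = -1 := by
  choose Φ U t₁ t₂ Y₁ Y₂ hΦ hpΦ hpU D ht using h
  -- At each `q` the invariants are read in the chart chosen for `q`. Any other chart with the same
  -- spheres gives the same value, so no compatibility of the choices is needed for local constancy.
  have key : ∀ {ψ : OpenPartialHomeomorph M E2} {W : Set E2} {r₁ r₂ : E2 → L5}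
      {Z₁ Z₂ : E2 → E2}, ψ ∈ IsManifold.maximalAtlas (𝓡 2) ∞ M →
      CyclideField W r₁ r₂ Z₁ Z₂ → (∀ x ∈ W, r₁ x = S₁ (ψ.symm x) ∧ r₂ x = S₂ (ψ.symm x)) →
      ∀ q, q ∈ ψ.source → ψ q ∈ W → ∀ z, CyclideField.invariants r₁ Z₂ z (ψ q) =
        CyclideField.invariants (t₁ q) (Y₂ q) z (Φ q q) := by
    intro ψ W r₁ r₂ Z₁ Z₂ hψ E hr q hq hqW z
    have hT : ContDiffOn ℝ ∞ (Φ q ∘ ψ.symm) (ψ.symm.trans (Φ q)).source :=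
      contMDiffOn_iff_contDiffOn.mp ((contMDiffOn_of_mem_maximalAtlas (hΦ q)).comp
        ((contMDiffOn_symm_of_mem_maximalAtlas hψ).mono fun y hy => hy.1) fun y hy => hy.2)
    set O : Set E2 := W ∩ ((ψ.symm.trans (Φ q)).source ∩ (ψ.symm.trans (Φ q)) ⁻¹' (U q)) with hO
    have hOo : IsOpen O := E.isOpen.inter
      ((ψ.symm.trans (Φ q)).isOpen_inter_preimage (D q).isOpen)
    have hqO : ψ q ∈ O := by
      refine ⟨hqW, ⟨⟨ψ.map_source hq, ?_⟩, ?_⟩⟩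
      · simpa [ψ.left_inv hq] using hpΦ q
      · simpa [ψ.left_inv hq] using hpU q
    have hback : ∀ y ∈ O, (Φ q).symm ((Φ q ∘ ψ.symm) y) = ψ.symm y := fun y hy =>
      (Φ q).left_inv hy.2.1.2
    have := E.invariants_transition (D q) (τ := Φ q ∘ ψ.symm) hOo inter_subset_left
      (hT.mono fun y hy => hy.2.1) (fun y hy => hy.2.2)
      (fun y hy => by rw [(hr y hy.1).1, (ht q ((Φ q ∘ ψ.symm) y) hy.2.2).1, hback y hy])
      (fun y hy => by rw [(hr y hy.1).2, (ht q ((Φ q ∘ ψ.symm) y) hy.2.2).2, hback y hy]) hqO z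
    rwa [Function.comp_apply, ψ.left_inv hq] at this
  have hconst : ∀ z, IsLocallyConstant fun q =>
      CyclideField.invariants (t₁ q) (Y₂ q) z (Φ q q) := by
    intro z
    rw [IsLocallyConstant.iff_eventually_eq]
    intro q
    have hc : ContinuousAt (Φ q) q := (Φ q).continuousAt (hpΦ q)
    filter_upwards [hc.eventually ((D q).invariants_eventually z (hpU q)),
      hc.eventually ((D q).isOpen.mem_nhds (hpU q)), (Φ q).open_source.mem_nhds (hpΦ q)]
      with r h1 h2 h3
    rw [← h1, key (hΦ q) (D q) (ht q) r h3 h2]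
  -- The argument `z` is frozen as `S₁ p - S₂ p` while the invariants are transported from `p₀` to
  -- `p`, where the equations hold by direct computation.
  rw [key hφ C hs p₀ hp hpV, (hconst _).apply_eq_of_preconnectedSpace p₀ p]
  have := (D p).invariants_point (hpU p)
  rwa [(ht p _ (hpU p)).1, (ht p _ (hpU p)).2, (Φ p).left_inv (hpΦ p)] at this

end Global

/-! ### Normal forms of Dupin cyclides -/

theorem toSphere_smul {c : ℝ} (hc : c ≠ 0) (y : L5) : toSphere (c • y) = toSphere y := by
  simp only [toSphere, Pi.smul_apply, smul_eq_mul, mul_inv, smul_smul]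
  rw [mul_comm c⁻¹, mul_assoc, inv_mul_cancel₀ hc, mul_one]

theorem exists_lightLift_eq {y : L5} (hy : lorentz y y = 0) (hd : y 0 - y 4 ≠ 0) :
    ∃ x : E3, x 0 = y 1 / (y 0 - y 4) ∧ x 1 = y 2 / (y 0 - y 4) ∧ x 2 = y 3 / (y 0 - y 4) ∧
      toSphere (lightLift x) = toSphere y := by
  set d := y 0 - y 4 with hd'
  refine ⟨!₂[y 1 / d, y 2 / d, y 3 / d], by simp, by simp, by simp, ?_⟩
  have hsq : ‖(!₂[y 1 / d, y 2 / d, y 3 / d] : E3)‖ ^ 2 = (y 0 + y 4) / d := by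
    rw [norm_sq_E3]
    simp only [lorentz] at hy
    simp only [Matrix.cons_val]
    field_simp
    rw [hd']
    linear_combination hy
  have : lightLift !₂[y 1 / d, y 2 / d, y 3 / d] = (2 / d) • y := by
    ext i
    fin_cases i <;> simp [lightLift, hsq] <;> field_simp <;> rw [hd'] <;> ring
  rw [this, toSphere_smul (by positivity)]

theorem toSphere_mem_cliffordTorus {y : L5} (hy : lorentz y y = 0) (h0 : y 0 ≠ 0) {a : ℝ}
    (h : y 1 ^ 2 + y 2 ^ 2 = a ^ 2 * y 0 ^ 2) : toSphere y ∈ cliffordTorus a := by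
  refine ⟨⟨?_, ?_⟩, ?_⟩
  · rw [toSphere, lorentz_smul_left, lorentz_smul_right, hy, mul_zero, mul_zero]
  · simp [toSphere, h0]
  · simp only [toSphere, Pi.smul_apply, smul_eq_mul]
    field_simp
    linear_combination h

theorem toSphere_mem_roundCylinder {y : L5} (hy : lorentz y y = 0) (hd : y 0 - y 4 ≠ 0) {r : ℝ}
    (h : y 1 ^ 2 + y 2 ^ 2 = r ^ 2 * (y 0 - y 4) ^ 2) :
    toSphere y ∈ (fun x => toSphere (lightLift x)) '' roundCylinder r := by
  obtain ⟨x, h0, h1, -, hx⟩ := exists_lightLift_eq hy hd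
  refine ⟨x, ?_, hx⟩
  rw [roundCylinder, mem_ofPred_eq, h0, h1]
  field_simp
  linear_combination h

theorem toSphere_mem_roundCone {y : L5} (hy : lorentz y y = 0) {m : ℝ} (h3 : y 3 ≠ 0)
    (h : y 1 ^ 2 + y 2 ^ 2 = m ^ 2 * y 3 ^ 2) :
    toSphere y ∈ (fun x => toSphere (lightLift x)) '' roundCone m := by
  have hd : y 0 - y 4 ≠ 0 := by
    intro hd
    have h30 : 0 < y 3 ^ 2 := by positivity
    have : y 3 ^ 2 = -(y 1 ^ 2 + y 2 ^ 2) := by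
      simp only [lorentz] at hy
      linear_combination hy + (y 0 + y 4) * hd
    nlinarith [sq_nonneg (y 1), sq_nonneg (y 2)]
  obtain ⟨x, h0, h1, h2, hx⟩ := exists_lightLift_eq hy hd
  refine ⟨x, ⟨?_, ?_⟩, hx⟩
  · rw [h0, h1, h2]
    field_simp
    linear_combination h
  · rw [h2]
    exact div_ne_zero h3 hd

/-- The points of the light cone with `r² (y₁² + y₂²) = 1` and `r (y₀ - r y₄) = 1` represent a
Dupin cyclide. -/
theorem exists_standardCyclide_of_coordinates {r : ℝ} (hr : 0 < r) :
    ∃ D, IsStandardCyclide D ∧ ∃ A : L5 ≃ₗ[ℝ] L5, IsLorentz A ∧ ∀ y, lorentz y y = 0 →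
      r ^ 2 * (y 1 ^ 2 + y 2 ^ 2) = 1 → r * (y 0 - r * y 4) = 1 → toSphere (A y) ∈ D := by
  -- The linear equation is a hyperplane with normal `(1, 0, 0, 0, r)`, of square norm `r² - 1`. A
  -- timelike normal is boosted to the `y₀` axis (torus), a null one gives the affine section of
  -- Euclidean space (cylinder), and a spacelike one is moved to the `y₃` axis (cone).
  rcases lt_trichotomy r 1 with h1 | rfl | h1
  · have ha2 : 0 < 1 - r ^ 2 := by nlinarith
    set a := √(1 - r ^ 2) with ha
    have ha0 : 0 < a := Real.sqrt_pos.mpr ha2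
    have haa : a ^ 2 = 1 - r ^ 2 := Real.sq_sqrt ha2.le
    obtain ⟨A, hA, hAy⟩ := exists_isLorentz_of_orthonormal
      ![![1 / a, 0, 0, 0, r / a], ![0, 1, 0, 0, 0], ![0, 0, 1, 0, 0], ![0, 0, 0, 1, 0],
        ![r / a, 0, 0, 0, 1 / a]] (by
      intro i j
      fin_cases i <;> fin_cases j <;> simp [lorentz] <;> field_simp <;> linarith)
    refine ⟨_, Or.inl ⟨a, ha0, by nlinarith, rfl⟩, A, hA, fun y hy hq hl => ?_⟩
    have e0 : A y 0 = (y 0 - r * y 4) / a := by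
      rw [hAy]; simp [lorentz]; ring
    have e1 : A y 1 = y 1 := by rw [hAy]; simp [lorentz]
    have e2 : A y 2 = y 2 := by rw [hAy]; simp [lorentz]
    have hl' : y 0 - r * y 4 = 1 / r := by field_simp; linarith
    refine toSphere_mem_cliffordTorus (by rw [hA, hy]) ?_ ?_
    · rw [e0, hl']; positivity
    · rw [e0, e1, e2, hl']; field_simp; linarith
  · refine ⟨_, Or.inr (Or.inl ⟨1, one_pos, rfl⟩), LinearEquiv.refl ℝ L5, fun _ _ => rfl,
      fun y hy hq hl => toSphere_mem_roundCylinder hy ?_ ?_⟩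
    · intro h; linarith
    · have : y 0 - y 4 = 1 := by linarith
      rw [this]; linarith
  · have ha2 : 0 < r ^ 2 - 1 := by nlinarith
    set a := √(r ^ 2 - 1) with ha
    have ha0 : 0 < a := Real.sqrt_pos.mpr ha2
    have haa : a ^ 2 = r ^ 2 - 1 := Real.sq_sqrt ha2.le
    obtain ⟨A, hA, hAy⟩ := exists_isLorentz_of_orthonormal
      ![![r / a, 0, 0, 0, 1 / a], ![0, 1, 0, 0, 0], ![0, 0, 1, 0, 0], ![1 / a, 0, 0, 0, r / a],
        ![0, 0, 0, 1, 0]] (by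
      intro i j
      fin_cases i <;> fin_cases j <;> simp [lorentz] <;> field_simp <;> linarith)
    refine ⟨_, Or.inr (Or.inr ⟨a, ha0, rfl⟩), A, hA, fun y hy hq hl => ?_⟩
    have e3 : A y 3 = -((y 0 - r * y 4) / a) := by
      rw [hAy]; simp [lorentz]; ring
    have e1 : A y 1 = y 1 := by rw [hAy]; simp [lorentz]
    have e2 : A y 2 = y 2 := by rw [hAy]; simp [lorentz]
    have hl' : y 0 - r * y 4 = 1 / r := by field_simp; linarith
    refine toSphere_mem_roundCone (by rw [hA, hy]) ?_ ?_
    · rw [e3, hl', neg_ne_zero]; positivity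
    · rw [e3, e1, e2, hl']; field_simp; linarith

/-- The normal form of the equations of a cyclide in terms of its invariants at a point. -/
theorem exists_standardCyclide {q : ℝ} (hq : 0 < q) {v a b s t : L5} (vv : lorentz v v = 1)
    (aa : lorentz a a = q) (bb : lorentz b b = 1) (ss : lorentz s s = 1) (tt : lorentz t t = 1)
    (st : lorentz s t = 1) (as : lorentz a s = -1) (at' : lorentz a t = 0) (av : lorentz a v = 0)
    (ab : lorentz a b = 0) (vb : lorentz v b = 0) (vs : lorentz v s = 0) (vt : lorentz v t = 0)
    (bs : lorentz b s = 0) (bt : lorentz b t = 0) :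
    ∃ D, IsStandardCyclide D ∧ ∃ A : L5 ≃ₗ[ℝ] L5, IsLorentz A ∧ ∀ y, lorentz y y = 0 →
      q * lorentz v y ^ 2 + lorentz a y ^ 2 = 1 → lorentz (a + q • s) y = -1 →
      toSphere (A y) ∈ D := by
  obtain ⟨r, hr, rfl⟩ : ∃ r, 0 < r ∧ q = r ^ 2 :=
    ⟨√q, Real.sqrt_pos.mpr hq, (Real.sq_sqrt hq.le).symm⟩
  obtain ⟨D, hD, A, hA, h⟩ := exists_standardCyclide_of_coordinates hr
  have ts := (lorentz_comm t s).trans st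
  have sa := (lorentz_comm s a).trans as
  have ta := (lorentz_comm t a).trans at'
  have va := (lorentz_comm v a).trans av
  have ba := (lorentz_comm b a).trans ab
  have bv := (lorentz_comm b v).trans vb
  have sv := (lorentz_comm s v).trans vs
  have tv := (lorentz_comm t v).trans vt
  have sb := (lorentz_comm s b).trans bs
  have tb := (lorentz_comm t b).trans bt
  -- With `q = r²`, the vector `r⁻¹ a + r (s - t)` has square `1 - 2 + 0 = -1` and completes `v, r⁻¹
  -- a, b, t`. In these coordinates `y₀ - r y₄` is `-r⁻¹ ⟨a + q s, y⟩`.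
  obtain ⟨B, hB, hBy⟩ := exists_isLorentz_of_orthonormal
    ![r⁻¹ • a + r • s - r • t, v, r⁻¹ • a, b, t] (by
    intro i j
    fin_cases i <;> fin_cases j <;>
      simp [lorentz_add_left, lorentz_add_right, lorentz_sub_left, lorentz_sub_right,
        lorentz_smul_left, lorentz_smul_right, *] <;> field_simp <;> ring_nf <;> simp)
  refine ⟨D, hD, B.trans A, fun x y => by simp [hA _ _, hB _ _], fun y hy hQ hC => ?_⟩
  rw [LinearEquiv.trans_apply]
  refine h _ (by rw [hB, hy]) ?_ ?_
  · simp only [hBy]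
    simp only [Matrix.cons_val, lorentz_smul_left]
    norm_num
    field_simp
    linarith
  · simp only [hBy]
    simp only [Matrix.cons_val, lorentz_smul_left, lorentz_add_left, lorentz_sub_left]
    rw [lorentz_add_left, lorentz_smul_left] at hC
    rw [if_pos trivial, if_neg (by decide)]
    field_simp
    linarith

/-! ### From vanishing ridge derivatives to a Dupin cyclide. -/

section Surfaces

variable {M : Type*} [TopologicalSpace M] [ChartedSpace E2 M] {f N : M → E3}

/-- The ridge derivatives of the principal curvatures of the surface vanish, in frame fields around
every point. -/
def RidgesVanish (f N : M → E3) : Prop :=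
  ∀ p, ∃ (φ : OpenPartialHomeomorph M E2) (V : Set E2) (k₁ k₂ : E2 → ℝ) (X₁ X₂ : E2 → E2),
    φ ∈ IsManifold.maximalAtlas (𝓡 2) ∞ M ∧ p ∈ φ.source ∧ φ p ∈ V ∧ V ⊆ φ.target ∧
    FrameField (f ∘ φ.symm) (N ∘ φ.symm) V k₁ k₂ X₁ X₂ ∧
    ∀ x ∈ V, dirDeriv X₁ k₁ x = 0 ∧ dirDeriv X₂ k₂ x = 0

theorem FrameField.curvatures_eq (hf : IsOrientedSurface f N) {φ : OpenPartialHomeomorph M E2}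
    {V : Set E2} {k₁ k₂ : E2 → ℝ} {X₁ X₂ : E2 → E2}
    (hφ : φ ∈ IsManifold.maximalAtlas (𝓡 2) ∞ M)
    (P : FrameField (f ∘ φ.symm) (N ∘ φ.symm) V k₁ k₂ X₁ X₂) {p : M} (hp : p ∈ φ.source)
    (hV : φ p ∈ V) {κ₁ κ₂ : ℝ} {e₁ e₂ : E3} (h : IsPrincipalFrame f N p κ₁ κ₂ e₁ e₂) :
    k₁ (φ p) = κ₁ ∧ k₂ (φ p) = κ₂ := by
  obtain ⟨w₁, hw₁, hw₁'⟩ := (isPrincipalVector_iff hf hφ hp _ _).mp h.principal₁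
  obtain ⟨w₂, hw₂, hw₂'⟩ := (isPrincipalVector_iff hf hφ hp _ _).mp h.principal₂
  have c₁ := P.principal_vector_cases hV (by rw [hw₁, h.norm₁]) (by rw [hw₁', hw₁])
  have c₂ := P.principal_vector_cases hV (by rw [hw₂, h.norm₂]) (by rw [hw₂', hw₂])
  have hlt := h.lt
  have hlt' := P.lt _ hV
  rcases c₁ with ⟨h1, -⟩ | ⟨h1, -⟩ <;> rcases c₂ with ⟨h2, -⟩ | ⟨h2, -⟩ <;>
    first | exact ⟨h1.symm, h2.symm⟩ | linarith

/-- A cyclide field at a point gives the normal form of the surface, if the acceleration of the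
first family of curvature spheres is spacelike there. -/
theorem AreCyclideSpheres.conformalToDupinCyclide [PreconnectedSpace M] {S₁ S₂ : M → L5}
    (h : AreCyclideSpheres S₁ S₂) (hS : ∀ p, ∃ c : ℝ, c ≠ 0 ∧ S₁ p - S₂ p = c • lightLift (f p))
    {φ : OpenPartialHomeomorph M E2} {V : Set E2} {s₁ s₂ : E2 → L5} {X₁ X₂ : E2 → E2}
    (hφ : φ ∈ IsManifold.maximalAtlas (𝓡 2) ∞ M) {p₀ : M} (hp : p₀ ∈ φ.source)
    (hpV : φ p₀ ∈ V) (C : CyclideField V s₁ s₂ X₁ X₂)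
    (hs : ∀ x ∈ V, s₁ x = S₁ (φ.symm x) ∧ s₂ x = S₂ (φ.symm x))
    (hq : 0 < CyclideField.accelSq s₁ X₂ (φ p₀)) : ConformalToDupinCyclide f := by
  obtain ⟨D, hD, A, hA, H⟩ := exists_standardCyclide hq (C.unit₂ _ hpV) rfl (C.unit₁ _ hpV)
    (C.s₁₁ _ hpV) (C.s₂₂ _ hpV) (C.s₁₂ _ hpV) (C.accel_s₁ hpV) (C.accel_s₂ hpV)
    (C.accel_velocity hpV) (C.accel_velocity' hpV) (C.velocity_velocity hpV) (C.velocity_s₁ hpV)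
    (C.velocity_s₂ hpV) (C.swap.velocity_s₂ hpV) (C.swap.velocity_s₁ hpV)
  refine ⟨D, hD, A, hA, fun p => ?_⟩
  obtain ⟨c, hc, hcp⟩ := hS p
  obtain ⟨hQ, hC⟩ := h.point_equations hφ hp hpV C hs p
  have hnull : lorentz (S₁ p - S₂ p) (S₁ p - S₂ p) = 0 := by
    have : lightLift (f p) = (2 : ℝ) • halfLift (f p) := by simp [halfLift]
    rw [hcp, this]
    simp [lorentz_smul_left, lorentz_smul_right, lorentz_halfLift_self]
  have := H _ hnull hQ hC
  rwa [hcp, map_smul, toSphere_smul hc] at this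

theorem RidgesVanish.conformalToDupinCyclide [ConnectedSpace M] (hf : IsOrientedSurface f N)
    (h : RidgesVanish f N) : ConformalToDupinCyclide f := by
  choose Φ U κ₁ κ₂ Y₁ Y₂ hΦ hpΦ hpU hU P hd using h
  set S₁ : M → L5 := fun p =>
    tangentLift (f p) (N p) + κ₁ p (Φ p p) • halfLift (f p) with hS₁
  set S₂ : M → L5 := fun p =>
    tangentLift (f p) (N p) + κ₂ p (Φ p p) • halfLift (f p) with hS₂
  have C := fun p => (P p).toPrincipalField.cyclideField (fun x hx => (hd p x hx).1)
    fun x hx => (hd p x hx).2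
  have hs : ∀ p, ∀ x ∈ U p,
      tangentLift ((f ∘ (Φ p).symm) x) ((N ∘ (Φ p).symm) x) + κ₁ p x • halfLift ((f ∘ (Φ p).symm) x) =
        S₁ ((Φ p).symm x) ∧
      tangentLift ((f ∘ (Φ p).symm) x) ((N ∘ (Φ p).symm) x) + κ₂ p x • halfLift ((f ∘ (Φ p).symm) x) =
        S₂ ((Φ p).symm x) := by
    intro p x hx
    have hx' := hU p hx
    have hr := (Φ p).right_inv hx'
    -- `S₁` and `S₂` use the frame chosen at each point; uniqueness of the principal curvatures
    -- identifies them with the spheres of any one chart.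
    have := (P p).curvatures_eq hf (hΦ p) ((Φ p).map_target hx') (by rwa [hr])
      ((P ((Φ p).symm x)).isPrincipalFrame hf (hΦ _) (hpΦ _) (hpU _))
    rw [hr] at this
    constructor
    · rw [this.1]; rfl
    · rw [this.2]; rfl
  have hA : AreCyclideSpheres S₁ S₂ := fun p =>
    ⟨Φ p, U p, _, _, _, _, hΦ p, hpΦ p, hpU p, C p, hs p⟩
  have hS : ∀ p, ∃ c : ℝ, c ≠ 0 ∧ S₁ p - S₂ p = c • lightLift (f p) := fun p => by
    have := (P p).lt _ (hpU p)
    refine ⟨(κ₁ p (Φ p p) - κ₂ p (Φ p p)) / 2, by linarith, ?_⟩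
    simp only [hS₁, hS₂, halfLift]
    module
  obtain ⟨p⟩ := (inferInstance : Nonempty M)
  -- The normal form needs a spacelike acceleration. If the first family lacks one, the second has
  -- one by `accelSq_swap`, and the families are exchanged.
  by_cases hq : 0 < CyclideField.accelSq
      (fun y => tangentLift ((f ∘ (Φ p).symm) y) ((N ∘ (Φ p).symm) y) +
        κ₁ p y • halfLift ((f ∘ (Φ p).symm) y))
      (fun y => (κ₁ p y - κ₂ p y)⁻¹ • Y₂ p y) (Φ p p)
  · exact hA.conformalToDupinCyclide hS (hΦ p) (hpΦ p) (hpU p) (C p) (hs p) hq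
  · refine hA.swap.conformalToDupinCyclide (fun r => ?_) (hΦ p) (hpΦ p) (hpU p) (C p).swap
      (fun x hx => (hs p x hx).symm) ?_
    · obtain ⟨c, hc, h⟩ := hS r
      exact ⟨-c, neg_ne_zero.mpr hc, by rw [neg_smul, ← h, neg_sub]⟩
    · rw [(C p).accelSq_swap (hpU p)]
      linarith

end Surfaces

/-! ### One-parameter families of tangent spheres -/

namespace PrincipalField

variable {V : Set E2} {m n : E2 → L5} {l : L5} {k₁ k₂ : E2 → ℝ} {X₁ X₂ : E2 → E2} {x : E2}

theorem dirDeriv_lorentzMap (A : L5 ≃ₗ[ℝ] L5) {g : E2 → L5} (hg : DifferentiableAt ℝ g x)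
    (Y : E2 → E2) : dirDeriv Y (fun y => A (g y)) x = A (dirDeriv Y g x) := by
  have := (A.toContinuousLinearEquiv.toContinuousLinearMap.hasFDerivAt.comp x hg.hasFDerivAt).fderiv
  exact DFunLike.congr_fun this (Y x)

/-- Lorentz transformations preserve principal fields. -/
theorem map (P : PrincipalField V m n l k₁ k₂ X₁ X₂) {A : L5 ≃ₗ[ℝ] L5} (hA : IsLorentz A) :
    PrincipalField V (fun y => A (m y)) (fun y => A (n y)) (A l) k₁ k₂ X₁ X₂ := by
  have sA : ContDiff ℝ ∞ A := A.toContinuousLinearEquiv.contDiff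
  have dm : ∀ Y : E2 → E2, ∀ x ∈ V, dirDeriv Y (fun y => A (m y)) x = A (dirDeriv Y m x) :=
    fun Y x hx => dirDeriv_lorentzMap A (P.smooth_m.differentiableAt_of_isOpen P.isOpen hx) Y
  have dn : ∀ Y : E2 → E2, ∀ x ∈ V, dirDeriv Y (fun y => A (n y)) x = A (dirDeriv Y n x) :=
    fun Y x hx => dirDeriv_lorentzMap A (P.smooth_n.differentiableAt_of_isOpen P.isOpen hx) Y
  exact
  { isOpen := P.isOpen
    smooth_m := sA.comp_contDiffOn P.smooth_m
    smooth_n := sA.comp_contDiffOn P.smooth_n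
    smooth_k₁ := P.smooth_k₁
    smooth_k₂ := P.smooth_k₂
    smooth_X₁ := P.smooth_X₁
    smooth_X₂ := P.smooth_X₂
    lt := P.lt
    mm := fun x hx => by rw [hA, P.mm x hx]
    nm := fun x hx => by rw [hA, P.nm x hx]
    nn := fun x hx => by rw [hA, P.nn x hx]
    ll := by rw [hA, P.ll]
    lm := fun x hx => by rw [hA, P.lm x hx]
    ln := fun x hx => by rw [hA, P.ln x hx]
    ne₁ := fun x hx => by rw [dm X₁ x hx, hA, P.ne₁ x hx]
    ne₂ := fun x hx => by rw [dm X₂ x hx, hA, P.ne₂ x hx]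
    dn₁ := fun x hx => by rw [dm X₁ x hx, dn X₁ x hx, P.dn₁ x hx, map_neg, map_smul]
    dn₂ := fun x hx => by rw [dm X₂ x hx, dn X₂ x hx, P.dn₂ x hx, map_neg, map_smul]
    unit₁ := fun x hx => by rw [dm X₁ x hx, hA, P.unit₁ x hx]
    unit₂ := fun x hx => by rw [dm X₂ x hx, hA, P.unit₂ x hx]
    orth := fun x hx => by rw [dm X₁ x hx, dm X₂ x hx, hA, P.orth x hx] }

/-- Reversing the normal field exchanges the two principal curvatures. -/
theorem reverse (P : PrincipalField V m n l k₁ k₂ X₁ X₂) :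
    PrincipalField V m (fun y => -n y) l (fun y => -k₂ y) (fun y => -k₁ y) X₂ X₁ where
  isOpen := P.isOpen
  smooth_m := P.smooth_m
  smooth_n := P.smooth_n.neg
  smooth_k₁ := P.smooth_k₂.neg
  smooth_k₂ := P.smooth_k₁.neg
  smooth_X₁ := P.smooth_X₂
  smooth_X₂ := P.smooth_X₁
  lt x hx := neg_lt_neg (P.lt x hx)
  mm := P.mm
  nm x hx := by rw [lorentz_neg_left, P.nm x hx, neg_zero]
  nn x hx := by rw [lorentz_neg_left, lorentz_neg_right, P.nn x hx, neg_neg]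
  ll := P.ll
  lm := P.lm
  ln x hx := by rw [lorentz_neg_right, P.ln x hx, neg_zero]
  ne₁ x hx := by rw [lorentz_neg_left, P.ne₂ x hx, neg_zero]
  ne₂ x hx := by rw [lorentz_neg_left, P.ne₁ x hx, neg_zero]
  dn₁ x hx := by rw [dirDeriv_neg, P.dn₂ x hx, neg_smul]
  dn₂ x hx := by rw [dirDeriv_neg, P.dn₁ x hx, neg_smul]
  unit₁ := P.unit₂
  unit₂ := P.unit₁
  orth x hx := by rw [lorentz_comm, P.orth x hx]

/-- A family of spheres tangent to the surface, of constant nonzero norm, that depends on one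
parameter only. -/
structure TangentSphereCurve (V : Set E2) (m : E2 → L5) (X₁ X₂ : E2 → E2) (σ : E2 → L5)
    (c : ℝ) : Prop where
  smooth : ContDiffOn ℝ ∞ σ V
  ne_zero : c ≠ 0
  norm : ∀ x ∈ V, lorentz (σ x) (σ x) = c
  incident : ∀ x ∈ V, lorentz (σ x) (m x) = 0
  tangent₁ : ∀ x ∈ V, lorentz (dirDeriv X₁ σ x) (m x) = 0
  tangent₂ : ∀ x ∈ V, lorentz (dirDeriv X₂ σ x) (m x) = 0
  minor : ∀ x ∈ V, ∀ ξ η : L5, lorentz (dirDeriv X₁ σ x) ξ * lorentz (dirDeriv X₂ σ x) η =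
    lorentz (dirDeriv X₁ σ x) η * lorentz (dirDeriv X₂ σ x) ξ

theorem TangentSphereCurve.reverse {σ : E2 → L5} {c : ℝ} (T : TangentSphereCurve V m X₁ X₂ σ c) :
    TangentSphereCurve V m X₂ X₁ σ c where
  smooth := T.smooth
  ne_zero := T.ne_zero
  norm := T.norm
  incident := T.incident
  tangent₁ := T.tangent₂
  tangent₂ := T.tangent₁
  minor x hx ξ η := by rw [mul_comm, T.minor x hx η ξ, mul_comm]

theorem TangentSphereCurve.smooth_pole {σ : E2 → L5} {c : ℝ}
    (T : TangentSphereCurve V m X₁ X₂ σ c) (l : L5) :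
    ContDiffOn ℝ ∞ (fun y => lorentz (σ y) l) V :=
  T.smooth.lorentz contDiffOn_const

section
variable (P : PrincipalField V m n l k₁ k₂ X₁ X₂) {σ : E2 → L5} {c : ℝ}
  (T : TangentSphereCurve V m X₁ X₂ σ c)
include P T

/-- Differentiating `⟨σ, m⟩ = 0` and using `⟨dσ, m⟩ = 0` shows that `σ` is orthogonal to the tangent
vectors as well. -/
theorem tangentSphere_eq (hx : x ∈ V) :
    σ x = lorentz (σ x) (n x) • n x - lorentz (σ x) l • m x := by
  refine P.tangent_sphere_eq hx (T.incident x hx) ?_ ?_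
  · have := lorentz_dirDeriv_of_const (X := X₁) P.isOpen T.smooth P.smooth_m T.incident hx
    rwa [T.tangent₁ x hx, zero_add] at this
  · have := lorentz_dirDeriv_of_const (X := X₂) P.isOpen T.smooth P.smooth_m T.incident hx
    rwa [T.tangent₂ x hx, zero_add] at this

theorem tangentSphere_normal_sq (hx : x ∈ V) :
    lorentz (σ x) (n x) * lorentz (σ x) (n x) = c := by
  have h := T.norm x hx
  nth_rewrite 1 2 [P.tangentSphere_eq T hx] at h
  simpa [lorentz_sub_left, lorentz_sub_right, lorentz_smul_left, lorentz_smul_right, P.nn x hx,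
    P.mm x hx, P.nm x hx, lorentz_comm (m x) (n x)] using h

theorem tangentSphere_normal_ne_zero (hx : x ∈ V) : lorentz (σ x) (n x) ≠ 0 := by
  intro h
  have := P.tangentSphere_normal_sq T hx
  rw [h, zero_mul] at this
  exact T.ne_zero this.symm

theorem smooth_tangentSphere_normal : ContDiffOn ℝ ∞ (fun y => lorentz (σ y) (n y)) V :=
  T.smooth.lorentz P.smooth_n

theorem d_tangentSphere_normal (Y : E2 → E2) (hx : x ∈ V) :
    dirDeriv Y (fun y => lorentz (σ y) (n y)) x = 0 := by
  have dd := (P.smooth_tangentSphere_normal T).differentiableAt_of_isOpen P.isOpen hx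
  have h := dirDeriv_mul (X := Y) dd dd
  rw [dirDeriv_const_on P.isOpen (fun y hy => P.tangentSphere_normal_sq T hy) hx] at h
  have : lorentz (σ x) (n x) * dirDeriv Y (fun y => lorentz (σ y) (n y)) x = 0 := by linarith
  exact (mul_eq_zero.mp this).resolve_left (P.tangentSphere_normal_ne_zero T hx)

theorem d_tangentSphere (Y : E2 → E2) (hx : x ∈ V) : dirDeriv Y σ x =
    lorentz (σ x) (n x) • dirDeriv Y n x - lorentz (σ x) l • dirDeriv Y m x -
      dirDeriv Y (fun y => lorentz (σ y) l) x • m x := by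
  have dν := (P.smooth_tangentSphere_normal T).differentiableAt_of_isOpen P.isOpen hx
  have dl := (T.smooth_pole l).differentiableAt_of_isOpen P.isOpen hx
  have dn := P.smooth_n.differentiableAt_of_isOpen P.isOpen hx
  have dm := P.smooth_m.differentiableAt_of_isOpen P.isOpen hx
  rw [dirDeriv_congr P.isOpen (fun y hy => P.tangentSphere_eq T hy) hx,
    dirDeriv_sub (dν.fun_smul dn) (dl.fun_smul dm), dirDeriv_smul dν dn, dirDeriv_smul dl dm,
    P.d_tangentSphere_normal T Y hx]
  module

/-- The `e₁, e₂` components of the derivatives of `σ` along `X₁, X₂` form a diagonal matrix with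
entries `-(⟨σ, n⟩ kᵢ + ⟨σ, l⟩)`. For a one-parameter family its determinant vanishes. -/
theorem tangentSphere_cases (hx : x ∈ V) :
    lorentz (σ x) l = -(lorentz (σ x) (n x) * k₁ x) ∨
      lorentz (σ x) l = -(lorentz (σ x) (n x) * k₂ x) := by
  have h := T.minor x hx (dirDeriv X₁ m x) (dirDeriv X₂ m x)
  have o := (lorentz_comm _ _).trans (P.orth x hx)
  simp only [P.d_tangentSphere T _ hx, P.dn₁ x hx, P.dn₂ x hx, lorentz_sub_left, lorentz_smul_left,
    lorentz_neg_left, P.unit₁ x hx, P.unit₂ x hx, P.orth x hx, o, P.m_dirDeriv _ hx] at h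
  have : (lorentz (σ x) l + lorentz (σ x) (n x) * k₁ x) *
      (lorentz (σ x) l + lorentz (σ x) (n x) * k₂ x) = 0 := by linarith
  rcases mul_eq_zero.mp this with h | h
  · left; linarith
  · right; linarith

/-- As `k₁ ≠ k₂`, the same alternative holds nearby and `σ = ν (n + k₁ m)` with `ν = ⟨σ, n⟩` of zero
derivative. Then `X₁ σ = ν (X₁ k₁) m`, while `X₂ σ` has a nonzero `e₂` component. Dependence of the
two derivatives forces `X₁ k₁ = 0`. -/
theorem ridge₁_of_tangentSphere (hx : x ∈ V)
    (h : lorentz (σ x) l = -(lorentz (σ x) (n x) * k₁ x)) : dirDeriv X₁ k₁ x = 0 := by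
  have hν := P.tangentSphere_normal_ne_zero T hx
  have dν := (P.smooth_tangentSphere_normal T).differentiableAt_of_isOpen P.isOpen hx
  have d1 := P.smooth_k₁.differentiableAt_of_isOpen P.isOpen hx
  have near : ∀ᶠ y in nhds x,
      lorentz (σ y) l = -(lorentz (σ y) (n y) * k₁ y) := by
    have hc : ContinuousAt (fun y => lorentz (σ y) l + lorentz (σ y) (n y) * k₂ y) x :=
      (((T.smooth_pole l).add ((P.smooth_tangentSphere_normal T).mul
        P.smooth_k₂)).contDiffAt (P.isOpen.mem_nhds hx)).continuousAt
    have hne : lorentz (σ x) l + lorentz (σ x) (n x) * k₂ x ≠ 0 := by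
      rw [h, show -(lorentz (σ x) (n x) * k₁ x) + lorentz (σ x) (n x) * k₂ x =
        -(lorentz (σ x) (n x) * (k₁ x - k₂ x)) by ring]
      exact neg_ne_zero.mpr (mul_ne_zero hν (P.gap_ne_zero hx))
    filter_upwards [hc.eventually_ne hne, P.isOpen.mem_nhds hx] with y hy hyV
    exact (P.tangentSphere_cases T hyV).resolve_right fun h' => hy (by rw [h']; ring)
  have hd : dirDeriv X₁ (fun y => lorentz (σ y) l) x =
      -(lorentz (σ x) (n x) * dirDeriv X₁ k₁ x) := by
    rw [dirDeriv, Filter.EventuallyEq.fderiv_eq near]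
    change dirDeriv X₁ (fun y => -(lorentz (σ y) (n y) * k₁ y)) x = _
    rw [dirDeriv_neg, dirDeriv_mul dν d1, P.d_tangentSphere_normal T _ hx, zero_mul, add_zero]
  have hm := T.minor x hx l (dirDeriv X₂ m x)
  have ml := (lorentz_comm _ _).trans (P.lm x hx)
  have el := (lorentz_comm _ _).trans (P.l_dirDeriv_m X₁ hx)
  simp only [P.d_tangentSphere T _ hx, P.dn₁ x hx, P.dn₂ x hx, lorentz_sub_left, lorentz_smul_left,
    lorentz_neg_left, P.unit₂ x hx, P.orth x hx, P.m_dirDeriv _ hx, ml, el, hd, h] at hm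
  have : lorentz (σ x) (n x) * lorentz (σ x) (n x) * (k₁ x - k₂ x) * dirDeriv X₁ k₁ x = 0 := by
    linarith
  exact (mul_eq_zero.mp this).resolve_left
    (mul_ne_zero (mul_ne_zero hν hν) (P.gap_ne_zero hx))

theorem ridge₂_of_tangentSphere (hx : x ∈ V)
    (h : lorentz (σ x) l = -(lorentz (σ x) (n x) * k₂ x)) : dirDeriv X₂ k₂ x = 0 := by
  have := P.reverse.ridge₁_of_tangentSphere T.reverse hx (by
    rw [h, lorentz_neg_right]; ring)
  rwa [dirDeriv_neg, neg_eq_zero] at this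

end

/-- If two families of tangent spheres are distinct everywhere, both ridge derivatives vanish. -/
theorem ridge_of_tangentSphereCurves (P : PrincipalField V m n l k₁ k₂ X₁ X₂) {σ σ' : E2 → L5}
    {c c' : ℝ} (T : TangentSphereCurve V m X₁ X₂ σ c) (T' : TangentSphereCurve V m X₁ X₂ σ' c')
    {r : ℝ} (hr : r ≠ 0) (hx : x ∈ V) (h : σ x + σ' x = r • m x) :
    dirDeriv X₁ k₁ x = 0 ∧ dirDeriv X₂ k₂ x = 0 := by
  have hn := congrArg (fun y => lorentz y (n x)) h
  have hl := congrArg (fun y => lorentz y l) h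
  simp only [lorentz_add_left, lorentz_smul_left, lorentz_comm (m x), P.nm x hx, P.lm x hx] at hn hl
  -- If both families belonged to the same curvature, their sum would have zero product with `l`,
  -- whereas `⟨r m, l⟩ = -r`.
  rcases P.tangentSphere_cases T hx with h1 | h1 <;> rcases P.tangentSphere_cases T' hx with h2 | h2
  · rw [h1, h2] at hl
    refine absurd ?_ hr
    linear_combination hl + k₁ x * hn
  · exact ⟨P.ridge₁_of_tangentSphere T hx h1, P.ridge₂_of_tangentSphere T' hx h2⟩
  · exact ⟨P.ridge₁_of_tangentSphere T' hx h2, P.ridge₂_of_tangentSphere T hx h1⟩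
  · rw [h1, h2] at hl
    refine absurd ?_ hr
    linear_combination hl + k₂ x * hn

end PrincipalField

/-! ### Surfaces on a Dupin cyclide -/

/-- Vectors orthogonal to `z` and `n` are multiples of their cross product `u`. The assumption on
`u₀² - u₁² - u₂²` ensures `u ≠ 0`, so any two such vectors are proportional. -/
theorem cross_eq_zero {d₀ d₁ d₂ b₀ b₁ b₂ z₀ z₁ z₂ n₀ n₁ n₂ : ℝ}
    (dz : d₀ * z₀ + d₁ * z₁ + d₂ * z₂ = 0) (dn : d₀ * n₀ + d₁ * n₁ + d₂ * n₂ = 0)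
    (bz : b₀ * z₀ + b₁ * z₁ + b₂ * z₂ = 0) (bn : b₀ * n₀ + b₁ * n₁ + b₂ * n₂ = 0)
    (h : (z₁ * n₂ - z₂ * n₁) ^ 2 - (z₂ * n₀ - z₀ * n₂) ^ 2 - (z₀ * n₁ - z₁ * n₀) ^ 2 ≠ 0) :
    d₀ * b₁ = d₁ * b₀ ∧ d₀ * b₂ = d₂ * b₀ ∧ d₁ * b₂ = d₂ * b₁ := by
  obtain ⟨u₀, hu₀⟩ : ∃ u₀, u₀ = z₁ * n₂ - z₂ * n₁ := ⟨_, rfl⟩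
  obtain ⟨u₁, hu₁⟩ : ∃ u₁, u₁ = z₂ * n₀ - z₀ * n₂ := ⟨_, rfl⟩
  obtain ⟨u₂, hu₂⟩ : ∃ u₂, u₂ = z₀ * n₁ - z₁ * n₀ := ⟨_, rfl⟩
  rw [← hu₀, ← hu₁, ← hu₂] at h
  have d01 : d₀ * u₁ = d₁ * u₀ := by rw [hu₀, hu₁]; linear_combination z₂ * dn - n₂ * dz
  have d02 : d₀ * u₂ = d₂ * u₀ := by rw [hu₀, hu₂]; linear_combination n₁ * dz - z₁ * dn
  have d12 : d₁ * u₂ = d₂ * u₁ := by rw [hu₁, hu₂]; linear_combination z₀ * dn - n₀ * dz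
  have b01 : b₀ * u₁ = b₁ * u₀ := by rw [hu₀, hu₁]; linear_combination z₂ * bn - n₂ * bz
  have b02 : b₀ * u₂ = b₂ * u₀ := by rw [hu₀, hu₂]; linear_combination n₁ * bz - z₁ * bn
  have b12 : b₁ * u₂ = b₂ * u₁ := by rw [hu₁, hu₂]; linear_combination z₀ * bn - n₀ * bz
  have key : ∀ c : ℝ, u₀ * c = 0 → u₁ * c = 0 → u₂ * c = 0 → c = 0 := by
    intro c h0 h1 h2
    refine (mul_eq_zero.mp (?_ : (u₀ ^ 2 - u₁ ^ 2 - u₂ ^ 2) * c = 0)).resolve_left h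
    linear_combination u₀ * h0 - u₁ * h1 - u₂ * h2
  refine ⟨sub_eq_zero.mp (key _ ?_ ?_ ?_), sub_eq_zero.mp (key _ ?_ ?_ ?_),
    sub_eq_zero.mp (key _ ?_ ?_ ?_)⟩
  · linear_combination d₀ * -b01 + b₀ * d01
  · linear_combination b₁ * d01 - d₁ * b01
  · linear_combination b₁ * d02 - b₀ * d12 - d₂ * b01
  · linear_combination b₀ * d02 - d₀ * b02
  · linear_combination b₂ * d01 + b₀ * d12 - d₁ * b02
  · linear_combination b₂ * d02 - d₂ * b02
  · linear_combination b₁ * d02 - b₂ * d01 - d₀ * b12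
  · linear_combination b₁ * d12 - d₁ * b12
  · linear_combination b₂ * d12 - d₂ * b12

namespace PrincipalField

variable {V : Set E2} {m n : E2 → L5} {l : L5} {k₁ k₂ : E2 → ℝ} {X₁ X₂ : E2 → E2} {x : E2}

/-- A surface that lies on the cyclide `y₁² + y₂² = ⟨y, n₀⟩²` has vanishing ridge derivatives. -/
theorem ridge_of_cyclide (P : PrincipalField V m n l k₁ k₂ X₁ X₂) {n₀ : L5} (h₁ : n₀ 1 = 0)
    (h₂ : n₀ 2 = 0) (hn : 0 < 1 + lorentz n₀ n₀) (hL : ∀ x ∈ V, lorentz (m x) n₀ ≠ 0)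
    (hq : ∀ x ∈ V, m x 1 ^ 2 + m x 2 ^ 2 = lorentz (m x) n₀ ^ 2) (hx : x ∈ V) :
    dirDeriv X₁ k₁ x = 0 ∧ dirDeriv X₂ k₂ x = 0 := by
  obtain ⟨L, hLdef⟩ : ∃ L : E2 → ℝ, L = fun x => lorentz (m x) n₀ := ⟨_, rfl⟩
  -- The normalized point `m / L` splits as `w + z`: `w` lies on the unit circle of the plane of
  -- coordinates `1, 2`, and `z` in the orthogonal Lorentz three-space on the conic `⟨z, z⟩ = -1`,
  -- `⟨z, n₀⟩ = 1`. The tangent spheres sought are `w - n₀` and `z + n₀`, with sum `m / L`.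
  obtain ⟨w, hw⟩ : ∃ w : E2 → L5, w = fun x => ![0, m x 1 / L x, m x 2 / L x, 0, 0] := ⟨_, rfl⟩
  obtain ⟨z, hz⟩ : ∃ z : E2 → L5, z = fun x => (L x)⁻¹ • m x - w x := ⟨_, rfl⟩
  have hL0 : ∀ x ∈ V, L x ≠ 0 := fun x hx => by rw [hLdef]; exact hL x hx
  have hq' : ∀ x ∈ V, m x 1 ^ 2 + m x 2 ^ 2 = L x ^ 2 := fun x hx => by rw [hLdef]; exact hq x hx
  have hLn : ∀ x, lorentz (m x) n₀ = L x := fun x => by rw [hLdef]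
  have sL : ContDiffOn ℝ ∞ L V := by rw [hLdef]; exact P.smooth_m.lorentz contDiffOn_const
  have sm : ∀ i, ContDiffOn ℝ ∞ (fun y => m y i) V := contDiffOn_pi.mp P.smooth_m
  have sw : ContDiffOn ℝ ∞ w V := by
    rw [hw, contDiffOn_pi]
    intro i
    fin_cases i
    exacts [contDiffOn_const, (sm 1).div sL hL0, (sm 2).div sL hL0, contDiffOn_const,
      contDiffOn_const]
  have sz : ContDiffOn ℝ ∞ z V := by
    rw [hz]; exact ((sL.inv hL0).smul P.smooth_m).sub sw
  have w0 : ∀ x, w x 0 = 0 := fun x => by rw [hw]; rfl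
  have w1 : ∀ x, w x 1 = m x 1 / L x := fun x => by rw [hw]; rfl
  have w2 : ∀ x, w x 2 = m x 2 / L x := fun x => by rw [hw]; rfl
  have w3 : ∀ x, w x 3 = 0 := fun x => by rw [hw]; rfl
  have w4 : ∀ x, w x 4 = 0 := fun x => by rw [hw]; rfl
  have z1 : ∀ x, z x 1 = 0 := fun x => by
    rw [hz]; simp only [Pi.sub_apply, Pi.smul_apply, smul_eq_mul, w1]; ring
  have z2 : ∀ x, z x 2 = 0 := fun x => by
    rw [hz]; simp only [Pi.sub_apply, Pi.smul_apply, smul_eq_mul, w2]; ring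
  have wm : ∀ x ∈ V, lorentz (w x) (m x) = L x := fun x hx => by
    have := hL0 x hx
    simp only [lorentz, w0, w1, w2, w3, w4]
    field_simp
    linear_combination hq' x hx
  have ww : ∀ x ∈ V, lorentz (w x) (w x) = 1 := fun x hx => by
    have := hL0 x hx
    simp only [lorentz, w0, w1, w2, w3, w4]
    field_simp
    linear_combination hq' x hx
  have wn : ∀ x, lorentz (w x) n₀ = 0 := fun x => by
    simp [lorentz, w0, w3, w4, h₁, h₂]
  have mz : ∀ x ∈ V, m x = L x • (z x + w x) := fun x hx => by
    rw [hz]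
    simp only [sub_add_cancel, smul_smul, mul_inv_cancel₀ (hL0 x hx), one_smul]
  have zn : ∀ x ∈ V, lorentz (z x) n₀ = 1 := fun x hx => by
    rw [hz]
    simp only [lorentz_sub_left, lorentz_smul_left, hLn, wn]
    rw [inv_mul_cancel₀ (hL0 x hx), sub_zero]
  have wz : ∀ x ∈ V, lorentz (z x) (w x) = 0 := fun x hx => by
    simp [lorentz, w0, w3, w4, z1, z2]
  have zz : ∀ x ∈ V, lorentz (z x) (z x) = -1 := fun x hx => by
    have h := P.mm x hx
    rw [mz x hx, lorentz_smul_left, lorentz_smul_right] at h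
    have h := (mul_eq_zero.mp ((mul_eq_zero.mp h).resolve_left (hL0 x hx))).resolve_left (hL0 x hx)
    simp only [lorentz_add_left, lorentz_add_right, lorentz_comm (w x) (z x), wz x hx, ww x hx] at h
    linarith
  have comp : ∀ {g : E2 → L5}, ContDiffOn ℝ ∞ g V → ∀ (i : Fin 5), (∀ x, g x i = 0) →
      ∀ (Y : E2 → E2), ∀ x ∈ V, dirDeriv Y g x i = 0 := fun hg i h Y x hx => by
    rw [dirDeriv_apply_L5 (hg.differentiableAt_of_isOpen P.isOpen hx)]
    exact dirDeriv_const_on P.isOpen (fun y _ => h y) hx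
  have dzn : ∀ (Y : E2 → E2), ∀ x ∈ V, lorentz (dirDeriv Y z x) n₀ = 0 := fun Y x hx => by
    have := lorentz_dirDeriv_of_const (X := Y) (g' := fun _ => n₀) P.isOpen sz contDiffOn_const zn hx
    rwa [dirDeriv_const_on P.isOpen (g := fun _ => n₀) (fun _ _ => rfl) hx, lorentz_zero_right,
      add_zero] at this
  have dzz : ∀ (Y : E2 → E2), ∀ x ∈ V, lorentz (dirDeriv Y z x) (z x) = 0 := fun Y x hx => by
    rw [lorentz_comm]; exact lorentz_self_dirDeriv_of_const P.isOpen sz zz hx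
  have dww : ∀ (Y : E2 → E2), ∀ x ∈ V, lorentz (dirDeriv Y w x) (w x) = 0 := fun Y x hx => by
    rw [lorentz_comm]; exact lorentz_self_dirDeriv_of_const P.isOpen sw ww hx
  have dσ : ∀ (Y : E2 → E2), ∀ x ∈ V, dirDeriv Y (fun y => w y - n₀) x = dirDeriv Y w x :=
    fun Y x hx => by
      rw [dirDeriv_sub (sw.differentiableAt_of_isOpen P.isOpen hx) (differentiableAt_const _),
        dirDeriv_const_on P.isOpen (g := fun _ => n₀) (fun _ _ => rfl) hx, sub_zero]
  have dσ' : ∀ (Y : E2 → E2), ∀ x ∈ V, dirDeriv Y (fun y => z y + n₀) x = dirDeriv Y z x :=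
    fun Y x hx => by
      rw [dirDeriv_add (sz.differentiableAt_of_isOpen P.isOpen hx) (differentiableAt_const _),
        dirDeriv_const_on P.isOpen (g := fun _ => n₀) (fun _ _ => rfl) hx, add_zero]
  have dwm : ∀ (Y : E2 → E2), ∀ x ∈ V, lorentz (dirDeriv Y w x) (m x) = 0 := fun Y x hx => by
    rw [mz x hx, lorentz_smul_right, lorentz_add_right, dww Y x hx]
    simp [lorentz, comp sw 0 w0 Y x hx, comp sw 3 w3 Y x hx, comp sw 4 w4 Y x hx, z1, z2]
  have dzm : ∀ (Y : E2 → E2), ∀ x ∈ V, lorentz (dirDeriv Y z x) (m x) = 0 := fun Y x hx => by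
    rw [mz x hx, lorentz_smul_right, lorentz_add_right, dzz Y x hx]
    simp [lorentz, comp sz 1 z1 Y x hx, comp sz 2 z2 Y x hx, w0, w3, w4]
  have mn := fun x => (lorentz_comm n₀ (m x)).trans (hLn x)
  have T : TangentSphereCurve V m X₁ X₂ (fun y => w y - n₀) (1 + lorentz n₀ n₀) :=
    { smooth := sw.sub contDiffOn_const
      ne_zero := hn.ne'
      norm := fun x hx => by
        simp [lorentz_sub_left, lorentz_sub_right, ww x hx, wn, lorentz_comm n₀ (w x)]
      incident := fun x hx => by rw [lorentz_sub_left, wm x hx, mn, sub_self]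
      tangent₁ := fun x hx => by rw [dσ _ x hx, dwm _ x hx]
      tangent₂ := fun x hx => by rw [dσ _ x hx, dwm _ x hx]
      minor := fun x hx ξ η => by
        rw [dσ _ x hx, dσ _ x hx]
        have a := dww X₁ x hx
        have b := dww X₂ x hx
        have c := ww x hx
        simp only [lorentz, w0, w3, w4, comp sw 0 w0 _ x hx, comp sw 3 w3 _ x hx,
          comp sw 4 w4 _ x hx] at a b c ⊢
        generalize dirDeriv X₁ w x 1 = d₁ at *
        generalize dirDeriv X₁ w x 2 = d₂ at *
        generalize dirDeriv X₂ w x 1 = b₁ at *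
        generalize dirDeriv X₂ w x 2 = b₂ at *
        -- Both derivatives of `w` are orthogonal to `w` in a Euclidean plane, hence parallel.
        have hmin : d₁ * b₂ - d₂ * b₁ = 0 := by
          linear_combination (w x 1 * b₂ - w x 2 * b₁) * a + (w x 2 * d₁ - w x 1 * d₂) * b -
            (d₁ * b₂ - d₂ * b₁) * c
        linear_combination (ξ 1 * η 2 - ξ 2 * η 1) * hmin }
  have T' : TangentSphereCurve V m X₁ X₂ (fun y => z y + n₀) (1 + lorentz n₀ n₀) :=
    { smooth := sz.add contDiffOn_const
      ne_zero := hn.ne'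
      norm := fun x hx => by
        simp only [lorentz_add_left, lorentz_add_right, zz x hx, zn x hx,
          lorentz_comm n₀ (z x)]
        ring
      incident := fun x hx => by
        have : lorentz (z x) (m x) = -L x := by
          rw [mz x hx, lorentz_smul_right, lorentz_add_right, zz x hx, wz x hx]; ring
        rw [lorentz_add_left, this, mn]; ring
      tangent₁ := fun x hx => by rw [dσ' _ x hx, dzm _ x hx]
      tangent₂ := fun x hx => by rw [dσ' _ x hx, dzm _ x hx]
      minor := fun x hx ξ η => by
        rw [dσ' _ x hx, dσ' _ x hx]
        have a := dzz X₁ x hx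
        have b := dzz X₂ x hx
        have a' := dzn X₁ x hx
        have b' := dzn X₂ x hx
        have c := zz x hx
        have c' := zn x hx
        have hn' := hn.ne'
        simp only [lorentz, z1, z2, comp sz 1 z1 _ x hx, comp sz 2 z2 _ x hx, h₁, h₂]
          at a b a' b' c c' hn' ⊢
        -- Both derivatives of `z` are orthogonal to `z` and `n₀` in a three-space. The Gram
        -- determinant of `z, n₀` is `-(1 + ⟨n₀, n₀⟩) ≠ 0`. The sign of the timelike entry is
        -- changed to write Lorentz products as Euclidean ones.
        obtain ⟨e1, e2, e3⟩ := cross_eq_zero (d₀ := -dirDeriv X₁ z x 0) (d₁ := dirDeriv X₁ z x 3)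
          (d₂ := dirDeriv X₁ z x 4) (b₀ := -dirDeriv X₂ z x 0) (b₁ := dirDeriv X₂ z x 3)
          (b₂ := dirDeriv X₂ z x 4) (z₀ := z x 0) (z₁ := z x 3) (z₂ := z x 4) (n₀ := n₀ 0)
          (n₁ := n₀ 3) (n₂ := n₀ 4) (by linarith) (by linarith) (by linarith) (by linarith) (by
            intro h
            refine hn' ?_
            linear_combination -h + (-(n₀ 0 * n₀ 0) + n₀ 3 * n₀ 3 + n₀ 4 * n₀ 4) * c -
              (-(z x 0 * n₀ 0) + z x 3 * n₀ 3 + z x 4 * n₀ 4 + 1) * c')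
        linear_combination (ξ 0 * η 3 - ξ 3 * η 0) * e1 + (ξ 0 * η 4 - ξ 4 * η 0) * e2 +
          (ξ 3 * η 4 - ξ 4 * η 3) * e3 }
  refine P.ridge_of_tangentSphereCurves T T' (inv_ne_zero (hL0 x hx)) hx ?_
  rw [hz]
  change w x - n₀ + ((L x)⁻¹ • m x - w x + n₀) = (L x)⁻¹ • m x
  module

end PrincipalField

/-- The points of the three standard cyclides satisfy an equation `y₁² + y₂² = ⟨y, n₀⟩²`. -/
theorem IsStandardCyclide.exists_equation {D : Set L5} (hD : IsStandardCyclide D) :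
    ∃ n₀ : L5, n₀ 1 = 0 ∧ n₀ 2 = 0 ∧ 0 < 1 + lorentz n₀ n₀ ∧ ∀ y ∈ D,
      lorentz y n₀ ≠ 0 ∧ y 1 ^ 2 + y 2 ^ 2 = lorentz y n₀ ^ 2 := by
  have scale : ∀ {n₀ : L5} {c : ℝ} {y : L5}, c ≠ 0 →
      (lorentz y n₀ ≠ 0 ∧ y 1 ^ 2 + y 2 ^ 2 = lorentz y n₀ ^ 2) →
      lorentz (c • y) n₀ ≠ 0 ∧ (c • y) 1 ^ 2 + (c • y) 2 ^ 2 = lorentz (c • y) n₀ ^ 2 := by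
    rintro n₀ c y hc ⟨h1, h2⟩
    rw [lorentz_smul_left]
    refine ⟨mul_ne_zero hc h1, ?_⟩
    simp only [Pi.smul_apply, smul_eq_mul]
    linear_combination c ^ 2 * h2
  have hpos : ∀ x : E3, (lightLift x 0)⁻¹ ≠ 0 := fun x => by
    have : lightLift x 0 = ‖x‖ ^ 2 + 1 := rfl
    rw [this]; positivity
  -- The vector `n₀` is timelike, null or spacelike; `1 + ⟨n₀, n₀⟩` equals `1 - a²`, `1` and `1 +
  -- m²`.
  rcases hD with ⟨a, ha, ha1, rfl⟩ | ⟨r, hr, rfl⟩ | ⟨m, hm, rfl⟩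
  · refine ⟨![a, 0, 0, 0, 0], rfl, rfl, by simp [lorentz]; nlinarith, ?_⟩
    rintro y ⟨⟨-, hy0⟩, hy⟩
    have : lorentz y ![a, 0, 0, 0, 0] = -a := by simp [lorentz, hy0]
    rw [this, hy]
    exact ⟨neg_ne_zero.mpr ha.ne', by ring⟩
  · refine ⟨![r, 0, 0, 0, r], rfl, rfl, by simp [lorentz], ?_⟩
    rintro - ⟨x, hx, rfl⟩
    refine scale (hpos x) ?_
    have : lorentz (lightLift x) ![r, 0, 0, 0, r] = -(2 * r) := by
      simp [lorentz, lightLift]; ring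
    rw [this]
    refine ⟨neg_ne_zero.mpr (by positivity), ?_⟩
    simp only [lightLift, Matrix.cons_val]
    have hx' : x 0 ^ 2 + x 1 ^ 2 = r ^ 2 := hx
    linear_combination 4 * hx'
  · refine ⟨![0, 0, 0, m, 0], rfl, rfl, by simp [lorentz]; nlinarith, ?_⟩
    rintro - ⟨x, ⟨hx, hx2⟩, rfl⟩
    refine scale (hpos x) ?_
    have : lorentz (lightLift x) ![0, 0, 0, m, 0] = 2 * x 2 * m := by
      simp [lorentz, lightLift]
    rw [this]
    refine ⟨by positivity, ?_⟩
    simp only [lightLift, Matrix.cons_val]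
    linear_combination 4 * hx

/-! ### Comparison of all conditions with `RidgesVanish`. -/

section Surfaces

variable {M : Type*} [TopologicalSpace M] [ChartedSpace E2 M] [IsManifold (𝓡 2) ∞ M]
  {f N : M → E3}

theorem ConformalToDupinCyclide.ridgesVanish (hf : IsOrientedSurface f N)
    (hu : ∀ p, ¬ IsUmbilic f N p) (h : ConformalToDupinCyclide f) : RidgesVanish f N := by
  obtain ⟨D, hD, A, hA, hmem⟩ := h
  obtain ⟨n₀, h1, h2, hn, hDn⟩ := hD.exists_equation
  intro p
  obtain ⟨φ, V, k₁, k₂, X₁, X₂, hφ, hp, hpV, hV, P⟩ := exists_frameField_chart hf hu p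
  refine ⟨φ, V, k₁, k₂, X₁, X₂, hφ, hp, hpV, hV, P, fun x hx => ?_⟩
  have hpt : ∀ q, lorentz (A (halfLift (f q))) n₀ ≠ 0 ∧
      A (halfLift (f q)) 1 ^ 2 + A (halfLift (f q)) 2 ^ 2 =
        lorentz (A (halfLift (f q))) n₀ ^ 2 := fun q => by
    obtain ⟨e1, e2⟩ := hDn _ (hmem q)
    rw [show lightLift (f q) = (2 : ℝ) • halfLift (f q) by simp [halfLift], map_smul,
      toSphere_smul two_ne_zero, toSphere, lorentz_smul_left] at e1 e2
    obtain ⟨c0, c1⟩ := mul_ne_zero_iff.mp e1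
    refine ⟨c1, ?_⟩
    simp only [Pi.smul_apply, smul_eq_mul] at e2
    refine mul_left_cancel₀ (pow_ne_zero 2 c0) ?_
    linear_combination e2
  exact (P.toPrincipalField.map hA).ridge_of_cyclide h1 h2 hn (fun y _ => (hpt _).1)
    (fun y _ => (hpt _).2) hx

omit [IsManifold (𝓡 2) ∞ M] in
theorem RidgesVanish.leavesAreDarboux (hf : IsOrientedSurface f N) (h : RidgesVanish f N) (α : ℝ) :
    LeavesAreDarboux f N α univ := by
  refine leavesAreDarboux_of_ridge hf (fun p _ => ?_) α
  obtain ⟨φ, V, k₁, k₂, X₁, X₂, hφ, hp, hpV, hV, P, hd⟩ := h p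
  exact ⟨φ, V, k₁, k₂, X₁, X₂, hφ, hp, hpV, P, (hd _ hpV).1, (hd _ hpV).2⟩

theorem ridgesVanish_of_leavesAreDarboux (hf : IsOrientedSurface f N)
    (hu : ∀ p, ¬ IsUmbilic f N p) {α : ℝ} (hα : α ∈ Ioo (-(Real.pi / 2)) (Real.pi / 2))
    (hα0 : α ≠ 0) (h : LeavesAreDarboux f N α univ) : RidgesVanish f N := by
  intro p
  obtain ⟨φ, V, k₁, k₂, X₁, X₂, hφ, hp, hpV, hV, P⟩ := exists_frameField_chart hf hu p
  exact ⟨φ, V, k₁, k₂, X₁, X₂, hφ, hp, hpV, hV, P, fun x hx =>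
    P.ridge_of_leavesAreDarboux hf hφ hV (mapsTo_univ _ _) hα hα0 h hx⟩

theorem ridgesVanish_iff_exists_isPrincipalChart (hf : IsOrientedSurface f N) :
    RidgesVanish f N ↔ ∀ p, ∃ (φ : OpenPartialHomeomorph M E2) (k₁ k₂ : E2 → ℝ),
      p ∈ φ.source ∧ IsPrincipalChart f N φ k₁ k₂ ∧ RidgeDerivativesVanish φ k₁ k₂ := by
  refine forall_congr' fun p => ⟨?_, ?_⟩
  · rintro ⟨φ, V, k₁, k₂, X₁, X₂, hφ, hp, hpV, hV, P, hd⟩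
    exact P.exists_isPrincipalChart hφ (fun x hx => (hd x hx).1) (fun x hx => (hd x hx).2) hp hpV
  · rintro ⟨φ, k₁, k₂, hp, h, hd⟩
    obtain ⟨X₁, X₂, P, hiff⟩ := h.exists_frameField hf
    exact ⟨φ, φ.target, k₁, k₂, X₁, X₂, h.chart, hp, φ.map_source hp, subset_rfl, P, hiff.mp hd⟩

end Surfaces

theorem exists_angle_of_forall {Q : ℝ → Prop}
    (h : ∀ α ∈ Ioo (-(Real.pi / 2)) (Real.pi / 2), Q α) :
    ∃ α ∈ Ioo (-(Real.pi / 2)) (Real.pi / 2), α ≠ 0 ∧ Q α := by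
  have hπ := Real.pi_pos
  have hα : Real.pi / 4 ∈ Ioo (-(Real.pi / 2)) (Real.pi / 2) := ⟨by linarith, by linarith⟩
  exact ⟨Real.pi / 4, hα, by positivity, h _ hα⟩

theorem proposition6 {M : Type*} [TopologicalSpace M] [ChartedSpace E2 M]
    [IsManifold (𝓡 2) ∞ M] [ConnectedSpace M] (f N : M → E3)
    (hf : IsOrientedSurface f N) (hu : ∀ p, ¬ IsUmbilic f N p) :
    List.TFAE [
      ∀ α ∈ Ioo (-(Real.pi / 2)) (Real.pi / 2), LeavesAreDarboux f N α univ,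
      ∃ α ∈ Ioo (-(Real.pi / 2)) (Real.pi / 2), α ≠ 0 ∧ LeavesAreDarboux f N α univ,
      ConformalToDupinCyclide f,
      ∀ p, ∃ (φ : OpenPartialHomeomorph M E2) (k₁ k₂ : E2 → ℝ),
        p ∈ φ.source ∧ IsPrincipalChart f N φ k₁ k₂ ∧ RidgeDerivativesVanish φ k₁ k₂] ∧
    ∀ (φ : OpenPartialHomeomorph M E2) (k₁ k₂ : E2 → ℝ), IsPrincipalChart f N φ k₁ k₂ →
      List.TFAE [
        ∀ α ∈ Ioo (-(Real.pi / 2)) (Real.pi / 2), LeavesAreDarboux f N α φ.source,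
        ∃ α ∈ Ioo (-(Real.pi / 2)) (Real.pi / 2), α ≠ 0 ∧ LeavesAreDarboux f N α φ.source,
        RidgeDerivativesVanish φ k₁ k₂] := by
  constructor
  · rw [← ridgesVanish_iff_exists_isPrincipalChart hf]
    tfae_have 1 → 2 := exists_angle_of_forall
    tfae_have 2 → 4 := fun ⟨_, hα, hα0, h⟩ => ridgesVanish_of_leavesAreDarboux hf hu hα hα0 h
    tfae_have 4 → 1 := fun h α _ => h.leavesAreDarboux hf α
    tfae_have 4 → 3 := fun h => h.conformalToDupinCyclide hf
    tfae_have 3 → 4 := fun h => h.ridgesVanish hf hu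
    tfae_finish
  · intro φ k₁ k₂ h
    -- The unit fields of the given chart are multiples of its coordinate fields by nonvanishing
    -- functions, so the ridge condition can be tested on either.
    obtain ⟨X₁, X₂, P, hiff⟩ := h.exists_frameField hf
    tfae_have 1 → 2 := exists_angle_of_forall
    tfae_have 2 → 3 := fun ⟨_, hα, hα0, hl⟩ => hiff.mpr fun _ hx =>
      P.ridge_of_leavesAreDarboux hf h.chart subset_rfl φ.mapsTo_symm hα hα0 hl hx
    tfae_have 3 → 1 := fun hd α _ => leavesAreDarboux_of_ridge hf (fun p hp =>
      ⟨φ, φ.target, k₁, k₂, X₁, X₂, h.chart, hp, φ.map_source hp, P,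
        hiff.mp hd _ (φ.map_source hp)⟩) α
    tfae_finish
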